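/- Let $k$ be an algebraically closed field of characteristic $0$, let $h\ge 2$, $R=k[[x_1,\dots,x_h]]$, and let $s,t$ be integers with $t\ge 2$ and $s\ge 2t$. An Artinian local ring $(A,\mathfrak m)$ is called almost stretched if $\mathfrak m^2$ is minimally generated by two elements, and it is Gorenstein if its socle $(0:\mathfrak m)$ is one-dimensional over $A/\mathfrak m$. A quotient $A=R/I$ is of type $(s,t)$ if its Hilbert function $H_A(j)=\dim_{A/\mathfrak m}\mathfrak m^j/\mathfrak m^{j+1}$ satisfies $H_A(0)=1$, $H_A(1)=h$, $H_A(j)=2$ for $2\le j\le t$, $H_A(j)=1$ for $t+1\le j\le s$, and $H_A(j)=0$ for $j>s$. Two ideals $I,J$ of $R$ are called isomorphic if $R/I$ and $R/J$ are isomorphic $k$-algebras. For an integer $p\ge 0$ and $z\in R$ let $I_{p,z}$ be the ideal of $R$ generated by the products $x_ix_j$ with $1\le i<j\le h$, $(i,j)\ne(1,2)$, by $x_j^2-x_1^s$ for $3\le j\le h$, by $x_2^2-x_1^{p+1}x_2-z\,x_1^{s-t+1}$ and by $x_1^tx_2$. The pair $(s,t)$ is called regular if there is no integer $r$ with $0\le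 r\le t-2$ and $2(r+1)=s-t+1$. Theorem. Let $I$ be an ideal of $R$ such that $R/I$ is almost stretched and Gorenstein of type $(s,t)$. (1) If $(s,t)$ is regular, then $I$ is isomorphic to one and only one of the ideals $I_{0,1},I_{1,1},\dots,I_{t-1,1}$. (2) If $(s,t)$ is not regular and $r$ is the integer with $0\le r\le t-2$ and $2(r+1)=s-t+1$, then $I$ is isomorphic to one and only one of the following ideals: $I_{p,1}$ with $0\le p\le t-1$, $p\ne r$; $I_{r,c}$ with $c\in k^*$; $I_{r,c+x_1^d}$ with $c\in k^*$ and $1\le d\le t-r-2$. (The last families are absent if $r=t-2$; different parameters count as different members of the list.) Consequence. There is a family of complete intersections of codimension two and length $10$ with infinitely many isomorphism classes: for $h=2$ and $(s,t)=(6,3)$, for every $c$ in the infinite set $k^*$, the ideal $I_{1,c}=(x_2^2-x_1^2x_2-c\,x_1^4,\;x_1^3x_2)$ of $k[[x_1,x_2]]$ is generated by a regular sequence of length two, its quotient has length $10$ and is almost stretched and Gorenstein of type $(6,3)$, and $I_{1,c}$ and $I_{1,c'}$ are not isomorphic for $c\ne c'$ in $k^*$. -/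

import Mathlib

namespace AlmostStretched

section LocalRings

variable (A : Type*) [CommRing A] [IsLocalRing A]

/-- The Hilbert function of a local ring `A` with maximal ideal `m`: the dimension of
`m ^ j / m ^ (j + 1)` over the residue field `A / m`. -/
noncomputable def hilbertFn (j : ℕ) : ℕ :=
  Module.finrank (A ⧸ IsLocalRing.maximalIdeal A)
    (↥(IsLocalRing.maximalIdeal A ^ j) ⧸
      (IsLocalRing.maximalIdeal A • ⊤ : Submodule A ↥(IsLocalRing.maximalIdeal A ^ j)))

/-- An Artinian local ring is almost stretched if the minimal number of generators of the square
of its maximal ideal is two. -/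
def IsAlmostStretched : Prop :=
  IsArtinianRing A ∧ (IsLocalRing.maximalIdeal A ^ 2).spanFinrank = 2

/-- An Artinian local ring is Gorenstein if its socle `(0 : m)` is one-dimensional over the residue
field, that is, a simple module. -/
def IsArtinGorenstein : Prop :=
  IsArtinianRing A ∧
    IsSimpleModule A ↥(Module.annihilator A ↥(IsLocalRing.maximalIdeal A))

/-- The Hilbert function of `A` is `(1, h, 2, …, 2, 1, …, 1)`, with the last `2` in degree `t` and
the last `1` in degree `s`. -/
def HasType (h s t : ℕ) : Prop :=
  hilbertFn A 0 = 1 ∧ hilbertFn A 1 = h ∧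
    (∀ j, 2 ≤ j → j ≤ t → hilbertFn A j = 2) ∧
    (∀ j, t + 1 ≤ j → j ≤ s → hilbertFn A j = 1) ∧
    (∀ j, s < j → hilbertFn A j = 0)

end LocalRings

/-- `A` is a local ring that is almost stretched and Gorenstein of type `(s, t)`, with embedding
dimension `h`. -/
def IsAlmostStretchedGorenstein (A : Type*) [CommRing A] (h s t : ℕ) : Prop :=
  ∃ _ : IsLocalRing A, IsAlmostStretched A ∧ IsArtinGorenstein A ∧ HasType A h s t

/-- `(s, t)` is regular if there is no integer `r` with `0 ≤ r ≤ t - 2` and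
`2 (r + 1) = s - t + 1` (written without subtraction). -/
def RegularPair (s t : ℕ) : Prop :=
  ¬ ∃ r : ℕ, r + 2 ≤ t ∧ 2 * (r + 1) + t = s + 1

section PowerSeries

variable {k : Type*} [Field k] {h : ℕ}

/-- Two ideals of `k[[x_1, …, x_h]]` are isomorphic if their quotients are isomorphic
`k`-algebras. -/
def IdealIso (I J : Ideal (MvPowerSeries (Fin h) k)) : Prop :=
  Nonempty ((MvPowerSeries (Fin h) k ⧸ I) ≃ₐ[k] (MvPowerSeries (Fin h) k ⧸ J))

/-- The variable `x_1` (index `0`). -/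
noncomputable def x₁ (hh : 2 ≤ h) : MvPowerSeries (Fin h) k :=
  MvPowerSeries.X ⟨0, by omega⟩

/-- The variable `x_2` (index `1`). -/
noncomputable def x₂ (hh : 2 ≤ h) : MvPowerSeries (Fin h) k :=
  MvPowerSeries.X ⟨1, by omega⟩

/-- The ideal `I_{p,z}` of `k[[x_1, …, x_h]]` generated by `x_i x_j` for `i < j`,
`(i, j) ≠ (1, 2)`, by `x_j ^ 2 - x_1 ^ s` for `j ≥ 3`, by
`x_2 ^ 2 - x_1 ^ (p + 1) x_2 - z x_1 ^ (s - t + 1)` and by `x_1 ^ t x_2`.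
The `Fin h` indices start at `0`, so they are one less than those of the variables. It is meant for
`t ≤ s`. -/
noncomputable def modelIdeal (hh : 2 ≤ h) (s t p : ℕ) (z : MvPowerSeries (Fin h) k) :
    Ideal (MvPowerSeries (Fin h) k) :=
  Ideal.span
    ({f | ∃ i j : Fin h, i < j ∧ ¬ (i.val = 0 ∧ j.val = 1) ∧
        f = MvPowerSeries.X i * MvPowerSeries.X j} ∪
      {f | ∃ j : Fin h, 2 ≤ j.val ∧ f = MvPowerSeries.X j ^ 2 - x₁ hh ^ s} ∪
      {x₂ hh ^ 2 - x₁ hh ^ (p + 1) * x₂ hh - z * x₁ hh ^ (s - t + 1), x₁ hh ^ t * x₂ hh})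

/-- The parameters `(p, z)` of the models `I_{0,1}, …, I_{t-1,1}`. -/
def regularParams (k : Type*) [Field k] (h t : ℕ) : Set (ℕ × MvPowerSeries (Fin h) k) :=
  {q | q.1 < t ∧ q.2 = 1}

/-- The parameters `(p, z)` of the models of a pair `(s, t)` that is not regular: the sporadic
`(p, 1)` with `p < t`, `p ≠ r`, then `(r, c)` with `c ≠ 0`, and `(r, c + x_1 ^ d)` with `c ≠ 0` and
`1 ≤ d ≤ t - r - 2`. -/
def nonregularParams (k : Type*) [Field k] {h : ℕ} (hh : 2 ≤ h) (t r : ℕ) :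
    Set (ℕ × MvPowerSeries (Fin h) k) :=
  {q | (q.1 < t ∧ q.1 ≠ r ∧ q.2 = 1) ∨
    (q.1 = r ∧ ∃ c : k, c ≠ 0 ∧ q.2 = MvPowerSeries.C c) ∨
    (q.1 = r ∧ ∃ c : k, c ≠ 0 ∧ ∃ d : ℕ, 1 ≤ d ∧ d + r + 2 ≤ t ∧
      q.2 = MvPowerSeries.C c + x₁ hh ^ d)}

/-- `I` is generated by a regular sequence of length two, so that `R / I` is a complete
intersection of codimension two. -/
def IsCodimTwoCompleteIntersection {R : Type*} [CommRing R] (I : Ideal R) : Prop :=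
  ∃ f g : R, RingTheory.Sequence.IsRegular R [f, g] ∧ I = Ideal.span {f, g}

end PowerSeries

end AlmostStretched

/-!
Write `m` for the maximal ideal of `A = R / I`, and recall that `2 t ≤ s`.

*Structure.* The Hilbert function only enters through the dimensions of the powers of `m` over `k`,
and the Gorenstein property through the socle being a line; both are recorded in `TypeData`. Since
the characteristic is zero, a general `x` in `m` satisfies `x ^ s ≠ 0` and `m ^ 2 = x m`
(`TypeData.exists_sq_eq_span_mul`). The algebra `k[x]` contains `m ^ (t + 1)`, so a second
generator `y` can be corrected by a polynomial in `x` to satisfy `x ^ t y = 0`; such a pair is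
called a frame (`TypeData.exists_isFrame`). In a frame the elements `x ^ i`, `i ≤ s`, and `x ^ i
y`, `i < t`, are linearly independent, `y ^ 2 = x g(x) y + x ^ (s - t + 1) b(x)`, and `b(0) ≠ 0`,
for otherwise `x ^ (t - 1) y` would enlarge the socle (`IsFrame.exists_y_sq`). On the common
annihilator of `x` and `y` multiplication is a quadratic form with values in the line `k x ^ s`,
which is the radical, so the remaining generators can be chosen orthonormal
(`IsFrame.exists_orthonormal`).

*Normal forms.* Write `x g(x) = x ^ (p + 1) a(x)` with `a(0) ≠ 0`; only `p < t` matters. Units of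
`A` have roots of every order, and rescaling `x` and `y` by units normalises `a` and `b` to `1`,
unless both terms of the relation have the same weight, that is, `2 (p + 1) = s - t + 1`. Then `b /
a ^ 2` is an invariant up to reparametrisation of `x`: its constant term `c` cannot be changed,
while the rest becomes a single power `x ^ d`, or disappears if its order is at least `t - p - 1`
(`IsFrame.exists_normal_form`). This gives a surjection from `R` to `A` whose kernel contains a
model ideal, and a count of dimensions shows that it is an equality (`exists_algEquiv_model`).

*Uniqueness.* Two isomorphisms with models are two systems of coordinates in the same `A`. The
square of the annihilator of `m ^ (t + 1)` lies in `m ^ (p + 2)`, which separates different `p`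
(`ModelRel.le_of_modelRel`). If `2 (p + 1) = s - t + 1`, the two systems are compared in the ring
`QuadExt`, in which `x_1 = T` and `x_2 = T ^ (p + 1) ω` with `ω ^ 2 = ω + Z(T)`: comparing leading
terms shows that the parameters agree modulo `T ^ (t - p - 1)` after a substitution `T ↦ T u(T)`
(`exists_dvd_sub_comp`), and two parameters in the list with this property are equal
(`param_eq_of_dvd`).

*Two variables.* For `h = 2` the monomials `x_1 ^ i` and `x_1 ^ i x_2` remain independent in an
explicit quotient of a quadratic algebra, so they form a basis of the quotient by a model ideal,
from which the Hilbert function, the socle and the length are read off (`IsPlaneModel`). The two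
generators of the ideal have no common factor, since the first is divisible neither by `x_1` nor by
`x_2`.
-/

namespace AlmostStretched

open IsLocalRing Polynomial
open scoped Pointwise

/-! ### Quotients of power series rings -/

section PowerSeriesQuotients

variable {k : Type*} [Field k] {h : ℕ}

/-- A power series without constant term is a combination of the variables: its terms are
distributed according to the first variable that occurs in them. -/
theorem mem_span_X_of_constantCoeff_eq_zero {f : MvPowerSeries (Fin h) k}
    (hf : MvPowerSeries.constantCoeff f = 0) :
    f ∈ Ideal.span (Set.range (MvPowerSeries.X : Fin h → MvPowerSeries (Fin h) k)) := by
  classical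
  let g : Fin h → MvPowerSeries (Fin h) k := fun i d =>
    if d.support.min = (i : WithTop (Fin h)) then MvPowerSeries.coeff d f else 0
  have hg : ∀ i d, MvPowerSeries.coeff d (g i) =
      if d.support.min = (i : WithTop (Fin h)) then MvPowerSeries.coeff d f else 0 :=
    fun i d => rfl
  have hsum : f = ∑ i, g i := by
    ext d
    rw [map_sum]
    simp only [hg]
    by_cases hd : d = 0
    · subst hd
      have : MvPowerSeries.coeff 0 f = 0 := by
        rw [MvPowerSeries.coeff_zero_eq_constantCoeff_apply, hf]
      simp [this]
    · have hne : d.support.Nonempty := Finsupp.support_nonempty_iff.mpr hd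
      obtain ⟨j, hj⟩ := Finset.min_of_nonempty hne
      rw [hj, Finset.sum_eq_single j]
      · simp
      · intro b _ hb
        rw [if_neg]
        intro hjb
        exact hb (WithTop.coe_injective hjb).symm
      · simp
  rw [hsum]
  refine Ideal.sum_mem _ fun i _ => ?_
  refine Ideal.mem_of_dvd _ ?_ (Ideal.subset_span ⟨i, rfl⟩)
  rw [MvPowerSeries.X_dvd_iff]
  intro d hd
  rw [hg, if_neg]
  intro hmin
  have := Finset.mem_of_min hmin
  rw [Finsupp.mem_support_iff] at this
  exact this hd

variable {A : Type*} [CommRing A] [Algebra k A]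

/-- Power series over `k` may be evaluated at nilpotent elements of a `k`-algebra. -/
theorem exists_algHom_of_isNilpotent (a : Fin h → A) (ha : ∀ i, IsNilpotent (a i)) :
    ∃ f : MvPowerSeries (Fin h) k →ₐ[k] A, ∀ i, f (MvPowerSeries.X i) = a i := by
  let _ : UniformSpace k := ⊥
  let _ : UniformSpace A := ⊥
  have _ : DiscreteUniformity k := ⟨rfl⟩
  have _ : DiscreteUniformity A := ⟨rfl⟩
  have he : MvPowerSeries.HasEval a := by
    refine ⟨fun i => ?_, ?_⟩
    · obtain ⟨n, hn⟩ := ha i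
      refine tendsto_const_nhds.congr' ?_
      filter_upwards [Filter.eventually_ge_atTop n] with j hj
      exact (pow_eq_zero_of_le hj hn).symm
    · rw [Filter.cofinite_eq_bot]
      exact Filter.tendsto_bot
  have _ : IsUniformAddGroup k := inferInstance
  have _ : IsUniformAddGroup A := inferInstance
  have _ : ContinuousSMul k A := ⟨continuous_of_discreteTopology⟩
  refine ⟨MvPowerSeries.aeval he, fun i => ?_⟩
  rw [← MvPolynomial.coe_X, MvPowerSeries.aeval_coe, MvPolynomial.aeval_X]

/-- If the `X i` have nilpotent images under a surjection `f` from the power series ring, then the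
target is generated by these images as a `k`-algebra, in the form of an induction principle for
subspaces. -/
theorem submodule_eq_top_of_mul_mem (f : MvPowerSeries (Fin h) k →ₐ[k] A)
    (hf : Function.Surjective f) (hnil : ∀ i, IsNilpotent (f (MvPowerSeries.X i)))
    (M : Submodule k A) (h1 : (1 : A) ∈ M)
    (hM : ∀ i, ∀ a ∈ M, f (MvPowerSeries.X i) * a ∈ M) : M = ⊤ := by
  set J : Ideal A := Ideal.span (Set.range fun i => f (MvPowerSeries.X i)) with hJ
  have hJnil : IsNilpotent J := by
    refine (Ideal.FG.isNilpotent_iff_le_nilradical (Submodule.fg_span (Set.finite_range _))).mpr ?_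
    rw [Ideal.span_le]
    rintro _ ⟨i, rfl⟩
    exact hnil i
  have key : ∀ j : ℕ, ∀ a : A, ∃ b ∈ M, a - b ∈ J ^ j := by
    intro j
    induction j with
    | zero => exact fun a => ⟨0, M.zero_mem, by simp⟩
    | succ j ih =>
      intro a
      obtain ⟨g, rfl⟩ := hf a
      set c := MvPowerSeries.constantCoeff g
      have h0 : g - MvPowerSeries.C c ∈
          Ideal.span (Set.range (MvPowerSeries.X : Fin h → MvPowerSeries (Fin h) k)) :=
        mem_span_X_of_constantCoeff_eq_zero (by simp [c])
      obtain ⟨v, hv⟩ := (Ideal.mem_span_range_iff_exists_fun).mp h0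
      choose b hbM hb using fun i => ih (f (v i))
      refine ⟨c • 1 + ∑ i, f (MvPowerSeries.X i) * b i,
        M.add_mem (M.smul_mem _ h1) (M.sum_mem fun i _ => hM i _ (hbM i)), ?_⟩
      have hg : f g = c • 1 + ∑ i, f (MvPowerSeries.X i) * f (v i) := by
        have h2 : g = algebraMap k _ c + ∑ i, v i * MvPowerSeries.X i := by
          rw [hv, MvPowerSeries.algebraMap_apply]; simp
        conv_lhs => rw [h2]
        rw [map_add, AlgHom.commutes, map_sum, Algebra.algebraMap_eq_smul_one]
        congr 1
        exact Finset.sum_congr rfl fun i _ => by rw [map_mul, mul_comm]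
      rw [hg, add_sub_add_left_eq_sub, ← Finset.sum_sub_distrib]
      refine Ideal.sum_mem _ fun i _ => ?_
      rw [← mul_sub, pow_succ']
      exact Ideal.mul_mem_mul (Ideal.subset_span ⟨i, rfl⟩) (hb i)
  obtain ⟨N, hN⟩ := hJnil
  rw [eq_top_iff]
  intro a _
  obtain ⟨b, hb, hab⟩ := key N a
  rw [hN] at hab
  rwa [sub_eq_zero.mp hab]

/-- An algebra homomorphism from the power series ring to a local algebra with residue field `k` and
nilpotent maximal ideal is onto if the images of the variables generate the maximal ideal. -/
theorem surjective_of_maximalIdeal_le_span [IsLocalRing A]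
    (hres : ∀ a : A, ∃ c : k, a - algebraMap k A c ∈ IsLocalRing.maximalIdeal A)
    (hnil : IsNilpotent (IsLocalRing.maximalIdeal A))
    (f : MvPowerSeries (Fin h) k →ₐ[k] A)
    (hspan : IsLocalRing.maximalIdeal A ≤
      Ideal.span (Set.range fun i => f (MvPowerSeries.X i)))
    (hmem : ∀ i, f (MvPowerSeries.X i) ∈ IsLocalRing.maximalIdeal A) :
    Function.Surjective f := by
  have key : ∀ j : ℕ, ∀ a : A, ∃ b, a - f b ∈ IsLocalRing.maximalIdeal A ^ j := by
    intro j
    induction j with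
    | zero => exact fun a => ⟨0, by simp⟩
    | succ j ih =>
      intro a
      obtain ⟨c, hc⟩ := hres a
      obtain ⟨v, hv⟩ := (Ideal.mem_span_range_iff_exists_fun).mp (hspan hc)
      choose b hb using fun i => ih (v i)
      refine ⟨algebraMap k _ c + ∑ i, b i * MvPowerSeries.X i, ?_⟩
      rw [map_add, AlgHom.commutes, map_sum, ← sub_sub, ← hv, ← Finset.sum_sub_distrib]
      refine Ideal.sum_mem _ fun i _ => ?_
      rw [map_mul, ← sub_mul, pow_succ]
      exact Ideal.mul_mem_mul (hb i) (hmem i)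
  obtain ⟨N, hN⟩ := hnil
  intro a
  obtain ⟨b, hab⟩ := key N a
  rw [hN] at hab
  exact ⟨b, (sub_eq_zero.mp hab).symm⟩

end PowerSeriesQuotients

/-! ### Hilbert functions and dimensions of powers of the maximal ideal -/

section HilbertFunction

variable {k : Type*} [Field k] {A : Type*} [CommRing A] [IsLocalRing A] [Algebra k A]

theorem exists_algebraMap_sub_mem_maximalIdeal {h : ℕ} (f : MvPowerSeries (Fin h) k →ₐ[k] A)
    (hf : Function.Surjective f) (a : A) :
    ∃ c : k, a - algebraMap k A c ∈ maximalIdeal A := by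
  obtain ⟨g, rfl⟩ := hf a
  have := Function.Surjective.isLocalHom (f : MvPowerSeries (Fin h) k →+* A) hf
  refine ⟨MvPowerSeries.constantCoeff g, ?_⟩
  rw [← AlgHom.commutes f, ← map_sub, mem_maximalIdeal, mem_nonunits_iff]
  intro hu
  have hu' : IsUnit (g - algebraMap k _ (MvPowerSeries.constantCoeff g)) :=
    this.map_nonunit _ hu
  rw [MvPowerSeries.isUnit_iff_constantCoeff] at hu'
  simp [MvPowerSeries.algebraMap_apply] at hu'

/-- An Artinian local algebra with residue field `k` is finite-dimensional over `k`. -/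
theorem finite_of_residue [IsArtinianRing A]
    (hres : ∀ a : A, ∃ c : k, a - algebraMap k A c ∈ maximalIdeal A) : Module.Finite k A := by
  have hstep : ∀ j : ℕ, ((maximalIdeal A ^ (j + 1)).restrictScalars k).FG →
      ((maximalIdeal A ^ j).restrictScalars k).FG := by
    intro j hj
    obtain ⟨G, hG⟩ : (maximalIdeal A ^ j).FG := IsNoetherian.noetherian _
    have : (maximalIdeal A ^ j).restrictScalars k =
        Submodule.span k (G : Set A) ⊔ (maximalIdeal A ^ (j + 1)).restrictScalars k := by
      refine le_antisymm ?_ (sup_le ?_ ?_)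
      · intro a ha
        rw [Submodule.restrictScalars_mem, ← hG] at ha
        induction ha using Submodule.span_induction with
        | mem x hx => exact Submodule.mem_sup_left (Submodule.subset_span hx)
        | zero => exact Submodule.zero_mem _
        | add x y _ _ hx hy => exact Submodule.add_mem _ hx hy
        | smul r x hx' hx =>
          obtain ⟨c, hc⟩ := hres r
          have hr : r • x = c • x + (r - algebraMap k A c) * x := by
            rw [smul_eq_mul, Algebra.smul_def]; ring
          rw [hr]
          refine Submodule.add_mem _ (Submodule.smul_mem _ _ hx) (Submodule.mem_sup_right ?_)
          rw [Submodule.restrictScalars_mem, pow_succ', ← hG]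
          exact Ideal.mul_mem_mul hc hx'
      · rw [Submodule.span_le, Submodule.coe_restrictScalars, ← hG]
        exact Submodule.subset_span
      · intro a ha
        exact Ideal.pow_le_pow_right (Nat.le_succ j) ha
    rw [this]
    exact Submodule.FG.sup ⟨G, rfl⟩ hj
  obtain ⟨N, hN⟩ : IsNilpotent (maximalIdeal A) := by
    rw [← jacobson_eq_maximalIdeal ⊥ bot_ne_top]
    exact IsArtinianRing.isNilpotent_jacobson_bot
  have hall : ∀ i : ℕ, i ≤ N → ((maximalIdeal A ^ (N - i)).restrictScalars k).FG := by
    intro i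
    induction i with
    | zero =>
      intro _
      rw [Nat.sub_zero, hN]
      exact Submodule.fg_bot
    | succ i ih =>
      intro hi
      refine hstep _ ?_
      rw [show N - (i + 1) + 1 = N - i by omega]
      exact ih (by omega)
  have h0 := hall N le_rfl
  rw [Nat.sub_self, pow_zero, Ideal.one_eq_top, Submodule.restrictScalars_top] at h0
  exact ⟨h0⟩

theorem finrank_quotient_maximalIdeal
    (hres : ∀ a : A, ∃ c : k, a - algebraMap k A c ∈ maximalIdeal A) :
    Module.finrank k (A ⧸ maximalIdeal A) = 1 := by
  refine finrank_eq_one (1 : A ⧸ maximalIdeal A) one_ne_zero ?_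
  intro w
  obtain ⟨a, rfl⟩ := Ideal.Quotient.mk_surjective w
  obtain ⟨c, hc⟩ := hres a
  refine ⟨c, ?_⟩
  rw [← Algebra.algebraMap_eq_smul_one, ← sub_eq_zero, ← Ideal.Quotient.mk_algebraMap,
    ← map_sub, Ideal.Quotient.eq_zero_iff_mem, ← neg_sub]
  exact Submodule.neg_mem _ hc

/-- The Hilbert function is the sequence of differences of the dimensions over `k` of the powers of
the maximal ideal. -/
theorem hilbertFn_add_finrank [Module.Finite k A]
    (hres : ∀ a : A, ∃ c : k, a - algebraMap k A c ∈ maximalIdeal A) (j : ℕ) :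
    hilbertFn A j + Module.finrank k ↥(maximalIdeal A ^ (j + 1)) =
      Module.finrank k ↥(maximalIdeal A ^ j) := by
  set N : Submodule A ↥(maximalIdeal A ^ j) := maximalIdeal A • ⊤ with hN
  have h1 : hilbertFn A j = Module.finrank k (↥(maximalIdeal A ^ j) ⧸ N) := by
    have : IsScalarTower k (A ⧸ maximalIdeal A) (↥(maximalIdeal A ^ j) ⧸ N) := by
      refine IsScalarTower.of_algebraMap_smul fun c w => ?_
      obtain ⟨a, rfl⟩ := Submodule.Quotient.mk_surjective _ w
      rw [IsScalarTower.algebraMap_apply k A (A ⧸ maximalIdeal A)]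
      change Submodule.Quotient.mk (algebraMap k A c • a) = Submodule.Quotient.mk (c • a)
      rw [algebraMap_smul]
    let _ : Field (A ⧸ maximalIdeal A) := Ideal.Quotient.field _
    have _ : Module.Free (A ⧸ maximalIdeal A) (↥(maximalIdeal A ^ j) ⧸ N) :=
      Module.Free.of_divisionRing _ _
    have h2 := Module.finrank_mul_finrank k (A ⧸ maximalIdeal A) (↥(maximalIdeal A ^ j) ⧸ N)
    rw [finrank_quotient_maximalIdeal hres, one_mul] at h2
    exact h2
  have h2 : Module.finrank k ↥N = Module.finrank k ↥(maximalIdeal A ^ (j + 1)) := by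
    have hmap : N.map (maximalIdeal A ^ j).subtype = maximalIdeal A ^ (j + 1) := by
      rw [hN, Submodule.map_smul'', Submodule.map_top, Submodule.range_subtype, pow_succ',
        smul_eq_mul]
    rw [← hmap]
    exact ((Submodule.equivMapOfInjective _ (Submodule.subtype_injective _) N).restrictScalars
      k).finrank_eq
  rw [h1, ← h2]
  exact Submodule.finrank_quotient_add_finrank (N.restrictScalars k)

end HilbertFunction

/-- The information carried by a local `k`-algebra `A` with residue field `k` that is almost
stretched and Gorenstein of type `(s, t)` with embedding dimension `h`, in terms of dimensions over
`k`: the Hilbert function is read off the dimensions of the powers of the maximal ideal, and the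
socle is a line. -/
structure TypeData (k A : Type*) [Field k] [CommRing A] [IsLocalRing A] [Algebra k A]
    (h s t : ℕ) : Prop where
  finite : Module.Finite k A
  res : ∀ a : A, ∃ c : k, a - algebraMap k A c ∈ maximalIdeal A
  pow_eq_bot : maximalIdeal A ^ (s + 1) = ⊥
  finrank_two : ∀ j, 2 ≤ j → j ≤ t → Module.finrank k ↥(maximalIdeal A ^ j) =
    Module.finrank k ↥(maximalIdeal A ^ (j + 1)) + 2
  finrank_one : ∀ j, t + 1 ≤ j → j ≤ s → Module.finrank k ↥(maximalIdeal A ^ j) =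
    Module.finrank k ↥(maximalIdeal A ^ (j + 1)) + 1
  finrank_add_one : Module.finrank k A + 1 = s + t + h
  socle : ∀ a w : A, w ≠ 0 → (∀ b ∈ maximalIdeal A, b * a = 0) →
    (∀ b ∈ maximalIdeal A, b * w = 0) → ∃ c : k, a = c • w

/-- The Hilbert function determines `dim A = 1 + h + 2 (t - 1) + (s - t)`, and since it vanishes
from degree `s + 1` on, so does the corresponding power of the maximal ideal. -/
theorem TypeData.of_hasType {k A : Type*} [Field k] [CommRing A] [IsLocalRing A] [Algebra k A]
    {h s t : ℕ} (ht : 2 ≤ t) (hst : 2 * t ≤ s)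
    (hres : ∀ a : A, ∃ c : k, a - algebraMap k A c ∈ maximalIdeal A)
    (hG : IsArtinGorenstein A) (hT : HasType A h s t) : TypeData k A h s t := by
  obtain ⟨hart, hsimple⟩ := hG
  obtain ⟨h0, h1, h2, h3, h4⟩ := hT
  have hfin : Module.Finite k A := finite_of_residue hres
  have hH := hilbertFn_add_finrank (A := A) hres
  have hpow : maximalIdeal A ^ (s + 1) = ⊥ := by
    obtain ⟨N, hN⟩ : IsNilpotent (maximalIdeal A) := by
      rw [← jacobson_eq_maximalIdeal ⊥ bot_ne_top]
      exact IsArtinianRing.isNilpotent_jacobson_bot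
    have hz : ∀ i : ℕ, Module.finrank k ↥(maximalIdeal A ^ (s + 1 + i)) =
        Module.finrank k ↥(maximalIdeal A ^ (s + 1)) := by
      intro i
      induction i with
      | zero => rfl
      | succ i ih =>
        have := hH (s + 1 + i)
        rw [h4 _ (by omega), zero_add] at this
        rw [← add_assoc, this, ih]
    have hbot : maximalIdeal A ^ (s + 1 + N) = ⊥ := by
      rw [pow_add, hN]; simp
    have hz' := hz N
    rw [hbot] at hz'
    have hz2 : Module.finrank k ↥(maximalIdeal A ^ (s + 1)) = 0 := by
      rw [← hz']; exact finrank_bot k A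
    have : (maximalIdeal A ^ (s + 1)).restrictScalars k = ⊥ := Submodule.finrank_eq_zero.mp hz2
    rwa [Submodule.restrictScalars_eq_bot_iff] at this
  have h2' : ∀ j, 2 ≤ j → j ≤ t → Module.finrank k ↥(maximalIdeal A ^ j) =
      Module.finrank k ↥(maximalIdeal A ^ (j + 1)) + 2 := fun j hj hj' => by
    rw [← hH j, h2 j hj hj', add_comm]
  have h3' : ∀ j, t + 1 ≤ j → j ≤ s → Module.finrank k ↥(maximalIdeal A ^ j) =
      Module.finrank k ↥(maximalIdeal A ^ (j + 1)) + 1 := fun j hj hj' => by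
    rw [← hH j, h3 j hj hj', add_comm]
  refine ⟨hfin, hres, hpow, h2', h3', ?_, ?_⟩
  · have hs : ∀ i, i + t ≤ s → Module.finrank k ↥(maximalIdeal A ^ (s + 1 - i)) = i := by
      intro i
      induction i with
      | zero =>
        intro _
        rw [Nat.sub_zero, hpow]; exact finrank_bot k A
      | succ i ih =>
        intro hi
        rw [h3' _ (by omega) (by omega), show s + 1 - (i + 1) + 1 = s + 1 - i by omega,
          ih (by omega)]
    have ht' : ∀ i, i + 1 ≤ t →
        Module.finrank k ↥(maximalIdeal A ^ (t + 1 - i)) = s - t + 2 * i := by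
      intro i
      induction i with
      | zero =>
        intro _
        have := hs (s - t) (by omega)
        rw [show s + 1 - (s - t) = t + 1 by omega] at this
        rw [Nat.sub_zero, this]; rfl
      | succ i ih =>
        intro hi
        rw [h2' _ (by omega) (by omega), show t + 1 - (i + 1) + 1 = t + 1 - i by omega,
          ih (by omega)]
        ring
    have e2 := ht' (t - 1) (by omega)
    rw [show t + 1 - (t - 1) = 2 by omega] at e2
    have e1 := hH 1
    have e0 := hH 0
    rw [h1, e2] at e1
    rw [h0, zero_add, ← e1] at e0
    have etop : Module.finrank k ↥(maximalIdeal A ^ 0) = Module.finrank k A := by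
      rw [pow_zero, Ideal.one_eq_top]
      exact finrank_top k A
    omega
  · intro a w hw ha hw'
    have hmem : ∀ {v : A}, (∀ b ∈ maximalIdeal A, b * v = 0) →
        v ∈ Module.annihilator A ↥(maximalIdeal A) := by
      intro v hv
      rw [Module.mem_annihilator]
      rintro ⟨b, hb⟩
      ext
      simpa [mul_comm] using hv b hb
    have hne : (⟨w, hmem hw'⟩ : ↥(Module.annihilator A ↥(maximalIdeal A))) ≠ 0 := by
      intro h
      exact hw (congrArg Subtype.val h)
    obtain ⟨r, hr⟩ := IsSimpleModule.toSpanSingleton_surjective A hne ⟨a, hmem ha⟩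
    have hr' : r * w = a := congrArg Subtype.val hr
    obtain ⟨c, hc⟩ := hres r
    refine ⟨c, ?_⟩
    have := hw' _ hc
    rw [sub_mul, hr', sub_eq_zero] at this
    rw [this, Algebra.smul_def]

/-! ### General elements of the maximal ideal -/

theorem smul_mem_ideal {k A : Type*} [CommSemiring k] [CommRing A] [Algebra k A] (I : Ideal A)
    (c : k) {a : A} (ha : a ∈ I) : c • a ∈ I := by
  rw [Algebra.smul_def]; exact Ideal.mul_mem_left _ _ ha

theorem aeval_eq_add_divX {k A : Type*} [CommSemiring k] [CommRing A] [Algebra k A]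
    (x : A) (F : k[X]) :
    aeval x F = algebraMap k A (F.coeff 0) + x * aeval x F.divX := by
  conv_lhs => rw [← divX_mul_X_add F]
  rw [map_add, map_mul, aeval_X, aeval_C, mul_comm, add_comm]

section Polarization

variable {k : Type*} [Field k] [CharZero k] {A : Type*} [CommRing A] [Algebra k A]

/-- A polynomial over an algebra over an infinite field vanishes if it vanishes at all scalars. -/
theorem polynomial_eq_zero_of_eval_algebraMap_eq_zero (P : A[X])
    (hP : ∀ c : k, P.eval (algebraMap k A c) = 0) : P = 0 := by
  ext i
  rw [coeff_zero, ← Module.forall_dual_apply_eq_zero_iff k]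
  intro φ
  by_cases hi : i ∈ Finset.range (P.natDegree + 1)
  · set Q : k[X] := ∑ j ∈ Finset.range (P.natDegree + 1), monomial j (φ (P.coeff j)) with hQ
    have hQ0 : Q = 0 := by
      refine Polynomial.funext fun c => ?_
      have h1 := congrArg φ (hP c)
      rw [eval_eq_sum_range, map_sum, map_zero] at h1
      rw [eval_zero, hQ, eval_finsetSum, ← h1]
      refine Finset.sum_congr rfl fun j _ => ?_
      rw [eval_monomial, ← map_pow, mul_comm (P.coeff j), ← Algebra.smul_def, map_smul,
        smul_eq_mul, mul_comm]
    have h2 := congrArg (fun q => coeff q i) hQ0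
    simp only [hQ, finsetSum_coeff, coeff_monomial, coeff_zero] at h2
    rwa [Finset.sum_ite_eq' , if_pos hi] at h2
  · rw [coeff_eq_zero_of_natDegree_lt (by simpa [Nat.lt_succ_iff] using hi), map_zero]

/-- A form of polarization: the product is, up to the factor `N + 1`, the linear term of
`(l + c y) ^ (N + 1) b` as a polynomial in `c`. -/
theorem pow_mul_mul_eq_zero {l y b : A} {N : ℕ}
    (h : ∀ c : k, (l + c • y) ^ (N + 1) * b = 0) : l ^ N * (y * b) = 0 := by
  have h0 : ((C l + C y * X) ^ (N + 1) * C b : A[X]) = 0 := by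
    refine polynomial_eq_zero_of_eval_algebraMap_eq_zero (k := k) _ fun c => ?_
    have := h c
    rw [Algebra.smul_def] at this
    rw [eval_mul, eval_pow, eval_add, eval_mul, eval_C, eval_C, eval_X, eval_C, mul_comm y]
    exact this
  have h1 := congrArg (fun P => eval 0 (derivative P)) h0
  simp only [derivative_mul, derivative_pow, derivative_C, derivative_add, derivative_X,
    derivative_zero, eval_zero, eval_mul, eval_add, eval_pow, eval_C, eval_X] at h1
  simp only [mul_zero, add_zero, zero_add, eval_one, mul_one,
    Nat.add_sub_cancel] at h1
  have h2 : ((N + 1 : ℕ) : k) • (l ^ N * (y * b)) = 0 := by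
    rw [Algebra.smul_def, map_natCast, ← h1]
    push_cast
    ring
  exact (smul_eq_zero.mp h2).resolve_left (Nat.cast_ne_zero.mpr (Nat.succ_ne_zero N))

end Polarization

section LocalAlgebra

variable {k : Type*} [Field k] {A : Type*} [CommRing A] [IsLocalRing A] [Algebra k A]

theorem isUnit_algebraMap_add {c : k} (hc : c ≠ 0) {a : A} (ha : a ∈ maximalIdeal A) :
    IsUnit (algebraMap k A c + a) := by
  by_contra h
  have h1 : algebraMap k A c + a ∈ maximalIdeal A := h
  have h2 : algebraMap k A c ∈ maximalIdeal A := by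
    simpa using Ideal.sub_mem _ h1 ha
  exact h2 ((IsUnit.mk0 c hc).map (algebraMap k A))

theorem isUnit_aeval {x : A} (hx : x ∈ maximalIdeal A) {F : k[X]} (hF : F.coeff 0 ≠ 0) :
    IsUnit (aeval x F) := by
  rw [aeval_eq_add_divX]
  exact isUnit_algebraMap_add hF (Ideal.mul_mem_right _ _ hx)

theorem coeff_zero_eq_zero_of_add_mem {x : A} (hx : x ∈ maximalIdeal A) {F : k[X]} {r : A}
    (hr : r ∈ maximalIdeal A) (h : aeval x F + r ∈ maximalIdeal A) : F.coeff 0 = 0 := by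
  by_contra hF
  exact (by simpa using Ideal.sub_mem _ h hr : aeval x F ∈ maximalIdeal A) (isUnit_aeval hx hF)

theorem exists_eq_X_pow_mul {F : k[X]} (hF : F ≠ 0) :
    ∃ (d : ℕ) (G : k[X]), F = X ^ d * G ∧ G.coeff 0 ≠ 0 := by
  obtain ⟨G, hG, hnd⟩ := exists_eq_pow_rootMultiplicity_mul_and_not_dvd F hF 0
  rw [C_0, sub_zero] at hG hnd
  exact ⟨_, G, hG, fun h => hnd (X_dvd_iff.mpr h)⟩

theorem X_pow_dvd_of_aeval_eq_zero {s : ℕ} {x : A} (hx : x ∈ maximalIdeal A) (hs : x ^ s ≠ 0)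
    {F : k[X]} (hF : aeval x F = 0) : X ^ (s + 1) ∣ F := by
  by_cases h0 : F = 0
  · rw [h0]; exact dvd_zero _
  obtain ⟨d, G, rfl, hG⟩ := exists_eq_X_pow_mul h0
  rw [map_mul, map_pow, aeval_X, (isUnit_aeval hx hG).mul_left_eq_zero] at hF
  have hd : s + 1 ≤ d := by
    by_contra h
    exact hs (pow_eq_zero_of_le (by omega) hF)
  exact Dvd.dvd.mul_right (pow_dvd_pow _ hd) _

end LocalAlgebra

namespace TypeData

variable {k : Type*} [Field k] {A : Type*} [CommRing A] [IsLocalRing A] [Algebra k A]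
  {h s t : ℕ}

theorem eq_zero_of_mem_pow (T : TypeData k A h s t) {a : A}
    (ha : a ∈ maximalIdeal A ^ (s + 1)) : a = 0 := by
  rwa [T.pow_eq_bot] at ha

theorem isNilpotent_of_mem (T : TypeData k A h s t) {a : A} (ha : a ∈ maximalIdeal A) :
    IsNilpotent a :=
  ⟨s + 1, T.eq_zero_of_mem_pow (Ideal.pow_mem_pow ha _)⟩

theorem isNilpotent_maximalIdeal (T : TypeData k A h s t) : IsNilpotent (maximalIdeal A) :=
  ⟨s + 1, T.pow_eq_bot⟩

theorem pow_notMem (T : TypeData k A h s t) {x : A} (hx : x ∈ maximalIdeal A) (hs : x ^ s ≠ 0)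
    {j : ℕ} (hj : j ≤ s) : x ^ j ∉ maximalIdeal A ^ (j + 1) := by
  intro hmem
  refine hs (T.eq_zero_of_mem_pow ?_)
  have h1 := Ideal.mul_mem_mul hmem (Ideal.pow_mem_pow hx (s - j))
  rwa [← pow_add, ← pow_add, show j + (s - j) = s by omega,
    show j + 1 + (s - j) = s + 1 by omega] at h1

/-- In degrees between `2` and `t` one element does not generate the power of the maximal ideal. -/
theorem exists_sub_smul_notMem (T : TypeData k A h s t) {j : ℕ} (hj : 2 ≤ j) (hjt : j ≤ t)
    (u : A) : ∃ a ∈ maximalIdeal A ^ j, ∀ c : k, a - c • u ∉ maximalIdeal A ^ (j + 1) := by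
  by_contra! hcon
  have := T.finite
  have hle : (maximalIdeal A ^ j).restrictScalars k ≤
      Submodule.span k {u} ⊔ (maximalIdeal A ^ (j + 1)).restrictScalars k := by
    intro a ha
    obtain ⟨c, hc⟩ := hcon a ha
    rw [← add_sub_cancel (c • u) a]
    exact Submodule.add_mem _
      (Submodule.mem_sup_left (Submodule.smul_mem _ _ (Submodule.mem_span_singleton_self u)))
      (Submodule.mem_sup_right hc)
  have h1 := Submodule.finrank_mono hle
  have h2 := Submodule.finrank_add_le_finrank_add_finrank (Submodule.span k {u})
    ((maximalIdeal A ^ (j + 1)).restrictScalars k)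
  have h3 := finrank_span_le_card (R := k) ({u} : Set A)
  rw [Set.toFinset_singleton, Finset.card_singleton] at h3
  have h4 := T.finrank_two j hj hjt
  change Module.finrank k ↥(maximalIdeal A ^ j) ≤ _ at h1
  change _ ≤ _ + Module.finrank k ↥(maximalIdeal A ^ (j + 1)) at h2
  omega

/-- In degrees between `2` and `t` two independent elements generate the power of the maximal
ideal. -/
theorem exists_eq_smul_add_smul_add (T : TypeData k A h s t) {j : ℕ} (hj : 2 ≤ j) (hjt : j ≤ t)
    {u v : A} (hu : u ∈ maximalIdeal A ^ j) (hv : v ∈ maximalIdeal A ^ j)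
    (hu' : u ∉ maximalIdeal A ^ (j + 1)) (hv' : ∀ c : k, v - c • u ∉ maximalIdeal A ^ (j + 1))
    {a : A} (ha : a ∈ maximalIdeal A ^ j) :
    ∃ α β : k, a - (α • u + β • v) ∈ maximalIdeal A ^ (j + 1) := by
  have := T.finite
  have hind : ∀ α β : k, α • u + β • v ∈ maximalIdeal A ^ (j + 1) → α = 0 ∧ β = 0 := by
    intro α β hm
    have hβ : β = 0 := by
      by_contra hβ
      refine hv' (-(β⁻¹ * α)) ?_
      have := smul_mem_ideal _ β⁻¹ hm
      rw [smul_add, smul_smul, smul_smul, inv_mul_cancel₀ hβ, one_smul] at this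
      rwa [neg_smul, sub_neg_eq_add, add_comm v]
    subst hβ
    refine ⟨?_, rfl⟩
    by_contra hα
    have := smul_mem_ideal _ α⁻¹ hm
    rw [zero_smul, add_zero, smul_smul, inv_mul_cancel₀ hα, one_smul] at this
    exact hu' this
  set W : Submodule k A := Submodule.span k (Set.range ![u, v]) with hW
  set N : Submodule k A := (maximalIdeal A ^ (j + 1)).restrictScalars k with hN
  have hli : LinearIndependent k ![u, v] := by
    rw [LinearIndependent.pair_iff]
    intro α β hαβ
    exact hind α β (by rw [hαβ]; exact Submodule.zero_mem _)
  have hWdim : Module.finrank k W = 2 := by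
    rw [hW, finrank_span_eq_card hli, Fintype.card_fin]
  have hmemW : ∀ w ∈ W, ∃ α β : k, α • u + β • v = w := by
    intro w hw
    rw [hW, Matrix.range_cons, Matrix.range_cons, Matrix.range_empty, Set.union_empty,
      Set.singleton_union] at hw
    exact Submodule.mem_span_pair.mp hw
  have hinf : W ⊓ N = ⊥ := by
    rw [eq_bot_iff]
    rintro w ⟨hw, hwN⟩
    obtain ⟨α, β, rfl⟩ := hmemW w hw
    obtain ⟨rfl, rfl⟩ := hind α β hwN
    simp
  have hsum := Submodule.finrank_sup_add_finrank_inf_eq W N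
  rw [hinf, finrank_bot, add_zero, hWdim] at hsum
  have hle : W ⊔ N ≤ (maximalIdeal A ^ j).restrictScalars k := by
    refine sup_le ?_ ?_
    · intro w hw
      obtain ⟨α, β, rfl⟩ := hmemW w hw
      exact Ideal.add_mem _ (smul_mem_ideal _ _ hu) (smul_mem_ideal _ _ hv)
    · intro w hw
      exact Ideal.pow_le_pow_right (Nat.le_succ j) hw
  have heq : W ⊔ N = (maximalIdeal A ^ j).restrictScalars k := by
    refine Submodule.eq_of_le_of_finrank_eq hle ?_
    rw [hsum, add_comm]
    exact (T.finrank_two j hj hjt).symm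
  have ha' : a ∈ W ⊔ N := by rw [heq]; exact ha
  obtain ⟨w, hw, n, hn, rfl⟩ := Submodule.mem_sup.mp ha'
  obtain ⟨α, β, rfl⟩ := hmemW w hw
  exact ⟨α, β, by rw [add_sub_cancel_left]; exact hn⟩

/-- In degrees between `t + 1` and `s` one element generates the power of the maximal ideal. -/
theorem exists_sub_smul_mem (T : TypeData k A h s t) {j : ℕ} (hj : t + 1 ≤ j) (hjs : j ≤ s)
    {u : A} (hu : u ∈ maximalIdeal A ^ j) (hu' : u ∉ maximalIdeal A ^ (j + 1))
    {a : A} (ha : a ∈ maximalIdeal A ^ j) :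
    ∃ α : k, a - α • u ∈ maximalIdeal A ^ (j + 1) := by
  have := T.finite
  set N : Submodule k A := (maximalIdeal A ^ (j + 1)).restrictScalars k with hN
  have hle : Submodule.span k {u} ⊔ N ≤ (maximalIdeal A ^ j).restrictScalars k := by
    refine sup_le ?_ ?_
    · rw [Submodule.span_singleton_le_iff_mem]; exact hu
    · intro w hw
      exact Ideal.pow_le_pow_right (Nat.le_succ j) hw
  have hlt : N < Submodule.span k {u} ⊔ N := by
    refine lt_of_le_of_ne le_sup_right fun h => hu' ?_
    have : u ∈ Submodule.span k {u} ⊔ N :=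
      Submodule.mem_sup_left (Submodule.mem_span_singleton_self u)
    rw [← h] at this
    exact this
  have heq : Submodule.span k {u} ⊔ N = (maximalIdeal A ^ j).restrictScalars k := by
    refine Submodule.eq_of_le_of_finrank_le hle ?_
    have h1 := Submodule.finrank_lt_finrank_of_lt hlt
    have h2 := T.finrank_one j hj hjs
    change Module.finrank k ↥(maximalIdeal A ^ (j + 1)) < _ at h1
    change Module.finrank k ↥(maximalIdeal A ^ j) ≤ _
    omega
  have ha' : a ∈ Submodule.span k {u} ⊔ N := by rw [heq]; exact ha
  obtain ⟨w, hw, n, hn, rfl⟩ := Submodule.mem_sup.mp ha'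
  obtain ⟨α, rfl⟩ := Submodule.mem_span_singleton.mp hw
  exact ⟨α, by rw [add_sub_cancel_left]; exact hn⟩

theorem pow_ne_bot (T : TypeData k A h s t) (hst : t + 1 ≤ s) : maximalIdeal A ^ s ≠ ⊥ := by
  intro hb
  have h1 := T.finrank_one s hst le_rfl
  have h2 : Module.finrank k ↥(maximalIdeal A ^ s) = 0 := by rw [hb]; exact finrank_bot k A
  omega

/-- If all `s`-th powers of elements of the maximal ideal vanished, so would all products of `s`
elements, by polarization. -/
theorem exists_pow_ne_zero [CharZero k] (T : TypeData k A h s t) (hst : t + 1 ≤ s) :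
    ∃ x ∈ maximalIdeal A, x ^ s ≠ 0 := by
  by_contra! hcon
  have key : ∀ r : ℕ, r ≤ s → ∀ l ∈ maximalIdeal A, ∀ b ∈ maximalIdeal A ^ r,
      l ^ (s - r) * b = 0 := by
    intro r
    induction r with
    | zero =>
      intro _ l hl b _
      rw [Nat.sub_zero, hcon l hl, zero_mul]
    | succ r ih =>
      intro hr l hl b hb
      rw [pow_succ'] at hb
      induction hb using Submodule.mul_induction_on' with
      | mem_mul_mem y hy b hb =>
        refine pow_mul_mul_eq_zero (k := k) fun c => ?_
        rw [show s - (r + 1) + 1 = s - r by omega]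
        exact ih (by omega) _ (Ideal.add_mem _ hl (smul_mem_ideal _ _ hy)) b hb
      | add x _ y _ hx hy => rw [mul_add, hx, hy, add_zero]
  refine T.pow_ne_bot hst ?_
  rw [eq_bot_iff]
  intro b hb
  have := key s le_rfl 0 (Ideal.zero_mem _) b hb
  rwa [Nat.sub_self, pow_zero, one_mul] at this

theorem add_pow_sub_mem {x y : A} (hx : x ∈ maximalIdeal A) (hy : y ∈ maximalIdeal A)
    (hxy : x * y ∈ maximalIdeal A ^ 3) (j : ℕ) :
    (x + y) ^ (j + 1) - (x ^ (j + 1) + y ^ (j + 1)) ∈ maximalIdeal A ^ (j + 2) := by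
  induction j with
  | zero => simp
  | succ j ih =>
    have e : (x + y) ^ (j + 1 + 1) - (x ^ (j + 1 + 1) + y ^ (j + 1 + 1)) =
        ((x + y) ^ (j + 1) - (x ^ (j + 1) + y ^ (j + 1))) * (x + y) +
          x ^ j * (x * y) + y ^ j * (x * y) := by ring
    rw [e]
    refine Ideal.add_mem _ (Ideal.add_mem _ ?_ ?_) ?_
    · rw [show j + 1 + 2 = (j + 2) + 1 by ring, pow_succ]
      exact Ideal.mul_mem_mul ih (Ideal.add_mem _ hx hy)
    · rw [show j + 1 + 2 = j + 3 by ring, pow_add]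
      exact Ideal.mul_mem_mul (Ideal.pow_mem_pow hx j) hxy
    · rw [show j + 1 + 2 = j + 3 by ring, pow_add]
      exact Ideal.mul_mem_mul (Ideal.pow_mem_pow hy j) hxy

/-- If `x ^ 2` and `x a` are independent modulo `m ^ 3`, then they generate `m ^ 2` modulo `m ^ 3`,
and `m ^ 2 = x m` follows by Nakayama's lemma. -/
theorem sq_eq_span_mul (T : TypeData k A h s t) (ht : 2 ≤ t) (hst : t + 1 ≤ s) {x a : A}
    (hx : x ∈ maximalIdeal A) (hs : x ^ s ≠ 0) (ha : a ∈ maximalIdeal A)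
    (hxa : ∀ c : k, x * a - c • x ^ 2 ∉ maximalIdeal A ^ 3) :
    maximalIdeal A ^ 2 = Ideal.span {x} * maximalIdeal A := by
  have hle : Ideal.span {x} * maximalIdeal A ≤ maximalIdeal A ^ 2 := by
    rw [pow_two]
    exact Ideal.mul_mono_left ((Ideal.span_singleton_le_iff_mem _).mpr hx)
  refine le_antisymm ?_ hle
  have hall : ∀ j : ℕ, maximalIdeal A ^ 2 ≤
      Ideal.span {x} * maximalIdeal A ⊔ maximalIdeal A ^ (2 + j) := by
    intro j
    induction j with
    | zero => exact le_sup_right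
    | succ j ih =>
      refine ih.trans (sup_le le_sup_left ?_)
      have h1 : maximalIdeal A ^ 2 ≤ Ideal.span {x} * maximalIdeal A ⊔ maximalIdeal A ^ 3 := by
        intro b hb
        obtain ⟨α, β, hαβ⟩ := T.exists_eq_smul_add_smul_add le_rfl ht
          (Ideal.pow_mem_pow hx 2) (by rw [pow_two]; exact Ideal.mul_mem_mul hx ha)
          (T.pow_notMem hx hs (by omega)) hxa hb
        rw [← add_sub_cancel (α • x ^ 2 + β • (x * a)) b]
        refine Ideal.add_mem _ (Ideal.mem_sup_left ?_) (Ideal.mem_sup_right hαβ)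
        refine Ideal.mem_span_singleton_mul.mpr ⟨α • x + β • a,
          Ideal.add_mem _ (smul_mem_ideal _ _ hx) (smul_mem_ideal _ _ ha), ?_⟩
        rw [mul_add, mul_smul_comm, mul_smul_comm, pow_two]
      have h2 : maximalIdeal A ^ j * (Ideal.span {x} * maximalIdeal A) ≤
          Ideal.span {x} * maximalIdeal A :=
        Ideal.mul_le.mpr fun a _ b hb => Ideal.mul_mem_left _ _ hb
      calc maximalIdeal A ^ (2 + j) = maximalIdeal A ^ j * maximalIdeal A ^ 2 := by
            rw [← pow_add, add_comm]
        _ ≤ maximalIdeal A ^ j * (Ideal.span {x} * maximalIdeal A ⊔ maximalIdeal A ^ 3) :=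
            Ideal.mul_mono_right h1
        _ = maximalIdeal A ^ j * (Ideal.span {x} * maximalIdeal A) ⊔
              maximalIdeal A ^ (2 + (j + 1)) := by
            rw [Ideal.mul_sup, ← pow_add, show j + 3 = 2 + (j + 1) by ring]
        _ ≤ Ideal.span {x} * maximalIdeal A ⊔ maximalIdeal A ^ (2 + (j + 1)) :=
            sup_le_sup_right h2 _
  have := hall (s - 1)
  rwa [show 2 + (s - 1) = s + 1 by omega, T.pow_eq_bot, sup_bot_eq] at this

/-- A general element `x` of the maximal ideal satisfies `x ^ s ≠ 0` and `m ^ 2 = x m`. -/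
theorem exists_sq_eq_span_mul [CharZero k] (T : TypeData k A h s t) (ht : 2 ≤ t)
    (hst : t + 1 ≤ s) :
    ∃ x ∈ maximalIdeal A, x ^ s ≠ 0 ∧
      maximalIdeal A ^ 2 = Ideal.span {x} * maximalIdeal A := by
  obtain ⟨x, hx, hs⟩ := T.exists_pow_ne_zero hst
  by_cases hgood : ∃ a ∈ maximalIdeal A, ∀ c : k, x * a - c • x ^ 2 ∉ maximalIdeal A ^ 3
  · obtain ⟨a, ha, hxa⟩ := hgood
    exact ⟨x, hx, hs, T.sq_eq_span_mul ht hst hx hs ha hxa⟩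
  push Not at hgood
  -- Multiplication by `x` has rank one on `m / m ^ 2`. Some `y` in its kernel has a square
  -- outside `k x ^ 2`, since otherwise all squares, hence all products, lie on this line.
  have hy : ∃ y ∈ maximalIdeal A, x * y ∈ maximalIdeal A ^ 3 ∧
      ∀ c : k, y ^ 2 - c • x ^ 2 ∉ maximalIdeal A ^ 3 := by
    by_contra! hcon
    obtain ⟨b, hb, hb'⟩ := T.exists_sub_smul_notMem le_rfl ht (x ^ 2)
    have hall : ∀ b ∈ maximalIdeal A ^ 2, ∃ c : k, b - c • x ^ 2 ∈ maximalIdeal A ^ 3 := by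
      intro b hb
      rw [pow_two] at hb
      induction hb using Submodule.mul_induction_on' with
      | mem_mul_mem a ha b hb =>
        obtain ⟨c, hc⟩ := hgood a ha
        obtain ⟨d, hd⟩ := hgood b hb
        have ha' : a - c • x ∈ maximalIdeal A := Ideal.sub_mem _ ha (smul_mem_ideal _ _ hx)
        have hb' : b - d • x ∈ maximalIdeal A := Ideal.sub_mem _ hb (smul_mem_ideal _ _ hx)
        have hxa : x * (a - c • x) ∈ maximalIdeal A ^ 3 := by
          rwa [mul_sub, mul_smul_comm, ← pow_two]
        have hxb : x * (b - d • x) ∈ maximalIdeal A ^ 3 := by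
          rwa [mul_sub, mul_smul_comm, ← pow_two]
        obtain ⟨p, hp⟩ := hcon _ ha' hxa
        obtain ⟨q, hq⟩ := hcon _ hb' hxb
        obtain ⟨r, hr⟩ := hcon _ (Ideal.add_mem _ ha' hb')
          (by rw [mul_add]; exact Ideal.add_mem _ hxa hxb)
        refine ⟨(2 : k)⁻¹ * (r - p - q) + c * d, ?_⟩
        have h2 : algebraMap k A (2 : k)⁻¹ * 2 = 1 := by
          rw [← map_ofNat (algebraMap k A) 2, ← map_mul, inv_mul_cancel₀ two_ne_zero, map_one]
        have e : a * b - ((2 : k)⁻¹ * (r - p - q) + c * d) • x ^ 2 =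
            algebraMap k A (2 : k)⁻¹ * (((a - c • x + (b - d • x)) ^ 2 - r • x ^ 2) -
              ((a - c • x) ^ 2 - p • x ^ 2) - ((b - d • x) ^ 2 - q • x ^ 2)) +
            algebraMap k A c * (x * (b - d • x)) + algebraMap k A d * (x * (a - c • x)) := by
          simp only [Algebra.smul_def, map_add, map_mul, map_sub]
          linear_combination (-(a - algebraMap k A c * x) * (b - algebraMap k A d * x)) * h2
        rw [e]
        exact Ideal.add_mem _ (Ideal.add_mem _
          (Ideal.mul_mem_left _ _ (Ideal.sub_mem _ (Ideal.sub_mem _ hr hp) hq))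
          (Ideal.mul_mem_left _ _ hxb)) (Ideal.mul_mem_left _ _ hxa)
      | add a _ b _ hx hy =>
        obtain ⟨c, hc⟩ := hx
        obtain ⟨d, hd⟩ := hy
        refine ⟨c + d, ?_⟩
        rw [add_smul, add_sub_add_comm]
        exact Ideal.add_mem _ hc hd
    obtain ⟨c, hc⟩ := hall b hb
    exact hb' c hc
  obtain ⟨y, hy, hxy, hyy⟩ := hy
  -- Replacing `x` by `x + ε y` makes the `y`-direction visible in `m ^ 2 / m ^ 3`; the `s`-th power
  -- stays nonzero for one of the values `1` and `2` of `ε`.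
  have hpow : ∀ ε : k, (x + ε • y) ^ s = x ^ s + ε ^ s • y ^ s := by
    intro ε
    obtain ⟨s', rfl⟩ : ∃ s', s = s' + 1 := ⟨s - 1, by omega⟩
    have := add_pow_sub_mem (y := ε • y) hx (smul_mem_ideal _ ε hy)
      (by rw [mul_smul_comm]; exact smul_mem_ideal _ _ hxy) s'
    rw [← _root_.smul_pow]
    exact sub_eq_zero.mp (T.eq_zero_of_mem_pow this)
  have hε : ∃ ε : k, ε ≠ 0 ∧ (x + ε • y) ^ s ≠ 0 := by
    by_contra! hcon
    have h1 := hcon 1 one_ne_zero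
    have h2 := hcon 2 two_ne_zero
    rw [hpow, one_pow, one_smul] at h1
    rw [hpow] at h2
    have h3 : ((2 : k) ^ s - 1) • y ^ s = 0 := by
      rw [sub_smul, one_smul]
      linear_combination h2 - h1
    have h4 : (2 : k) ^ s - 1 ≠ 0 := by
      rw [sub_ne_zero]
      have : (2 : ℕ) ^ s ≠ 1 := by
        have := Nat.one_lt_two_pow (n := s) (by omega)
        omega
      exact_mod_cast this
    have h5 := (smul_eq_zero.mp h3).resolve_left h4
    rw [h5, add_zero] at h1
    exact hs h1
  obtain ⟨ε, hε0, hεs⟩ := hε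
  have hx' : x + ε • y ∈ maximalIdeal A := Ideal.add_mem _ hx (smul_mem_ideal _ _ hy)
  refine ⟨x + ε • y, hx', hεs, T.sq_eq_span_mul (a := y) ht hst hx' hεs hy ?_⟩
  intro c hc
  have e : (x + ε • y) * y - c • (x + ε • y) ^ 2 =
      (ε * (1 - c * ε)) • y ^ 2 - c • x ^ 2 + (1 - 2 * c * ε) • (x * y) := by
    simp only [Algebra.smul_def, map_mul, map_sub, map_one, map_ofNat]
    ring
  have h1 : (ε * (1 - c * ε)) • y ^ 2 - c • x ^ 2 ∈ maximalIdeal A ^ 3 := by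
    rw [e] at hc
    simpa using Ideal.sub_mem _ hc (smul_mem_ideal _ (1 - 2 * c * ε) hxy)
  by_cases hcε : 1 - c * ε = 0
  · rw [hcε, mul_zero, zero_smul, zero_sub, neg_mem_iff] at h1
    have hc0 : c ≠ 0 := by
      rintro rfl
      simp at hcε
    have := smul_mem_ideal _ c⁻¹ h1
    rw [smul_smul, inv_mul_cancel₀ hc0, one_smul] at this
    exact T.pow_notMem hx hs (by omega) this
  · refine hyy ((ε * (1 - c * ε))⁻¹ * c) ?_
    have := smul_mem_ideal _ (ε * (1 - c * ε))⁻¹ h1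
    rwa [smul_sub, smul_smul, smul_smul, inv_mul_cancel₀ (mul_ne_zero hε0 hcε), one_smul] at this

end TypeData

/-! ### Frames -/

/-- A frame: elements `x`, `y` of the maximal ideal with `x ^ s ≠ 0`, `m ^ 2 = x m`, `x ^ t y = 0`
and such that `x y` is not a multiple of `x ^ 2` modulo `m ^ 3`. -/
structure IsFrame (k : Type*) {A : Type*} [Field k] [CommRing A] [IsLocalRing A] [Algebra k A]
    (s t : ℕ) (x y : A) : Prop where
  x_mem : x ∈ maximalIdeal A
  y_mem : y ∈ maximalIdeal A
  x_pow_ne : x ^ s ≠ 0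
  sq_eq : maximalIdeal A ^ 2 = Ideal.span {x} * maximalIdeal A
  x_pow_mul_y : x ^ t * y = 0
  notMem : ∀ c : k, x * y - c • x ^ 2 ∉ maximalIdeal A ^ 3

theorem pow_mul_aeval_eq {k A : Type*} [CommSemiring k] [CommRing A] [Algebra k A]
    (x : A) (F : k[X]) {j : ℕ} (h0 : x ^ (j + 1) = 0) :
    x ^ j * aeval x F = F.coeff 0 • x ^ j := by
  rw [aeval_eq_add_divX, Algebra.smul_def]
  linear_combination aeval x F.divX * h0

section

variable {A : Type*} [CommRing A] [IsLocalRing A]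

theorem pow_succ_eq_span_mul {x : A}
    (hsq : maximalIdeal A ^ 2 = Ideal.span {x} * maximalIdeal A) (j : ℕ) :
    maximalIdeal A ^ (j + 1) = Ideal.span {x ^ j} * maximalIdeal A := by
  induction j with
  | zero => simp
  | succ j ih =>
    rw [pow_succ, ih, mul_assoc, ← pow_two, hsq, ← mul_assoc,
      Ideal.span_singleton_mul_span_singleton, ← pow_succ]

theorem exists_eq_pow_mul {x : A}
    (hsq : maximalIdeal A ^ 2 = Ideal.span {x} * maximalIdeal A) (j : ℕ) {b : A}
    (hb : b ∈ maximalIdeal A ^ (j + 1)) : ∃ d ∈ maximalIdeal A, b = x ^ j * d := by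
  rw [pow_succ_eq_span_mul hsq j, Ideal.mem_span_singleton_mul] at hb
  obtain ⟨d, hd, rfl⟩ := hb
  exact ⟨d, hd, rfl⟩

end

namespace TypeData

variable {k : Type*} [Field k] {A : Type*} [CommRing A] [IsLocalRing A] [Algebra k A]
  {h s t : ℕ} {x y : A}

theorem pow_eq_zero (T : TypeData k A h s t) (hx : x ∈ maximalIdeal A) {j : ℕ} (hj : s < j) :
    x ^ j = 0 :=
  pow_eq_zero_of_le hj (T.eq_zero_of_mem_pow (Ideal.pow_mem_pow hx _))

/-- Beyond degree `t` the powers of the maximal ideal consist of polynomials in `x`. -/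
theorem exists_eq_pow_mul_aeval (T : TypeData k A h s t) (hx : x ∈ maximalIdeal A)
    (hs : x ^ s ≠ 0) {j : ℕ} (hj : t + 1 ≤ j) {b : A} (hb : b ∈ maximalIdeal A ^ j) :
    ∃ F : k[X], b = x ^ j * aeval x F := by
  by_cases hjs : s < j
  · exact ⟨0, by simpa using T.eq_zero_of_mem_pow (Ideal.pow_le_pow_right hjs hb)⟩
  obtain ⟨i, hi⟩ : ∃ i, i + j = s + 1 := ⟨s + 1 - j, by omega⟩
  induction i generalizing j b with
  | zero => omega
  | succ i ih =>
    obtain ⟨α, hα⟩ := T.exists_sub_smul_mem hj (by omega) (Ideal.pow_mem_pow hx j)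
      (T.pow_notMem hx hs (by omega)) hb
    by_cases hjs' : s < j + 1
    · have h0 := T.eq_zero_of_mem_pow (Ideal.pow_le_pow_right hjs' hα)
      refine ⟨C α, ?_⟩
      rw [aeval_C, mul_comm, ← Algebra.smul_def]
      exact sub_eq_zero.mp h0
    · obtain ⟨F, hF⟩ := ih (by omega) hα hjs' (by omega)
      refine ⟨C α + X * F, ?_⟩
      rw [map_add, map_mul, aeval_X, aeval_C]
      rw [Algebra.smul_def] at hF
      linear_combination hF

/-- Let `m ^ 2 = x m`. For `a` in the maximal ideal the element `x ^ t a` is a polynomial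
`x ^ (t + 1) F(x)`, and then `a - x F(x)` is annihilated by `x ^ t`. Unless it completes `x` to a
frame, `x a` is a multiple of `x ^ 2` modulo `m ^ 3`, which cannot hold for all `a`. -/
theorem exists_isFrame [CharZero k] (T : TypeData k A h s t) (ht : 2 ≤ t) (hst : t + 1 ≤ s) :
    ∃ x y : A, IsFrame k s t x y := by
  obtain ⟨x, hx, hs, hsq⟩ := T.exists_sq_eq_span_mul ht hst
  by_contra! hcon
  obtain ⟨b, hb, hb'⟩ := T.exists_sub_smul_notMem le_rfl ht (x ^ 2)
  obtain ⟨a, ha, rfl⟩ := exists_eq_pow_mul hsq 1 hb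
  have hxta : x ^ t * a ∈ maximalIdeal A ^ (t + 1) := by
    rw [pow_succ]; exact Ideal.mul_mem_mul (Ideal.pow_mem_pow hx t) ha
  obtain ⟨F, hF⟩ := T.exists_eq_pow_mul_aeval hx hs le_rfl hxta
  have hc : ∃ c : k, x * (a - x * aeval x F) - c • x ^ 2 ∈ maximalIdeal A ^ 3 := by
    by_contra! hc
    exact hcon x (a - x * aeval x F) ⟨hx, Ideal.sub_mem _ ha (Ideal.mul_mem_right _ _ hx), hs,
      hsq, by linear_combination hF, hc⟩
  obtain ⟨c, hc⟩ := hc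
  refine hb' (c + F.coeff 0) ?_
  have e : x ^ 1 * a - (c + F.coeff 0) • x ^ 2 =
      (x * (a - x * aeval x F) - c • x ^ 2) + x ^ 3 * aeval x F.divX := by
    rw [aeval_eq_add_divX x F]
    simp only [Algebra.smul_def, map_add]
    ring
  rw [e]
  exact Ideal.add_mem _ hc (Ideal.mul_mem_right _ _ (Ideal.pow_mem_pow hx 3))

end TypeData

namespace IsFrame

variable {k : Type*} [Field k] {A : Type*} [CommRing A] [IsLocalRing A] [Algebra k A]
  {h s t : ℕ} {x y : A}

theorem x_pow_mul_y_eq_zero (Fr : IsFrame k s t x y) {j : ℕ} (hj : t ≤ j) : x ^ j * y = 0 := by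
  rw [show j = (j - t) + t by omega, pow_add, mul_assoc, Fr.x_pow_mul_y, mul_zero]

theorem x_mul_y_mem (Fr : IsFrame k s t x y) : x * y ∈ maximalIdeal A ^ 2 := by
  rw [pow_two]; exact Ideal.mul_mem_mul Fr.x_mem Fr.y_mem

/-- From degree two on the powers of the maximal ideal lie in `k[x] + k[x] y`. -/
theorem exists_eq_of_mem_pow (Fr : IsFrame k s t x y) (T : TypeData k A h s t) (ht : 2 ≤ t)
    (hst : t + 1 ≤ s) (i : ℕ) {b : A} (hb : b ∈ maximalIdeal A ^ (i + 2)) :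
    ∃ F G : k[X], b = x ^ (i + 2) * aeval x F + x ^ (i + 1) * aeval x G * y := by
  by_cases his : s < i + 2
  · exact ⟨0, 0, by simpa using T.eq_zero_of_mem_pow (Ideal.pow_le_pow_right his hb)⟩
  obtain ⟨l, hl⟩ : ∃ l, l + (i + 2) = s + 1 := ⟨s + 1 - (i + 2), by omega⟩
  induction l generalizing i b with
  | zero => omega
  | succ l ih =>
    obtain ⟨d, hd, rfl⟩ := exists_eq_pow_mul Fr.sq_eq (i + 1) hb
    have hxd : x * d ∈ maximalIdeal A ^ 2 := by
      rw [pow_two]; exact Ideal.mul_mem_mul Fr.x_mem hd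
    obtain ⟨α, β, hαβ⟩ := T.exists_eq_smul_add_smul_add le_rfl ht
      (Ideal.pow_mem_pow Fr.x_mem 2) Fr.x_mul_y_mem (T.pow_notMem Fr.x_mem Fr.x_pow_ne (by omega))
      Fr.notMem hxd
    have h1 : x ^ i * (x * d - (α • x ^ 2 + β • (x * y))) ∈ maximalIdeal A ^ (i + 1 + 2) := by
      rw [show i + 1 + 2 = i + 3 by ring, pow_add]
      exact Ideal.mul_mem_mul (Ideal.pow_mem_pow Fr.x_mem i) hαβ
    have h2 : ∃ F G : k[X], x ^ i * (x * d - (α • x ^ 2 + β • (x * y))) =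
        x ^ (i + 1 + 2) * aeval x F + x ^ (i + 1 + 1) * aeval x G * y := by
      by_cases his' : s < i + 1 + 2
      · exact ⟨0, 0, by simpa using T.eq_zero_of_mem_pow (Ideal.pow_le_pow_right his' h1)⟩
      · exact ih (i + 1) h1 his' (by omega)
    obtain ⟨F, G, hFG⟩ := h2
    refine ⟨C α + X * F, C β + X * G, ?_⟩
    simp only [map_add, map_mul, aeval_X, aeval_C]
    simp only [Algebra.smul_def] at hFG
    linear_combination hFG

theorem x_pow_mul_y_notMem (Fr : IsFrame k s t x y) (T : TypeData k A h s t) (ht : 2 ≤ t)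
    (hst : t + 1 ≤ s) : x ^ (t - 1) * y ∉ maximalIdeal A ^ (t + 1) := by
  intro hmem
  obtain ⟨a, ha, ha'⟩ := T.exists_sub_smul_notMem ht le_rfl (x ^ t)
  obtain ⟨F, G, hFG⟩ := Fr.exists_eq_of_mem_pow T ht hst (t - 2)
    (by rwa [show t - 2 + 2 = t by omega])
  rw [show t - 2 + 2 = t by omega, show t - 2 + 1 = t - 1 by omega] at hFG
  refine ha' (F.coeff 0) ?_
  rw [hFG, aeval_eq_add_divX x F]
  have e : x ^ t * (algebraMap k A (F.coeff 0) + x * aeval x F.divX) +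
      x ^ (t - 1) * aeval x G * y - F.coeff 0 • x ^ t =
      x ^ (t + 1) * aeval x F.divX + aeval x G * (x ^ (t - 1) * y) := by
    rw [Algebra.smul_def]; ring
  rw [e]
  exact Ideal.add_mem _ (Ideal.mul_mem_right _ _ (Ideal.pow_mem_pow Fr.x_mem _))
    (Ideal.mul_mem_left _ _ hmem)

theorem dvd_of_x_pow_mul_aeval_eq_zero (Fr : IsFrame k s t x y) {j : ℕ} {F : k[X]}
    (hF : x ^ j * aeval x F = 0) (hj : j ≤ s + 1) : X ^ (s + 1 - j) ∣ F := by
  have h1 : aeval x (X ^ j * F) = 0 := by rw [map_mul, map_pow, aeval_X, hF]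
  have h2 := X_pow_dvd_of_aeval_eq_zero Fr.x_mem Fr.x_pow_ne h1
  rw [show s + 1 = j + (s + 1 - j) by omega, pow_add] at h2
  exact (mul_dvd_mul_iff_left (pow_ne_zero _ X_ne_zero)).mp h2

/-- The elements `x ^ i` with `i ≤ s` and `x ^ i y` with `i < t` are linearly independent. -/
theorem dvd_and_dvd (Fr : IsFrame k s t x y) (T : TypeData k A h s t) (ht : 2 ≤ t)
    (hst : 2 * t ≤ s) {F G : k[X]} (hFG : aeval x F + aeval x G * y = 0) :
    X ^ (s + 1) ∣ F ∧ X ^ t ∣ G := by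
  have hG : X ^ t ∣ G := by
    by_cases hG0 : G = 0
    · rw [hG0]; exact dvd_zero _
    obtain ⟨i, g, rfl, hg⟩ := exists_eq_X_pow_mul hG0
    by_contra hnd
    have hit : i < t := by
      by_contra hit
      exact hnd (Dvd.dvd.mul_right (pow_dvd_pow _ (by omega)) _)
    have h1 : x ^ t * aeval x F = 0 := by
      linear_combination x ^ t * hFG - aeval x (X ^ i * g) * Fr.x_pow_mul_y
    obtain ⟨F₁, rfl⟩ := Fr.dvd_of_x_pow_mul_aeval_eq_zero h1 (by omega)
    refine Fr.x_pow_mul_y_notMem T ht (by omega) ?_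
    rw [← Ideal.unit_mul_mem_iff_mem _ (isUnit_aeval Fr.x_mem hg)]
    have h2 : aeval x g * (x ^ (t - 1) * y) =
        -(x ^ (s + 1 - t) * (x ^ (t - 1 - i) * aeval x F₁)) := by
      simp only [map_mul, map_pow, aeval_X] at hFG
      have e : x ^ (t - 1) = x ^ (t - 1 - i) * x ^ i := by
        rw [← pow_add]; congr 1; omega
      rw [e]
      linear_combination x ^ (t - 1 - i) * hFG
    rw [h2, neg_mem_iff]
    exact Ideal.mul_mem_right _ _
      (Ideal.pow_le_pow_right (by omega) (Ideal.pow_mem_pow Fr.x_mem _))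
  refine ⟨?_, hG⟩
  obtain ⟨G', rfl⟩ := hG
  refine X_pow_dvd_of_aeval_eq_zero Fr.x_mem Fr.x_pow_ne ?_
  simp only [map_mul, map_pow, aeval_X] at hFG
  linear_combination hFG - aeval x G' * Fr.x_pow_mul_y

/-- The algebra is the sum of `k[x] + k[x] y` and of the annihilator of `x`. -/
theorem exists_add_annihilator (Fr : IsFrame k s t x y) (T : TypeData k A h s t) (ht : 2 ≤ t)
    (hst : t + 1 ≤ s) (a : A) :
    ∃ (F G : k[X]) (e : A), e ∈ maximalIdeal A ∧ x * e = 0 ∧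
      a = aeval x F + aeval x G * y + e := by
  obtain ⟨c, hc⟩ := T.res a
  have hxa : x * (a - algebraMap k A c) ∈ maximalIdeal A ^ (0 + 2) := by
    rw [zero_add, pow_two]; exact Ideal.mul_mem_mul Fr.x_mem hc
  obtain ⟨F, G, hFG⟩ := Fr.exists_eq_of_mem_pow T ht hst 0 hxa
  refine ⟨C c + X * F, G, a - algebraMap k A c - x * aeval x F - aeval x G * y, ?_, ?_, ?_⟩
  · exact Ideal.sub_mem _ (Ideal.sub_mem _ hc (Ideal.mul_mem_right _ _ Fr.x_mem))
      (Ideal.mul_mem_left _ _ Fr.y_mem)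
  · linear_combination hFG
  · simp only [map_add, map_mul, aeval_X, aeval_C]
    ring

/-- The annihilator of `x` in `k[x] + k[x] y` is spanned by `x ^ s` and `x ^ (t - 1) y`. -/
theorem exists_eq_of_x_mul_eq_zero (Fr : IsFrame k s t x y) (T : TypeData k A h s t) (ht : 2 ≤ t)
    (hst : 2 * t ≤ s) {F G : k[X]} (h0 : x * (aeval x F + aeval x G * y) = 0) :
    ∃ α β : k, aeval x F + aeval x G * y = α • x ^ s + β • (x ^ (t - 1) * y) := by
  have h1 : aeval x (X * F) + aeval x (X * G) * y = 0 := by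
    simp only [map_mul, aeval_X]
    linear_combination h0
  obtain ⟨h2, h3⟩ := Fr.dvd_and_dvd T ht hst h1
  rw [pow_succ', mul_dvd_mul_iff_left X_ne_zero] at h2
  rw [show t = (t - 1) + 1 by omega, pow_succ', mul_dvd_mul_iff_left X_ne_zero] at h3
  obtain ⟨F, rfl⟩ := h2
  obtain ⟨G, rfl⟩ := h3
  refine ⟨F.coeff 0, G.coeff 0, ?_⟩
  have h4 := Fr.x_pow_mul_y
  rw [show t = (t - 1) + 1 by omega] at h4
  simp only [map_mul, map_pow, aeval_X]
  rw [pow_mul_aeval_eq x F (T.pow_eq_zero Fr.x_mem (Nat.lt_succ_self s)), aeval_eq_add_divX x G,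
    Algebra.smul_def (G.coeff 0)]
  linear_combination aeval x G.divX * h4

theorem mul_x_pow_eq_zero (Fr : IsFrame k s t x y) (T : TypeData k A h s t) {b : A}
    (hb : b ∈ maximalIdeal A) : b * x ^ s = 0 := by
  refine T.eq_zero_of_mem_pow ?_
  rw [pow_succ']
  exact Ideal.mul_mem_mul hb (Ideal.pow_mem_pow Fr.x_mem s)

/-- In a frame, `y ^ 2 = x g(x) y + x ^ (s - t + 1) b(x)`. The Gorenstein property forces
`b(0) ≠ 0`, since otherwise `x ^ (t - 1) y` would be a socle element outside the line of
`x ^ s`. -/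
theorem exists_y_sq (Fr : IsFrame k s t x y) (T : TypeData k A h s t) (ht : 2 ≤ t)
    (hst : 2 * t ≤ s) :
    ∃ g b : k[X], b.coeff 0 ≠ 0 ∧
      y ^ 2 = x * aeval x g * y + x ^ (s - t + 1) * aeval x b := by
  obtain ⟨F, g, hFg⟩ := Fr.exists_eq_of_mem_pow T ht (by omega) 0
    (Ideal.pow_mem_pow Fr.y_mem 2)
  have h1 : x ^ (t + 2) * aeval x F = 0 := by
    linear_combination x ^ t * (-hFg) + (y - x * aeval x g) * Fr.x_pow_mul_y
  obtain ⟨b, rfl⟩ := Fr.dvd_of_x_pow_mul_aeval_eq_zero h1 (by omega)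
  have hy : y ^ 2 = x * aeval x g * y + x ^ (s - t + 1) * aeval x b := by
    have e : s - t + 1 = 2 + (s + 1 - (t + 2)) := by omega
    rw [hFg, e]
    simp only [map_mul, map_pow, aeval_X]
    ring
  refine ⟨g, b, ?_, hy⟩
  intro hb0
  have hys : x ^ (t - 1) * y * y = 0 := by
    have h2 : x ^ (t - 1) * y * y = x ^ t * y * aeval x g + x ^ s * aeval x b := by
      have e1 : x ^ t = x ^ (t - 1) * x := by rw [← pow_succ]; congr 1; omega
      have e2 : x ^ s = x ^ (t - 1) * x ^ (s - t + 1) := by rw [← pow_add]; congr 1; omega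
      rw [e1, e2]
      linear_combination x ^ (t - 1) * hy
    rw [h2, Fr.x_pow_mul_y,
      pow_mul_aeval_eq x b (T.pow_eq_zero Fr.x_mem (Nat.lt_succ_self s)), hb0]
    simp
  have hsoc : ∀ a ∈ maximalIdeal A, a * (x ^ (t - 1) * y) = 0 := by
    intro a ha
    obtain ⟨F, G, e, he, hxe, rfl⟩ := Fr.exists_add_annihilator T ht (by omega) a
    have hF0 : F.coeff 0 = 0 := by
      rw [add_assoc] at ha
      exact coeff_zero_eq_zero_of_add_mem Fr.x_mem
        (Ideal.add_mem _ (Ideal.mul_mem_left _ _ Fr.y_mem) he) ha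
    rw [aeval_eq_add_divX x F, hF0, map_zero]
    have e1 : x ^ t = x ^ (t - 1) * x := by rw [← pow_succ]; congr 1; omega
    have e2 : x ^ (t - 1) = x * x ^ (t - 2) := by rw [← pow_succ']; congr 1; omega
    have h3 : x ^ (t - 1) * e = 0 := by rw [e2]; linear_combination x ^ (t - 2) * hxe
    have h4 := Fr.x_pow_mul_y
    rw [e1] at h4
    linear_combination aeval x F.divX * h4 + aeval x G * hys + y * h3
  obtain ⟨c, hc⟩ := T.socle _ (x ^ s) Fr.x_pow_ne hsoc fun b hb => Fr.mul_x_pow_eq_zero T hb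
  refine Fr.x_pow_mul_y_notMem T ht (by omega) ?_
  rw [hc]
  exact smul_mem_ideal _ _ (Ideal.pow_le_pow_right (by omega) (Ideal.pow_mem_pow Fr.x_mem s))

theorem exists_x_pow_mul_y_sq (Fr : IsFrame k s t x y) (T : TypeData k A h s t) (ht : 2 ≤ t)
    (hst : 2 * t ≤ s) : ∃ β : k, β ≠ 0 ∧ x ^ (t - 1) * y * y = β • x ^ s := by
  obtain ⟨g, b, hb, hy⟩ := Fr.exists_y_sq T ht hst
  refine ⟨b.coeff 0, hb, ?_⟩
  have h2 : x ^ (t - 1) * y * y = x ^ t * y * aeval x g + x ^ s * aeval x b := by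
    have e1 : x ^ t = x ^ (t - 1) * x := by rw [← pow_succ]; congr 1; omega
    have e2 : x ^ s = x ^ (t - 1) * x ^ (s - t + 1) := by rw [← pow_add]; congr 1; omega
    rw [e1, e2]
    linear_combination x ^ (t - 1) * hy
  rw [h2, Fr.x_pow_mul_y,
    pow_mul_aeval_eq x b (T.pow_eq_zero Fr.x_mem (Nat.lt_succ_self s)), zero_mul, zero_add]

theorem mul_eq_zero_of_mem_sq (Fr : IsFrame k s t x y) {e a : A} (hxe : x * e = 0)
    (ha : a ∈ maximalIdeal A ^ 2) : a * e = 0 := by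
  obtain ⟨d, _, rfl⟩ := exists_eq_pow_mul Fr.sq_eq 1 ha
  linear_combination d * hxe

theorem exists_eq_smul_of_mem_sq (Fr : IsFrame k s t x y) (T : TypeData k A h s t) (ht : 2 ≤ t)
    (hst : 2 * t ≤ s) {a : A} (ha : a ∈ maximalIdeal A ^ 2) (hxa : x * a = 0)
    (hya : y * a = 0) : ∃ α : k, a = α • x ^ s := by
  obtain ⟨F, G, hFG⟩ := Fr.exists_eq_of_mem_pow T ht (by omega) 0 ha
  have h1 : a = aeval x (X ^ 2 * F) + aeval x (X * G) * y := by
    rw [hFG]; simp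
  rw [h1] at hxa
  obtain ⟨α, β, hαβ⟩ := Fr.exists_eq_of_x_mul_eq_zero T ht hst hxa
  rw [← h1] at hαβ
  obtain ⟨c, hc, hc'⟩ := Fr.exists_x_pow_mul_y_sq T ht hst
  have h2 : (β * c) • x ^ s = 0 := by
    rw [mul_smul, ← hc']
    rw [hαβ] at hya
    have h3 := Fr.mul_x_pow_eq_zero T Fr.y_mem
    simp only [Algebra.smul_def] at hya ⊢
    linear_combination hya - algebraMap k A α * h3
  have h3 : β = 0 :=
    (mul_eq_zero.mp ((smul_eq_zero.mp h2).resolve_right Fr.x_pow_ne)).resolve_right hc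
  exact ⟨α, by rw [hαβ, h3, zero_smul, add_zero]⟩

/-- The algebra is the sum of `k[x] + k[x] y` and of the common annihilator of `x` and `y`. -/
theorem exists_eq_add_annihilator (Fr : IsFrame k s t x y) (T : TypeData k A h s t) (ht : 2 ≤ t)
    (hst : 2 * t ≤ s) (a : A) :
    ∃ (F G : k[X]) (e : A), x * e = 0 ∧ y * e = 0 ∧ a = aeval x F + aeval x G * y + e := by
  obtain ⟨F, G, e, he, hxe, rfl⟩ := Fr.exists_add_annihilator T ht (by omega) a
  have hye2 : y * e ∈ maximalIdeal A ^ 2 := by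
    rw [pow_two]; exact Ideal.mul_mem_mul Fr.y_mem he
  have hy2 : y * (y * e) = 0 := by
    have := Fr.mul_eq_zero_of_mem_sq hxe (Ideal.pow_mem_pow Fr.y_mem 2)
    linear_combination this
  obtain ⟨α, hα⟩ := Fr.exists_eq_smul_of_mem_sq T ht hst hye2 (by linear_combination y * hxe) hy2
  obtain ⟨c, hc, hc'⟩ := Fr.exists_x_pow_mul_y_sq T ht hst
  refine ⟨F, G + C (α / c) * X ^ (t - 1), e - (α / c) • (x ^ (t - 1) * y), ?_, ?_, ?_⟩
  · have e1 : x ^ t = x * x ^ (t - 1) := by rw [← pow_succ']; congr 1; omega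
    have h4 := Fr.x_pow_mul_y
    rw [e1] at h4
    rw [Algebra.smul_def]
    linear_combination hxe - algebraMap k A (α / c) * h4
  · have h5 : (α / c) • (x ^ (t - 1) * y * y) = α • x ^ s := by
      rw [hc', smul_smul, div_mul_cancel₀ _ hc]
    rw [mul_sub, hα, ← h5, mul_smul_comm]
    simp only [Algebra.smul_def]
    ring
  · simp only [map_add, map_mul, map_pow, aeval_X, aeval_C, Algebra.smul_def]
    ring

end IsFrame

/-! ### Orthonormal complements of a frame -/

theorem aeval_modByMonic_X_pow {k A : Type*} [Field k] [CommRing A] [Algebra k A] {x : A} {n : ℕ}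
    {y : A} (hx : x ^ n * y = 0) (F : k[X]) : aeval x (F %ₘ X ^ n) * y = aeval x F * y := by
  conv_rhs => rw [← modByMonic_add_div F (X ^ n : k[X])]
  rw [map_add, map_mul, map_pow, aeval_X]
  linear_combination (-aeval x (F /ₘ X ^ n)) * hx

theorem modByMonic_X_pow_mem_degreeLT {k : Type*} [Field k] (n : ℕ) (F : k[X]) :
    F %ₘ X ^ n ∈ degreeLT k n := by
  rw [mem_degreeLT, ← degree_X_pow (R := k) n]
  exact degree_modByMonic_lt F (monic_X_pow n)

theorem eq_zero_of_mem_degreeLT_of_dvd {k : Type*} [Field k] {n : ℕ} {F : k[X]}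
    (hF : F ∈ degreeLT k n) (hd : X ^ n ∣ F) : F = 0 := by
  rw [mem_degreeLT, ← degree_X_pow (R := k) n] at hF
  exact eq_zero_of_dvd_of_degree_lt hd hF

theorem finrank_degreeLT {k : Type*} [Field k] (n : ℕ) :
    Module.finrank k (degreeLT k n) = n := by
  rw [(degreeLTEquiv k n).finrank_eq, Module.finrank_fin_fun]

instance {k : Type*} [Field k] (n : ℕ) : Module.Finite k (degreeLT k n) :=
  Module.Finite.equiv (degreeLTEquiv k n).symm

/-- The linear map sending a pair of polynomials `F`, `G` of degrees less than `m` and `n` and an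
element `v` of `V` to `F(x) + G(x) y + v`. -/
noncomputable def combMap {k A : Type*} [Field k] [CommRing A] [Algebra k A] (m n : ℕ) (x y : A)
    (V : Submodule k A) : (degreeLT k m × degreeLT k n) × V →ₗ[k] A :=
  LinearMap.coprod
    (LinearMap.coprod ((aeval x).toLinearMap ∘ₗ (degreeLT k m).subtype)
      (LinearMap.mulRight k y ∘ₗ (aeval x).toLinearMap ∘ₗ (degreeLT k n).subtype)) V.subtype

theorem combMap_apply {k A : Type*} [Field k] [CommRing A] [Algebra k A] {m n : ℕ} {x y : A}
    {V : Submodule k A} (p : (degreeLT k m × degreeLT k n) × V) :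
    combMap m n x y V p = aeval x (p.1.1 : k[X]) + aeval x (p.1.2 : k[X]) * y + p.2 := rfl

namespace IsFrame

variable {k : Type*} [Field k] {A : Type*} [CommRing A] [IsLocalRing A] [Algebra k A]
  {h s t : ℕ} {x y : A}

/-- The common annihilator of `x` and `y` as a `k`-subspace. -/
def annihilatorPair (k : Type*) {A : Type*} [Field k] [CommRing A] [Algebra k A] (x y : A) :
    Submodule k A where
  carrier := {e | x * e = 0 ∧ y * e = 0}
  add_mem' := by
    rintro a b ⟨h1, h2⟩ ⟨h3, h4⟩
    exact ⟨by rw [mul_add, h1, h3, add_zero], by rw [mul_add, h2, h4, add_zero]⟩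
  zero_mem' := ⟨mul_zero _, mul_zero _⟩
  smul_mem' := by
    rintro c a ⟨h1, h2⟩
    exact ⟨by rw [mul_smul_comm, h1, smul_zero], by rw [mul_smul_comm, h2, smul_zero]⟩

theorem mem_maximalIdeal_of_x_mul_eq_zero (Fr : IsFrame k s t x y) {e : A} (he : x * e = 0) :
    e ∈ maximalIdeal A := by
  intro hu
  have hx0 : x = 0 := hu.mul_left_eq_zero.mp he
  have h1 := Fr.notMem 0
  rw [hx0] at h1
  simp at h1

/-- Products of two elements that annihilate `x` and `y` are multiples of `x ^ s`. -/
theorem mul_mem_line (Fr : IsFrame k s t x y) (T : TypeData k A h s t) (ht : 2 ≤ t)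
    (hst : 2 * t ≤ s) {v w : A} (hv : v ∈ annihilatorPair k x y)
    (hw : w ∈ annihilatorPair k x y) : ∃ α : k, v * w = α • x ^ s := by
  refine Fr.exists_eq_smul_of_mem_sq T ht hst ?_ ?_ ?_
  · rw [pow_two]
    exact Ideal.mul_mem_mul (Fr.mem_maximalIdeal_of_x_mul_eq_zero hv.1)
      (Fr.mem_maximalIdeal_of_x_mul_eq_zero hw.1)
  · rw [← mul_assoc, hv.1, zero_mul]
  · rw [← mul_assoc, hv.2, zero_mul]

/-- Multiplication is a nondegenerate quadratic form, with values in the line of `x ^ s`, on a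
complement of this line in the common annihilator of `x` and `y`. An orthonormal basis completes
the frame to a system of generators of the maximal ideal. -/
theorem exists_orthonormal [CharZero k] [IsAlgClosed k] (Fr : IsFrame k s t x y)
    (T : TypeData k A h s t) (ht : 2 ≤ t) (hst : 2 * t ≤ s) :
    ∃ (d : ℕ) (e : Fin d → A), d + 2 = h ∧ (∀ i, x * e i = 0) ∧ (∀ i, y * e i = 0) ∧
      (∀ i j, i ≠ j → e i * e j = 0) ∧ (∀ i, e i ^ 2 = x ^ s) ∧
      maximalIdeal A ≤ Ideal.span {x, y} ⊔ Ideal.span (Set.range e) := by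
  classical
  have hfin := T.finite
  have hxs : x ^ s ∈ annihilatorPair k x y :=
    ⟨Fr.mul_x_pow_eq_zero T Fr.x_mem, Fr.mul_x_pow_eq_zero T Fr.y_mem⟩
  obtain ⟨V, hVinf, hVsup⟩ : ∃ V : Submodule k A, Submodule.span k {x ^ s} ⊓ V = ⊥ ∧
      Submodule.span k {x ^ s} ⊔ V = annihilatorPair k x y := by
    obtain ⟨C, hC⟩ := Submodule.exists_isCompl (Submodule.span k {x ^ s})
    have hle : Submodule.span k {x ^ s} ≤ annihilatorPair k x y :=
      (Submodule.span_singleton_le_iff_mem _ _).mpr hxs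
    refine ⟨C ⊓ annihilatorPair k x y, ?_, ?_⟩
    · rw [← inf_assoc, hC.inf_eq_bot, bot_inf_eq]
    · rw [← sup_inf_assoc_of_le _ hle, hC.sup_eq_top, top_inf_eq]
  have hVK : V ≤ annihilatorPair k x y := hVsup ▸ le_sup_right
  have hVline : ∀ v ∈ V, ∀ α : k, v = α • x ^ s → v = 0 := by
    intro v hv α hα
    have : v ∈ Submodule.span k {x ^ s} ⊓ V :=
      ⟨Submodule.mem_span_singleton.mpr ⟨α, hα.symm⟩, hv⟩
    rwa [hVinf, Submodule.mem_bot] at this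
  have hdec : ∀ a : A, ∃ (F G : k[X]) (v : V), a = aeval x F + aeval x G * y + v := by
    intro a
    obtain ⟨F, G, e, hxe, hye, rfl⟩ := Fr.exists_eq_add_annihilator T ht hst a
    have he : e ∈ Submodule.span k {x ^ s} ⊔ V := by rw [hVsup]; exact ⟨hxe, hye⟩
    obtain ⟨w, hw, v, hv, rfl⟩ := Submodule.mem_sup.mp he
    obtain ⟨α, rfl⟩ := Submodule.mem_span_singleton.mp hw
    refine ⟨F + C α * X ^ s, G, ⟨v, hv⟩, ?_⟩
    simp only [map_add, map_mul, map_pow, aeval_X, aeval_C, Algebra.smul_def]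
    ring
  -- The dimension of `V`.
  have hbij : Function.Bijective (combMap (s + 1) t x y V) := by
    constructor
    · rw [← LinearMap.ker_eq_bot, LinearMap.ker_eq_bot']
      rintro ⟨⟨⟨F, hF⟩, ⟨G, hG⟩⟩, ⟨v, hv⟩⟩ h0
      rw [combMap_apply] at h0
      change aeval x F + aeval x G * y + v = 0 at h0
      have h1 : x * (aeval x F + aeval x G * y) = 0 := by
        linear_combination x * h0 - (hVK hv).1
      obtain ⟨α, β, hαβ⟩ := Fr.exists_eq_of_x_mul_eq_zero T ht hst h1
      have hm : v ∈ maximalIdeal A := Fr.mem_maximalIdeal_of_x_mul_eq_zero (hVK hv).1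
      obtain ⟨c, hc, hc'⟩ := Fr.exists_x_pow_mul_y_sq T ht hst
      have h2 : (β * c) • x ^ s = 0 := by
        rw [mul_smul, ← hc']
        have h3 := Fr.mul_x_pow_eq_zero T Fr.y_mem
        have h4 := (hVK hv).2
        simp only [Algebra.smul_def] at hαβ ⊢
        linear_combination y * h0 - h4 - y * hαβ - algebraMap k A α * h3
      have h3 : β = 0 :=
        (mul_eq_zero.mp ((smul_eq_zero.mp h2).resolve_right Fr.x_pow_ne)).resolve_right hc
      have hv0 : v = 0 := by
        refine hVline v hv (-α) ?_
        rw [h3, zero_smul, add_zero] at hαβ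
        rw [neg_smul, ← hαβ]
        linear_combination h0
      rw [hv0, add_zero] at h0
      obtain ⟨hF', hG'⟩ := Fr.dvd_and_dvd T ht hst h0
      have hF0 := eq_zero_of_mem_degreeLT_of_dvd hF hF'
      have hG0 := eq_zero_of_mem_degreeLT_of_dvd hG hG'
      subst hF0 hG0 hv0
      rfl
    · intro a
      obtain ⟨F, G, v, rfl⟩ := hdec a
      refine ⟨((⟨F %ₘ X ^ (s + 1), modByMonic_X_pow_mem_degreeLT _ _⟩,
        ⟨G %ₘ X ^ t, modByMonic_X_pow_mem_degreeLT _ _⟩), v), ?_⟩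
      rw [combMap_apply]
      have h1 : aeval x (F %ₘ X ^ (s + 1)) * 1 = aeval x F * 1 := aeval_modByMonic_X_pow
        (by rw [mul_one]; exact T.pow_eq_zero Fr.x_mem (Nat.lt_succ_self s)) F
      rw [mul_one, mul_one] at h1
      simp only
      rw [h1, aeval_modByMonic_X_pow Fr.x_pow_mul_y]
  have hdim : Module.finrank k V + 2 = h := by
    have h1 := (LinearEquiv.ofBijective _ hbij).finrank_eq
    rw [Module.finrank_prod, Module.finrank_prod, finrank_degreeLT, finrank_degreeLT] at h1
    have h2 := T.finrank_add_one
    omega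
  -- The form given by multiplication on `V`.
  obtain ⟨φ, hφ⟩ : ∃ φ : A →ₗ[k] k, φ (x ^ s) = 1 :=
    Module.Projective.exists_dual_eq_one k Fr.x_pow_ne
  set B : LinearMap.BilinForm k V :=
    ((LinearMap.mul k A).compr₂ φ).compl₁₂ V.subtype V.subtype with hB
  have hBapp : ∀ v w : V, B v w = φ ((v : A) * w) := fun v w => rfl
  have hmul : ∀ v w : V, (v : A) * w = B v w • x ^ s := by
    intro v w
    obtain ⟨α, hα⟩ := Fr.mul_mem_line T ht hst (hVK v.2) (hVK w.2)
    rw [hBapp, hα, map_smul, hφ, smul_eq_mul, mul_one]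
  have hsymm : LinearMap.IsSymm B := ⟨fun v w => by
    simp only [hBapp, RingHom.id_apply, mul_comm]⟩
  have h2inv : Invertible (2 : k) := invertibleOfNonzero two_ne_zero
  obtain ⟨b, hb⟩ := LinearMap.BilinForm.exists_orthogonal_basis hsymm
  -- An isotropic basis vector is orthogonal to `V`, so it lies in the socle, the line of `x ^ s`.
  have hne : ∀ i, B (b i) (b i) ≠ 0 := by
    intro i h0
    have hVi : ∀ v : V, (v : A) * b i = 0 := by
      intro v
      have h1 : B v (b i) = 0 := by
        rw [← b.sum_repr v, map_sum, LinearMap.sum_apply]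
        refine Finset.sum_eq_zero fun j _ => ?_
        rw [map_smul, LinearMap.smul_apply]
        by_cases hji : j = i
        · rw [hji, h0, smul_zero]
        · rw [show B (b j) (b i) = 0 from hb hji, smul_zero]
      rw [hmul, h1, zero_smul]
    have hsoc : ∀ a ∈ maximalIdeal A, a * (b i : A) = 0 := by
      intro a ha
      obtain ⟨F, G, v, rfl⟩ := hdec a
      have hF0 : F.coeff 0 = 0 := by
        rw [add_assoc] at ha
        exact coeff_zero_eq_zero_of_add_mem Fr.x_mem (Ideal.add_mem _
          (Ideal.mul_mem_left _ _ Fr.y_mem)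
          (Fr.mem_maximalIdeal_of_x_mul_eq_zero (hVK v.2).1)) ha
      rw [aeval_eq_add_divX x F, hF0, map_zero]
      linear_combination aeval x F.divX * (hVK (b i).2).1 + aeval x G * (hVK (b i).2).2 + hVi v
    obtain ⟨c, hc⟩ := T.socle _ (x ^ s) Fr.x_pow_ne hsoc fun b hb => Fr.mul_x_pow_eq_zero T hb
    exact b.ne_zero i (Subtype.ext (hVline _ (b i).2 c hc))
  choose r hr using fun i => IsAlgClosed.exists_pow_nat_eq (B (b i) (b i)) (n := 2) (by omega)
  have hr0 : ∀ i, r i ≠ 0 := by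
    intro i hi
    have := hr i
    rw [hi] at this
    exact hne i (by rw [← this]; simp)
  refine ⟨Module.finrank k V, fun i => (r i)⁻¹ • (b i : A), hdim, ?_, ?_, ?_, ?_, ?_⟩
  · intro i
    rw [mul_smul_comm, (hVK (b i).2).1, smul_zero]
  · intro i
    rw [mul_smul_comm, (hVK (b i).2).2, smul_zero]
  · intro i j hij
    rw [smul_mul_smul_comm, hmul, show B (b i) (b j) = 0 from hb hij, zero_smul, smul_zero]
  · intro i
    rw [pow_two, smul_mul_smul_comm, hmul, ← hr i, smul_smul, pow_two]
    rw [show (r i)⁻¹ * (r i)⁻¹ * (r i * r i) = 1 by field_simp [hr0 i], one_smul]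
  · intro a ha
    obtain ⟨F, G, v, rfl⟩ := hdec a
    have hF0 : F.coeff 0 = 0 := by
      rw [add_assoc] at ha
      exact coeff_zero_eq_zero_of_add_mem Fr.x_mem (Ideal.add_mem _
        (Ideal.mul_mem_left _ _ Fr.y_mem) (Fr.mem_maximalIdeal_of_x_mul_eq_zero (hVK v.2).1)) ha
    rw [aeval_eq_add_divX x F, hF0, map_zero, zero_add]
    refine Ideal.add_mem _ (Ideal.mem_sup_left (Ideal.add_mem _ ?_ ?_)) (Ideal.mem_sup_right ?_)
    · exact Ideal.mul_mem_right _ _ (Ideal.subset_span (by simp))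
    · exact Ideal.mul_mem_left _ _ (Ideal.subset_span (by simp))
    · rw [← b.sum_repr v]
      push_cast
      refine Ideal.sum_mem _ fun i _ => ?_
      have e : (b.repr v i) • (b i : A) = (b.repr v i * r i) • ((r i)⁻¹ • (b i : A)) := by
        rw [smul_smul, mul_assoc, mul_inv_cancel₀ (hr0 i), mul_one]
      rw [e]
      exact smul_mem_ideal _ _ (Ideal.subset_span ⟨i, rfl⟩)

end IsFrame

/-! ### Normal forms by rescaling -/

section Roots

variable {k : Type*} [Field k] [CharZero k] [IsAlgClosed k] {A : Type*} [CommRing A]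
  [IsLocalRing A] [Algebra k A] {h s t : ℕ}

/-- Units have `N`-th roots, by Newton's method in an algebra with nilpotent maximal ideal. -/
theorem TypeData.exists_pow_eq (T : TypeData k A h s t) {N : ℕ} (hN : 0 < N) {b : A}
    (hb : IsUnit b) : ∃ u : A, IsUnit u ∧ u ^ N = b := by
  obtain ⟨c, hc⟩ := T.res b
  have hc0 : c ≠ 0 := by
    rintro rfl
    rw [map_zero, sub_zero] at hc
    exact hc hb
  obtain ⟨β, hβ⟩ := IsAlgClosed.exists_pow_nat_eq c hN
  have hβ0 : β ≠ 0 := by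
    rintro rfl
    rw [zero_pow hN.ne'] at hβ
    exact hc0 hβ.symm
  obtain ⟨u, ⟨-, hu⟩, -⟩ := existsUnique_nilpotent_sub_and_aeval_eq_zero
    (P := (X ^ N - C b : A[X])) (x := algebraMap k A β) (by
      rw [map_sub, map_pow, aeval_X, aeval_C, ← map_pow, hβ]
      refine T.isNilpotent_of_mem ?_
      rw [← neg_sub]
      exact Submodule.neg_mem _ hc) (by
      rw [derivative_sub, derivative_X_pow, derivative_C, sub_zero, map_mul, map_pow, aeval_X,
        aeval_C]
      refine IsUnit.mul ?_ (((IsUnit.mk0 β hβ0).map (algebraMap k A)).pow _)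
      have h1 : IsUnit ((N : k)) := IsUnit.mk0 _ (Nat.cast_ne_zero.mpr hN.ne')
      simpa using h1.map (algebraMap k A))
  rw [map_sub, map_pow, aeval_X, aeval_C, sub_eq_zero] at hu
  have hu' : u ^ N = b := hu
  refine ⟨u, ?_, hu'⟩
  rw [← hu', isUnit_pow_iff hN.ne'] at hb
  exact hb

/-- A unit congruent to `1` modulo an element `m` has a square root congruent to `1` modulo `m`:
one of the two roots `± σ` has `± σ + 1` invertible. -/
theorem TypeData.exists_sq_eq_one_add (T : TypeData k A h s t) {m v : A}
    (hb : IsUnit (1 + m * v)) : ∃ σ μ : A, IsUnit σ ∧ σ ^ 2 = 1 + m * v ∧ σ = 1 + m * μ := by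
  obtain ⟨σ, hσ, hσ2⟩ := T.exists_pow_eq (N := 2) (by omega) hb
  have key : ∀ τ : A, τ ^ 2 = 1 + m * v → IsUnit (τ + 1) → ∃ μ, τ = 1 + m * μ := by
    intro τ hτ hu
    obtain ⟨w, hw⟩ := hu.exists_right_inv
    refine ⟨v * w, ?_⟩
    linear_combination (1 - τ) * hw + w * hτ
  by_cases h1 : IsUnit (σ + 1)
  · obtain ⟨μ, hμ⟩ := key σ hσ2 h1
    exact ⟨σ, μ, hσ, hσ2, hμ⟩
  · have h2 : IsUnit (-σ + 1) := by
      by_contra h3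
      have h4 : (2 : A) ∈ maximalIdeal A := by
        have := Ideal.add_mem (maximalIdeal A) (a := σ + 1) (b := -σ + 1) h1 h3
        convert this using 1
        ring
      refine h4 ?_
      have := (IsUnit.mk0 (2 : k) two_ne_zero).map (algebraMap k A)
      rwa [map_ofNat] at this
    have h3 : (-σ) ^ 2 = 1 + m * v := by rw [neg_sq, hσ2]
    obtain ⟨μ, hμ⟩ := key (-σ) h3 h2
    exact ⟨-σ, μ, hσ.neg, h3, hμ⟩

end Roots

section Normalization

variable {k : Type*} [Field k] [CharZero k] [IsAlgClosed k] {A : Type*} [CommRing A]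
  [IsLocalRing A] [Algebra k A] {h s t : ℕ} {x y : A}

/-- Rescaling in the case where the weights of the two terms of
`y ^ 2 = a x ^ (p + 1) y + b x ^ n` differ. -/
theorem TypeData.exists_rescale_of_ne (T : TypeData k A h s t) {p n : ℕ} (hp : 2 * (p + 1) ≠ n)
    {a b : A} (ha : IsUnit a) (hb : IsUnit b)
    (hy : y ^ 2 = a * x ^ (p + 1) * y + b * x ^ n) :
    ∃ u w : A, IsUnit u ∧ IsUnit w ∧
      (w * y) ^ 2 = (u * x) ^ (p + 1) * (w * y) + (u * x) ^ n := by
  obtain ⟨a, rfl⟩ := ha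
  obtain ⟨b, rfl⟩ := hb
  have hu : ∃ u : Aˣ, (u : A) ^ (2 * (p + 1)) * b = u ^ n * a ^ 2 := by
    rcases Nat.lt_or_gt_of_ne hp with hlt | hlt
    · obtain ⟨u, hu, hu'⟩ := T.exists_pow_eq (N := n - 2 * (p + 1)) (by omega)
        (b * (a ^ 2)⁻¹ : Aˣ).isUnit
      obtain ⟨u, rfl⟩ := hu
      refine ⟨u, ?_⟩
      have e : (u : A) ^ n = u ^ (n - 2 * (p + 1)) * u ^ (2 * (p + 1)) := by
        rw [← pow_add]; congr 1; omega
      rw [e, hu']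
      have : ((b * (a ^ 2)⁻¹ : Aˣ) : A) * (a : A) ^ 2 = b := by
        rw [← Units.val_pow_eq_pow_val, ← Units.val_mul, inv_mul_cancel_right]
      linear_combination (-(u : A) ^ (2 * (p + 1))) * this
    · obtain ⟨u, hu, hu'⟩ := T.exists_pow_eq (N := 2 * (p + 1) - n) (by omega)
        (a ^ 2 * b⁻¹ : Aˣ).isUnit
      obtain ⟨u, rfl⟩ := hu
      refine ⟨u, ?_⟩
      have e : (u : A) ^ (2 * (p + 1)) = u ^ (2 * (p + 1) - n) * u ^ n := by
        rw [← pow_add]; congr 1; omega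
      rw [e, hu']
      have : ((a ^ 2 * b⁻¹ : Aˣ) : A) * (b : A) = a ^ 2 := by
        rw [← Units.val_mul, inv_mul_cancel_right, Units.val_pow_eq_pow_val]
      linear_combination ((u : A) ^ n) * this
  obtain ⟨u, hu⟩ := hu
  refine ⟨u, (u ^ (p + 1) * a⁻¹ : Aˣ), u.isUnit, Units.isUnit _, ?_⟩
  have hw : ((u ^ (p + 1) * a⁻¹ : Aˣ) : A) * a = u ^ (p + 1) := by
    rw [← Units.val_mul, inv_mul_cancel_right, Units.val_pow_eq_pow_val]
  set w : A := ((u ^ (p + 1) * a⁻¹ : Aˣ) : A) with hwdef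
  have hw2 : w ^ 2 * b = u ^ n := by
    have h1 : w ^ 2 * b * a ^ 2 = u ^ n * a ^ 2 := by
      rw [← hu]
      have : (u : A) ^ (2 * (p + 1)) = (u ^ (p + 1)) ^ 2 := by ring
      rw [this, ← hw]
      ring
    exact (a.isUnit.pow 2).mul_left_injective h1
  rw [mul_pow, hy, mul_pow, mul_pow, ← hw, ← hw2]
  ring

/-- Rescaling in the case `n = 2 (p + 1)` where both terms of
`y ^ 2 = a x ^ (p + 1) y + b x ^ n` have the same weight, for `b = a ^ 2 z` with `z` congruent to a
constant modulo `x ^ q`. -/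
theorem TypeData.exists_rescale_of_eq_const (T : TypeData k A h s t) {p n q : ℕ} {a b v : A}
    {c : k} (hc : c ≠ 0) (ha : IsUnit a) (hz : IsUnit (algebraMap k A c + x ^ q * v))
    (hb : b = a ^ 2 * (algebraMap k A c + x ^ q * v)) (hq : x ^ (q + (p + 1)) * y = 0)
    (hy : y ^ 2 = a * x ^ (p + 1) * y + b * x ^ n) :
    ∃ w : A, IsUnit w ∧
      (w * y) ^ 2 = x ^ (p + 1) * (w * y) + algebraMap k A c * x ^ n := by
  obtain ⟨z, hz'⟩ := hz
  have hzi : ((z⁻¹ : Aˣ) : A) * z = 1 := Units.inv_mul z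
  have e1 : algebraMap k A c * (z⁻¹ : Aˣ) = 1 + x ^ q * (-(v * (z⁻¹ : Aˣ))) := by
    rw [hz'] at hzi
    linear_combination hzi
  have hcu : IsUnit (algebraMap k A c * (z⁻¹ : Aˣ)) :=
    ((IsUnit.mk0 c hc).map (algebraMap k A)).mul (Units.isUnit _)
  -- `y` is multiplied by `σ / a` with `σ ^ 2 = c / z`. As `σ` is congruent to `1` modulo `x ^ q`,
  -- the term in `x ^ (p + 1) y` only changes by a multiple of `x ^ t y = 0`.
  obtain ⟨σ, μ, hσ, hσ2, hσμ⟩ := T.exists_sq_eq_one_add (e1 ▸ hcu)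
  obtain ⟨a, rfl⟩ := ha
  have hai : ((a⁻¹ : Aˣ) : A) * a = 1 := Units.inv_mul a
  refine ⟨σ * (a⁻¹ : Aˣ), hσ.mul (Units.isUnit _), ?_⟩
  have hb2 : (σ * (a⁻¹ : Aˣ)) ^ 2 * b = algebraMap k A c := by
    rw [mul_pow, hσ2, ← e1, hb, ← hz']
    linear_combination (algebraMap k A c * ((a⁻¹ : Aˣ) : A) ^ 2 * (a : A) ^ 2) * hzi +
      (algebraMap k A c) * (((a⁻¹ : Aˣ) : A) * a + 1) * hai
  have hw : (σ * (a⁻¹ : Aˣ)) * a = 1 + x ^ q * μ := by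
    rw [← hσμ]
    linear_combination σ * hai
  set w : A := σ * (a⁻¹ : Aˣ)
  have hq' : x ^ q * x ^ (p + 1) * y = 0 := by rw [← pow_add, hq]
  linear_combination w ^ 2 * hy + x ^ n * hb2 + w * x ^ (p + 1) * y * hw + w * μ * hq'

/-- Rescaling in the case `n = 2 (p + 1)`, for `b = a ^ 2 (c + x ^ d e)` with a unit `e`. -/
theorem TypeData.exists_rescale_of_eq_pow (T : TypeData k A h s t) {p n d : ℕ} (hd : 0 < d)
    {a b e : A} {c : k} (hn : n = 2 * (p + 1)) (ha : IsUnit a) (he : IsUnit e)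
    (hb : b = a ^ 2 * (algebraMap k A c + x ^ d * e))
    (hy : y ^ 2 = a * x ^ (p + 1) * y + b * x ^ n) :
    ∃ u w : A, IsUnit u ∧ IsUnit w ∧ (w * y) ^ 2 = (u * x) ^ (p + 1) * (w * y) +
      (algebraMap k A c + (u * x) ^ d) * (u * x) ^ n := by
  obtain ⟨u, hu, rfl⟩ := T.exists_pow_eq hd he
  obtain ⟨a, rfl⟩ := ha
  refine ⟨u, u ^ (p + 1) * (a⁻¹ : Aˣ), hu, (hu.pow _).mul (Units.isUnit _), ?_⟩
  have hw : (u ^ (p + 1) * (a⁻¹ : Aˣ)) * a = u ^ (p + 1) := by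
    rw [mul_assoc, Units.inv_mul, mul_one]
  set w : A := u ^ (p + 1) * (a⁻¹ : Aˣ)
  subst hn
  have e1 : (u * x) ^ (2 * (p + 1)) = (w * a) ^ 2 * x ^ (2 * (p + 1)) := by rw [hw]; ring
  rw [e1, mul_pow, hy, hb, mul_pow u x (p + 1), ← hw]
  ring

/-- The normal forms of the relation between the rescaled elements of a frame. -/
theorem IsFrame.exists_normal_form (Fr : IsFrame k s t x y) (T : TypeData k A h s t) (ht : 2 ≤ t)
    (hst : 2 * t ≤ s) :
    ∃ (p : ℕ) (Z : k[X]) (u w : A), IsUnit u ∧ IsUnit w ∧ p < t ∧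
      (w * y) ^ 2 = (u * x) ^ (p + 1) * (w * y) + aeval (u * x) Z * (u * x) ^ (s - t + 1) ∧
      ((Z = 1 ∧ ¬ (p + 2 ≤ t ∧ 2 * (p + 1) = s - t + 1)) ∨
        (p + 2 ≤ t ∧ 2 * (p + 1) = s - t + 1 ∧ ∃ c : k, c ≠ 0 ∧
          (Z = C c ∨ ∃ d : ℕ, 1 ≤ d ∧ d + p + 2 ≤ t ∧ Z = C c + X ^ d))) := by
  obtain ⟨g, b, hb, hy⟩ := Fr.exists_y_sq T ht hst
  have hbu : IsUnit (aeval x b) := isUnit_aeval Fr.x_mem hb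
  -- If `x ^ (t - 1)` divides `g`, the term in `y` vanishes because of `x ^ t y = 0`. The same holds
  -- for `x ^ t y` itself, which gives the normal form with `p = t - 1`.
  by_cases hg : X ^ (t - 1) ∣ g
  · obtain ⟨g, rfl⟩ := hg
    obtain ⟨b', hb'⟩ := hbu
    obtain ⟨w, hw, hw2⟩ := T.exists_pow_eq (N := 2) (by omega) (b'⁻¹).isUnit
    refine ⟨t - 1, 1, 1, w, isUnit_one, hw, by omega, ?_, Or.inl ⟨rfl, by omega⟩⟩
    have e1 : t - 1 + 1 = t := by omega
    have e2 : x * x ^ (t - 1) = x ^ t := by rw [← pow_succ']; congr 1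
    have hbi : ((b'⁻¹ : Aˣ) : A) * aeval x b = 1 := by rw [← hb']; exact Units.inv_mul b'
    simp only [map_mul, map_pow, aeval_X] at hy
    rw [one_mul, map_one, e1]
    linear_combination w ^ 2 * hy + w ^ 2 * aeval x g * y * e2 +
      (w ^ 2 * aeval x g - w) * Fr.x_pow_mul_y + x ^ (s - t + 1) * aeval x b * hw2 +
      x ^ (s - t + 1) * hbi
  · have hg0 : g ≠ 0 := by
      rintro rfl
      exact hg (dvd_zero _)
    obtain ⟨p, a, rfl, ha⟩ := exists_eq_X_pow_mul hg0
    have hp : p + 2 ≤ t := by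
      by_contra hp
      exact hg (Dvd.dvd.mul_right (pow_dvd_pow _ (by omega)) _)
    have hau : IsUnit (aeval x a) := isUnit_aeval Fr.x_mem ha
    have hy' : y ^ 2 = aeval x a * x ^ (p + 1) * y + aeval x b * x ^ (s - t + 1) := by
      rw [hy]
      simp only [map_mul, map_pow, aeval_X]
      ring
    by_cases hn : 2 * (p + 1) = s - t + 1
    · -- The ratio `b / a ^ 2`, as a polynomial in `x`.
      obtain ⟨z, hz⟩ : ∃ z : k[X], aeval x b = aeval x a ^ 2 * aeval x z := by
        have hcop : IsCoprime (a ^ 2) (X ^ (s + 1)) := by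
          refine IsCoprime.pow ?_
          rw [isCoprime_comm]
          refine (Irreducible.coprime_iff_not_dvd irreducible_X).mpr ?_
          rwa [X_dvd_iff]
        obtain ⟨i, j, hij⟩ := hcop
        refine ⟨i * b, ?_⟩
        have h1 := congrArg (aeval x) hij
        have h2 : x ^ (s + 1) = 0 := T.pow_eq_zero Fr.x_mem (Nat.lt_succ_self s)
        simp only [map_add, map_mul, map_pow, aeval_X, map_one] at h1 ⊢
        linear_combination (-aeval x b) * h1 + aeval x b * aeval x j * h2
      have hzu : IsUnit (aeval x z) := by
        rw [hz] at hbu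
        exact isUnit_of_mul_isUnit_right hbu
      have hz0 : z.coeff 0 ≠ 0 := by
        intro h0
        rw [aeval_eq_add_divX, h0, map_zero, zero_add] at hzu
        exact Fr.x_mem (isUnit_of_mul_isUnit_left hzu)
      have hconst : ∀ v : k[X], z - C (z.coeff 0) = X ^ (t - p - 1) * v →
          ∃ w : A, IsUnit w ∧ (w * y) ^ 2 = x ^ (p + 1) * (w * y) +
            algebraMap k A (z.coeff 0) * x ^ (s - t + 1) := by
        intro v hv
        have hzv : aeval x z = algebraMap k A (z.coeff 0) + x ^ (t - p - 1) * aeval x v := by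
          have := congrArg (aeval x) hv
          simp only [map_sub, map_mul, map_pow, aeval_X, aeval_C] at this
          linear_combination this
        refine T.exists_rescale_of_eq_const (q := t - p - 1) hz0 hau (hzv ▸ hzu)
          (by rw [hz, hzv]) ?_ hy'
        rw [show t - p - 1 + (p + 1) = t by omega]
        exact Fr.x_pow_mul_y
      by_cases hdvd : X ^ (t - p - 1) ∣ z - C (z.coeff 0)
      · obtain ⟨v, hv⟩ := hdvd
        obtain ⟨w, hw, hwy⟩ := hconst v hv
        refine ⟨p, C (z.coeff 0), 1, w, isUnit_one, hw, by omega, ?_,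
          Or.inr ⟨hp, hn, z.coeff 0, hz0, Or.inl rfl⟩⟩
        rw [one_mul, aeval_C, hwy]
      · have hz1 : z - C (z.coeff 0) ≠ 0 := by
          intro h0
          rw [h0] at hdvd
          exact hdvd (dvd_zero _)
        obtain ⟨d, e, hde, he⟩ := exists_eq_X_pow_mul hz1
        have hd : d + p + 2 ≤ t := by
          by_contra hd
          rw [hde] at hdvd
          exact hdvd (Dvd.dvd.mul_right (pow_dvd_pow _ (by omega)) _)
        have hd0 : 1 ≤ d := by
          by_contra hd0
          have h1 := congrArg (fun F => coeff F 0) hde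
          simp only [show d = 0 by omega, pow_zero, one_mul, coeff_sub, coeff_C_zero,
            sub_self] at h1
          exact he h1.symm
        have hze : aeval x z = algebraMap k A (z.coeff 0) + x ^ d * aeval x e := by
          have := congrArg (aeval x) hde
          simp only [map_sub, map_mul, map_pow, aeval_X, aeval_C] at this
          linear_combination this
        obtain ⟨u, w, hu, hw, hwy⟩ := T.exists_rescale_of_eq_pow hd0 hn.symm hau
          (isUnit_aeval Fr.x_mem he) (by rw [hz, hze]) hy'
        refine ⟨p, C (z.coeff 0) + X ^ d, u, w, hu, hw, by omega, ?_,
          Or.inr ⟨hp, hn, z.coeff 0, hz0, Or.inr ⟨d, hd0, hd, rfl⟩⟩⟩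
        rw [hwy, map_add, map_pow, aeval_X, aeval_C]
    · obtain ⟨u, w, hu, hw, hwy⟩ := T.exists_rescale_of_ne hn hau hbu hy'
      exact ⟨p, 1, u, w, hu, hw, by omega, by rw [hwy, map_one, one_mul],
        Or.inl ⟨rfl, fun h => hn h.2⟩⟩

end Normalization

/-! ### Relations of the model algebras and existence -/

section Relations

variable {k : Type*} [Field k] {h : ℕ}

theorem fin_cases_of_add_two {d : ℕ} (hd : d + 2 = h) (i : Fin h) :
    i = ⟨0, by omega⟩ ∨ i = ⟨1, by omega⟩ ∨ ∃ j : Fin d, i = ⟨j + 2, by omega⟩ := by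
  obtain ⟨i, hi⟩ := i
  by_cases h0 : i = 0
  · exact Or.inl (Fin.ext h0)
  by_cases h1 : i = 1
  · exact Or.inr (Or.inl (Fin.ext h1))
  · exact Or.inr (Or.inr ⟨⟨i - 2, by omega⟩, Fin.ext (by simp; omega)⟩)

/-- The images of the variables `x_3, …, x_h`. -/
noncomputable def tailVar {A : Type*} [CommRing A] [Algebra k A] {d : ℕ} (hd : d + 2 = h)
    (f : MvPowerSeries (Fin h) k →ₐ[k] A) (j : Fin d) : A :=
  f (MvPowerSeries.X ⟨j + 2, by omega⟩)

variable {A : Type*} [CommRing A] [Algebra k A] {hh : 2 ≤ h} {s t p d : ℕ}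
  {f : MvPowerSeries (Fin h) k →ₐ[k] A}

/-- The relations that define the quotient by a model ideal, in terms of the images of the
variables under an algebra homomorphism `f`. -/
structure ModelRel (hh : 2 ≤ h) (hd : d + 2 = h) (s t p : ℕ) (ζ : A)
    (f : MvPowerSeries (Fin h) k →ₐ[k] A) : Prop where
  x_tail : ∀ j, f (x₁ hh) * tailVar hd f j = 0
  y_tail : ∀ j, f (x₂ hh) * tailVar hd f j = 0
  tail_tail : ∀ i j, i ≠ j → tailVar hd f i * tailVar hd f j = 0
  tail_sq : ∀ j, tailVar hd f j ^ 2 = f (x₁ hh) ^ s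
  y_sq : f (x₂ hh) ^ 2 = f (x₁ hh) ^ (p + 1) * f (x₂ hh) + ζ * f (x₁ hh) ^ (s - t + 1)
  x_pow_y : f (x₁ hh) ^ t * f (x₂ hh) = 0

theorem modelIdeal_le_ker_iff (hd : d + 2 = h) {z : MvPowerSeries (Fin h) k} :
    modelIdeal hh s t p z ≤ RingHom.ker f ↔ ModelRel hh hd s t p (f z) f := by
  rw [modelIdeal, Ideal.span_le]
  constructor
  · intro hle
    have hmul : ∀ i j : Fin h, i < j → ¬ (i.val = 0 ∧ j.val = 1) →
        f (MvPowerSeries.X i) * f (MvPowerSeries.X j) = 0 := by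
      intro i j hij hij'
      rw [← map_mul]
      exact hle (Or.inl (Or.inl ⟨i, j, hij, hij', rfl⟩))
    refine ⟨fun j => ?_, fun j => ?_, fun i j hij => ?_, fun j => ?_, ?_, ?_⟩
    · exact hmul _ _ (Fin.mk_lt_mk.mpr (by omega)) (by rintro ⟨h0, h1⟩; simp at h0 h1)
    · exact hmul _ _ (Fin.mk_lt_mk.mpr (by omega)) (by rintro ⟨h0, h1⟩; simp at h0 h1)
    · rcases lt_or_gt_of_ne hij with hlt | hlt
      · exact hmul _ _ (Fin.mk_lt_mk.mpr (by have := Fin.lt_def.mp hlt; omega))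
          (by rintro ⟨h0, h1⟩; simp at h0)
      · rw [mul_comm]
        exact hmul _ _ (Fin.mk_lt_mk.mpr (by have := Fin.lt_def.mp hlt; omega))
          (by rintro ⟨h0, h1⟩; simp at h0)
    · have h1 : f (MvPowerSeries.X ⟨j + 2, by omega⟩ ^ 2 - x₁ hh ^ s) = 0 :=
        hle (Or.inl (Or.inr ⟨_, by simp, rfl⟩))
      rw [map_sub, map_pow, map_pow, sub_eq_zero] at h1
      exact h1
    · have h1 : f (x₂ hh ^ 2 - x₁ hh ^ (p + 1) * x₂ hh - z * x₁ hh ^ (s - t + 1)) = 0 :=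
        hle (Or.inr (Or.inl rfl))
      simp only [map_sub, map_mul, map_pow] at h1
      linear_combination h1
    · have h1 : f (x₁ hh ^ t * x₂ hh) = 0 := hle (Or.inr (Or.inr rfl))
      rwa [map_mul, map_pow] at h1
  · intro hR
    rintro g ((⟨i, j, hij, hij', rfl⟩ | ⟨j, hj, rfl⟩) | rfl | rfl) <;>
      rw [SetLike.mem_coe, RingHom.mem_ker]
    · rw [map_mul]
      rcases fin_cases_of_add_two hd i with rfl | rfl | ⟨i, rfl⟩ <;>
        rcases fin_cases_of_add_two hd j with rfl | rfl | ⟨j, rfl⟩ <;>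
        simp only [Fin.lt_def] at hij hij'
      · omega
      · simp at hij'
      · exact hR.x_tail j
      · omega
      · omega
      · exact hR.y_tail j
      · omega
      · omega
      · exact hR.tail_tail i j (by rintro rfl; omega)
    · rcases fin_cases_of_add_two hd j with rfl | rfl | ⟨j, rfl⟩
      · simp at hj
      · simp at hj
      · rw [map_sub, map_pow, map_pow, sub_eq_zero]
        exact hR.tail_sq j
    · simp only [map_sub, map_mul, map_pow]
      linear_combination hR.y_sq
    · rw [map_mul, map_pow, hR.x_pow_y]

theorem isUnit_aeval_x₁ {Z : k[X]} (hZ : Z.coeff 0 ≠ 0) :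
    IsUnit (aeval (x₁ hh : MvPowerSeries (Fin h) k) Z) := by
  rw [MvPowerSeries.isUnit_iff_constantCoeff, aeval_eq_add_divX]
  simp [x₁, MvPowerSeries.algebraMap_apply, hZ]

namespace ModelRel

theorem x_pow_eq_zero {hd : d + 2 = h} {ζ : A} (hR : ModelRel hh hd s t p ζ f) (hζ : IsUnit ζ)
    (hts : t ≤ s) : f (x₁ hh) ^ (s + 1) = 0 := by
  rw [← hζ.mul_right_eq_zero]
  have e : f (x₁ hh) ^ (s + 1) = f (x₁ hh) ^ t * f (x₁ hh) ^ (s - t + 1) := by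
    rw [← pow_add]; congr 1; omega
  rw [e]
  linear_combination (f (x₂ hh) - f (x₁ hh) ^ (p + 1)) * hR.x_pow_y - f (x₁ hh) ^ t * hR.y_sq

theorem isNilpotent {hd : d + 2 = h} {ζ : A} (hR : ModelRel hh hd s t p ζ f) (hζ : IsUnit ζ)
    (hs : 0 < s) (hts : t ≤ s) (i : Fin h) : IsNilpotent (f (MvPowerSeries.X i)) := by
  have hx : IsNilpotent (f (x₁ hh)) := ⟨_, hR.x_pow_eq_zero hζ hts⟩
  rcases fin_cases_of_add_two hd i with rfl | rfl | ⟨j, rfl⟩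
  · exact hx
  · have h1 : IsNilpotent (f (x₂ hh) ^ 2) := by
      have e : f (x₂ hh) ^ 2 =
          f (x₁ hh) * (f (x₁ hh) ^ p * f (x₂ hh) + ζ * f (x₁ hh) ^ (s - t)) := by
        rw [hR.y_sq]; ring
      rw [e]
      exact (Commute.all _ _).isNilpotent_mul_right hx
    obtain ⟨m, hm⟩ := h1
    exact ⟨2 * m, by rw [pow_mul]; exact hm⟩
  · refine ⟨2 * (s + 1), ?_⟩
    rw [pow_mul]
    change (tailVar hd f j ^ 2) ^ (s + 1) = 0
    rw [hR.tail_sq, ← pow_mul, mul_comm, pow_mul, hR.x_pow_eq_zero hζ hts, zero_pow hs.ne']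

theorem span_le_annihilatorPair {hd : d + 2 = h} {ζ : A} (hR : ModelRel hh hd s t p ζ f) :
    Submodule.span k (Set.range (tailVar hd f)) ≤
      IsFrame.annihilatorPair k (f (x₁ hh)) (f (x₂ hh)) := by
  rw [Submodule.span_le]
  rintro _ ⟨j, rfl⟩
  exact ⟨hR.x_tail j, hR.y_tail j⟩

/-- Every element of a quotient of a model algebra has the form
`F(x_1) + G(x_1) x_2 + c_3 x_3 + … + c_h x_h`. -/
theorem exists_eq {hd : d + 2 = h} {Z : k[X]} (hZ : Z.coeff 0 ≠ 0)
    (hR : ModelRel hh hd s t p (aeval (f (x₁ hh)) Z) f) (hs : 0 < s) (hts : t ≤ s)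
    (hf : Function.Surjective f) (a : A) :
    ∃ (F G : k[X]) (v : Submodule.span k (Set.range (tailVar hd f))),
      a = aeval (f (x₁ hh)) F + aeval (f (x₁ hh)) G * f (x₂ hh) + v := by
  have hζ : IsUnit (aeval (f (x₁ hh)) Z) := by
    rw [aeval_algHom_apply]
    exact (isUnit_aeval_x₁ hZ).map f
  set x := f (x₁ hh) with hx
  set y := f (x₂ hh) with hy
  set V := Submodule.span k (Set.range (tailVar hd f)) with hV
  let M : Submodule k A :=
    { carrier := {a | ∃ (F G : k[X]) (v : V), a = aeval x F + aeval x G * y + v}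
      add_mem' := by
        rintro _ _ ⟨F, G, v, rfl⟩ ⟨F', G', v', rfl⟩
        refine ⟨F + F', G + G', v + v', ?_⟩
        simp only [map_add, Submodule.coe_add]
        ring
      zero_mem' := ⟨0, 0, 0, by simp⟩
      smul_mem' := by
        rintro c _ ⟨F, G, v, rfl⟩
        refine ⟨c • F, c • G, c • v, ?_⟩
        simp only [map_smul, smul_add, smul_mul_assoc, Submodule.coe_smul] }
  have hMpoly : ∀ F G : k[X], aeval x F + aeval x G * y ∈ M := fun F G => ⟨F, G, 0, by simp⟩
  have hMV : ∀ v ∈ V, v ∈ M := fun v hv => ⟨0, 0, ⟨v, hv⟩, by simp⟩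
  have hVzero : ∀ b : A, (∀ j, b * tailVar hd f j = 0) → ∀ v ∈ V, b * v = 0 := by
    intro b hb v hv
    induction hv using Submodule.span_induction with
    | mem v hv => obtain ⟨j, rfl⟩ := hv; exact hb j
    | zero => exact mul_zero _
    | add v w _ _ hv hw => rw [mul_add, hv, hw, add_zero]
    | smul c v _ hv => rw [mul_smul_comm, hv, smul_zero]
  have htop : M = ⊤ := by
    refine submodule_eq_top_of_mul_mem f hf (hR.isNilpotent hζ hs hts) M ⟨1, 0, 0, by simp⟩ ?_
    intro i a ha
    obtain ⟨F, G, ⟨v, hv⟩, rfl⟩ := ha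
    rcases fin_cases_of_add_two hd i with rfl | rfl | ⟨j, rfl⟩
    · change x * _ ∈ M
      have h1 := hVzero x hR.x_tail v hv
      have e : x * (aeval x F + aeval x G * y + v) =
          aeval x (X * F) + aeval x (X * G) * y := by
        simp only [map_mul, aeval_X]
        linear_combination h1
      rw [e]
      exact hMpoly _ _
    · change y * _ ∈ M
      have h1 := hVzero y hR.y_tail v hv
      have e : y * (aeval x F + aeval x G * y + v) =
          aeval x (G * Z * X ^ (s - t + 1)) + aeval x (F + G * X ^ (p + 1)) * y := by
        simp only [map_mul, map_add, map_pow, aeval_X]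
        linear_combination h1 + aeval x G * hR.y_sq
      rw [e]
      exact hMpoly _ _
    · change tailVar hd f j * _ ∈ M
      have h1 : tailVar hd f j * v ∈ M := by
        induction hv using Submodule.span_induction with
        | mem v hv =>
          obtain ⟨i, rfl⟩ := hv
          by_cases hij : j = i
          · subst hij
            rw [← pow_two, hR.tail_sq]
            have := hMpoly (X ^ s) 0
            simpa using this
          · rw [hR.tail_tail _ _ hij]
            exact M.zero_mem
        | zero => rw [mul_zero]; exact M.zero_mem
        | add v w _ _ hv hw => rw [mul_add]; exact M.add_mem hv hw
        | smul c v _ hv => rw [mul_smul_comm]; exact M.smul_mem _ hv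
      have e : tailVar hd f j * (aeval x F + aeval x G * y + v) =
          F.coeff 0 • tailVar hd f j + tailVar hd f j * v := by
        rw [aeval_eq_add_divX x F, Algebra.smul_def]
        linear_combination aeval x F.divX * hR.x_tail j + aeval x G * hR.y_tail j
      rw [e]
      exact M.add_mem (M.smul_mem _ (hMV _ (Submodule.subset_span ⟨j, rfl⟩))) h1
  have : a ∈ M := by rw [htop]; trivial
  exact this

/-- A model algebra is spanned by `x_1 ^ i` with `i ≤ s`, `x_1 ^ i x_2` with `i < t` and
`x_3, …, x_h`. -/
theorem finrank_le {hd : d + 2 = h} {Z : k[X]} (hZ : Z.coeff 0 ≠ 0)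
    (hR : ModelRel hh hd s t p (aeval (f (x₁ hh)) Z) f) (hs : 0 < s) (hts : t ≤ s)
    (hf : Function.Surjective f) : Module.Finite k A ∧ Module.finrank k A + 1 ≤ s + t + h := by
  have hζ : IsUnit (aeval (f (x₁ hh)) Z) := by
    rw [aeval_algHom_apply]
    exact (isUnit_aeval_x₁ hZ).map f
  have hVfin : Module.Finite k (Submodule.span k (Set.range (tailVar hd f))) :=
    Module.Finite.span_of_finite k (Set.finite_range _)
  have hsurj : Function.Surjective (combMap (s + 1) t (f (x₁ hh)) (f (x₂ hh))
      (Submodule.span k (Set.range (tailVar hd f)))) := by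
    intro a
    obtain ⟨F, G, v, rfl⟩ := hR.exists_eq hZ hs hts hf a
    refine ⟨((⟨F %ₘ X ^ (s + 1), modByMonic_X_pow_mem_degreeLT _ _⟩,
      ⟨G %ₘ X ^ t, modByMonic_X_pow_mem_degreeLT _ _⟩), v), ?_⟩
    rw [combMap_apply]
    have h1 : aeval (f (x₁ hh)) (F %ₘ X ^ (s + 1)) * 1 = aeval (f (x₁ hh)) F * 1 :=
      aeval_modByMonic_X_pow (by rw [mul_one]; exact hR.x_pow_eq_zero hζ hts) F
    rw [mul_one, mul_one] at h1
    simp only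
    rw [h1, aeval_modByMonic_X_pow hR.x_pow_y]
  refine ⟨Module.Finite.of_surjective _ hsurj, ?_⟩
  have h1 := LinearMap.finrank_le_finrank_of_surjective hsurj
  rw [Module.finrank_prod, Module.finrank_prod, finrank_degreeLT, finrank_degreeLT] at h1
  have h2 := finrank_range_le_card (R := k) (tailVar hd f)
  rw [Fintype.card_fin] at h2
  change Module.finrank k (Submodule.span k (Set.range (tailVar hd f))) ≤ d at h2
  omega

end ModelRel

end Relations

section Existence

variable {k : Type*} [Field k] {h s t p : ℕ}

/-- A surjection from the quotient by a model ideal to an algebra of type `(s, t)` is an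
isomorphism, as the quotient is not larger than the algebra. -/
theorem nonempty_algEquiv_of_modelIdeal_le_ker {hh : 2 ≤ h} {A : Type*} [CommRing A]
    [IsLocalRing A] [Algebra k A] (T : TypeData k A h s t) (hs : 0 < s) (hts : t ≤ s) {Z : k[X]}
    (hZ : Z.coeff 0 ≠ 0) {f : MvPowerSeries (Fin h) k →ₐ[k] A} (hf : Function.Surjective f)
    (hle : modelIdeal hh s t p (aeval (x₁ hh) Z) ≤ RingHom.ker f) :
    Nonempty (A ≃ₐ[k]
      MvPowerSeries (Fin h) k ⧸
        modelIdeal hh s t p (aeval (x₁ hh : MvPowerSeries (Fin h) k) Z)) := by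
  obtain ⟨d, hd⟩ : ∃ d, d + 2 = h := ⟨h - 2, by omega⟩
  set J := modelIdeal hh s t p (aeval (x₁ hh : MvPowerSeries (Fin h) k) Z) with hJ
  have hR : ModelRel hh hd s t p (Ideal.Quotient.mkₐ k J (aeval (x₁ hh) Z))
      (Ideal.Quotient.mkₐ k J) := by
    rw [← modelIdeal_le_ker_iff]
    exact fun g hg => Ideal.Quotient.eq_zero_iff_mem.mpr hg
  rw [← aeval_algHom_apply] at hR
  obtain ⟨hfin, hrank⟩ := hR.finrank_le hZ hs hts (Ideal.Quotient.mkₐ_surjective k J)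
  set g : (MvPowerSeries (Fin h) k ⧸ J) →ₐ[k] A := Ideal.Quotient.liftₐ J f hle with hg
  have hgs : Function.Surjective g := by
    intro a
    obtain ⟨r, rfl⟩ := hf a
    exact ⟨Ideal.Quotient.mk J r, rfl⟩
  have hfinA := T.finite
  have h1 : Module.finrank k (MvPowerSeries (Fin h) k ⧸ J) = Module.finrank k A := by
    have h2 := LinearMap.finrank_le_finrank_of_surjective (f := g.toLinearMap) hgs
    have h3 := T.finrank_add_one
    omega
  have hgi : Function.Injective g :=
    (LinearMap.injective_iff_surjective_of_finrank_eq_finrank (f := g.toLinearMap) h1).mpr hgs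
  exact ⟨(AlgEquiv.ofBijective g ⟨hgi, hgs⟩).symm⟩

/-- Every almost stretched Gorenstein algebra of type `(s, t)` is a model algebra. -/
theorem exists_algEquiv_model [CharZero k] [IsAlgClosed k] (hh : 2 ≤ h) (ht : 2 ≤ t)
    (hst : 2 * t ≤ s) {A : Type*} [CommRing A] [IsLocalRing A] [Algebra k A]
    (T : TypeData k A h s t) :
    ∃ (p : ℕ) (Z : k[X]), p < t ∧
      ((Z = 1 ∧ ¬ (p + 2 ≤ t ∧ 2 * (p + 1) = s - t + 1)) ∨
        (p + 2 ≤ t ∧ 2 * (p + 1) = s - t + 1 ∧ ∃ c : k, c ≠ 0 ∧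
          (Z = C c ∨ ∃ d : ℕ, 1 ≤ d ∧ d + p + 2 ≤ t ∧ Z = C c + X ^ d))) ∧
      Nonempty (A ≃ₐ[k]
        MvPowerSeries (Fin h) k ⧸
        modelIdeal hh s t p (aeval (x₁ hh : MvPowerSeries (Fin h) k) Z)) := by
  obtain ⟨x, y, Fr⟩ := T.exists_isFrame ht (by omega)
  obtain ⟨p, Z, u, w, hu, hw, hp, hy, hZ⟩ := Fr.exists_normal_form T ht hst
  refine ⟨p, Z, hp, hZ, ?_⟩
  have hZ0 : Z.coeff 0 ≠ 0 := by
    rcases hZ with ⟨rfl, -⟩ | ⟨-, -, c, hc, rfl | ⟨d, hd, -, rfl⟩⟩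
    · simp
    · simpa using hc
    · have : coeff (X ^ d : k[X]) 0 = 0 := by
        rw [coeff_X_pow, if_neg (by omega)]
      simpa [this] using hc
  obtain ⟨d, e, hd, hxe, hye, hee, hesq, hspan⟩ := Fr.exists_orthonormal T ht hst
  -- The last variables are rescaled by a square root of the constant relating `(u x) ^ s` to
  -- `x ^ s`.
  obtain ⟨ε, hε, hε2⟩ := T.exists_pow_eq (N := 2) (by omega) (hu.pow s)
  have he : ∀ i, e i ∈ maximalIdeal A := fun i => Fr.mem_maximalIdeal_of_x_mul_eq_zero (hxe i)
  set a : Fin h → A := fun i =>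
    if i.val = 0 then u * x else if i.val = 1 then w * y else
      if hi : i.val - 2 < d then ε * e ⟨i.val - 2, hi⟩ else 0 with ha
  have ha0 : a ⟨0, by omega⟩ = u * x := by simp [ha]
  have ha1 : a ⟨1, by omega⟩ = w * y := by simp [ha]
  have ha2 : ∀ j : Fin d, a ⟨j + 2, by omega⟩ = ε * e j := by
    intro j
    simp [ha]
  have hmem : ∀ i, a i ∈ maximalIdeal A := by
    intro i
    rcases fin_cases_of_add_two hd i with rfl | rfl | ⟨j, rfl⟩
    · rw [ha0]; exact Ideal.mul_mem_left _ _ Fr.x_mem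
    · rw [ha1]; exact Ideal.mul_mem_left _ _ Fr.y_mem
    · rw [ha2]; exact Ideal.mul_mem_left _ _ (he j)
  obtain ⟨f, hf⟩ := exists_algHom_of_isNilpotent (k := k) a fun i => T.isNilpotent_of_mem (hmem i)
  have hf0 : f (x₁ hh) = u * x := by rw [← ha0]; exact hf _
  have hf1 : f (x₂ hh) = w * y := by rw [← ha1]; exact hf _
  have hf2 : ∀ j, tailVar hd f j = ε * e j := by intro j; rw [← ha2]; exact hf _
  have hsurj : Function.Surjective f := by
    refine surjective_of_maximalIdeal_le_span T.res T.isNilpotent_maximalIdeal f ?_ ?_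
    · refine hspan.trans (sup_le ?_ ?_)
      · rw [Ideal.span_le]
        rintro b (rfl | rfl)
        · rw [SetLike.mem_coe, ← Ideal.unit_mul_mem_iff_mem _ hu, ← hf0]
          exact Ideal.subset_span ⟨_, rfl⟩
        · rw [SetLike.mem_coe, ← Ideal.unit_mul_mem_iff_mem _ hw, ← hf1]
          exact Ideal.subset_span ⟨_, rfl⟩
      · rw [Ideal.span_le]
        rintro _ ⟨j, rfl⟩
        rw [SetLike.mem_coe, ← Ideal.unit_mul_mem_iff_mem _ hε, ← hf2]
        exact Ideal.subset_span ⟨_, rfl⟩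
    · intro i
      rw [hf]
      exact hmem i
  refine nonempty_algEquiv_of_modelIdeal_le_ker T (by omega) (by omega) hZ0 hsurj ?_
  rw [modelIdeal_le_ker_iff hd, ← aeval_algHom_apply]
  refine ⟨fun j => ?_, fun j => ?_, fun i j hij => ?_, fun j => ?_, ?_, ?_⟩
  · rw [hf0, hf2]; linear_combination u * ε * hxe j
  · rw [hf1, hf2]; linear_combination w * ε * hye j
  · rw [hf2, hf2]; linear_combination ε * ε * hee i j hij
  · rw [hf0, hf2, mul_pow, mul_pow, hesq, hε2]
  · rw [hf0, hf1]; exact hy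
  · rw [hf0, hf1]; linear_combination u ^ t * w * Fr.x_pow_mul_y

end Existence

/-! ### Invariance of the exponent -/

section Frame

variable {k : Type*} [Field k] {h s t p d : ℕ} {hh : 2 ≤ h} {A : Type*} [CommRing A]
  [IsLocalRing A] [Algebra k A] {f : MvPowerSeries (Fin h) k →ₐ[k] A}

namespace ModelRel

theorem apply_X_mem {hd : d + 2 = h} {Z : k[X]} (hZ : Z.coeff 0 ≠ 0)
    (hR : ModelRel hh hd s t p (aeval (f (x₁ hh)) Z) f) (hs : 0 < s) (hts : t ≤ s) (i : Fin h) :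
    f (MvPowerSeries.X i) ∈ maximalIdeal A := by
  have hζ : IsUnit (aeval (f (x₁ hh)) Z) := by
    rw [aeval_algHom_apply]
    exact (isUnit_aeval_x₁ hZ).map f
  intro hu
  obtain ⟨n, hn⟩ := hR.isNilpotent hζ hs hts i
  have := hu.pow n
  rw [hn] at this
  exact not_isUnit_zero this

theorem exists_eq_of_mem {hd : d + 2 = h} {Z : k[X]} (hZ : Z.coeff 0 ≠ 0)
    (hR : ModelRel hh hd s t p (aeval (f (x₁ hh)) Z) f) (hs : 0 < s) (hts : t ≤ s)
    (hf : Function.Surjective f) {a : A} (ha : a ∈ maximalIdeal A) :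
    ∃ (F G : k[X]) (v : A), v ∈ Submodule.span k (Set.range (tailVar hd f)) ∧
      a = f (x₁ hh) * aeval (f (x₁ hh)) F + aeval (f (x₁ hh)) G * f (x₂ hh) + v := by
  have hVm : ∀ v ∈ Submodule.span k (Set.range (tailVar hd f)), v ∈ maximalIdeal A := by
    intro v hv
    induction hv using Submodule.span_induction with
    | mem v hv => obtain ⟨j, rfl⟩ := hv; exact hR.apply_X_mem hZ hs hts _
    | zero => exact Ideal.zero_mem _
    | add v w _ _ hv hw => exact Ideal.add_mem _ hv hw
    | smul c v _ hv => exact smul_mem_ideal _ _ hv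
  obtain ⟨F, G, ⟨v, hv⟩, rfl⟩ := hR.exists_eq hZ hs hts hf a
  have hF0 : F.coeff 0 = 0 := by
    rw [add_assoc] at ha
    exact coeff_zero_eq_zero_of_add_mem (hR.apply_X_mem hZ hs hts _)
      (Ideal.add_mem _ (Ideal.mul_mem_left _ _ (hR.apply_X_mem hZ hs hts _)) (hVm v hv)) ha
  refine ⟨F.divX, G, v, hv, ?_⟩
  rw [aeval_eq_add_divX _ F, hF0, map_zero, zero_add]

/-- The images of `x_1` and `x_2` in a model algebra form a frame. -/
theorem isFrame {hd : d + 2 = h} {Z : k[X]} (hZ : Z.coeff 0 ≠ 0)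
    (hR : ModelRel hh hd s t p (aeval (f (x₁ hh)) Z) f) (T : TypeData k A h s t) (ht : 2 ≤ t)
    (hst : 2 * t ≤ s) (hf : Function.Surjective f) :
    IsFrame k s t (f (x₁ hh)) (f (x₂ hh)) := by
  have hmem := hR.apply_X_mem hZ (by omega) (by omega)
  have hx : f (x₁ hh) ∈ maximalIdeal A := hmem _
  have hy : f (x₂ hh) ∈ maximalIdeal A := hmem _
  have hdec : ∀ a ∈ maximalIdeal A, _ := fun a ha =>
    hR.exists_eq_of_mem hZ (by omega) (by omega) hf ha
  have hann := hR.span_le_annihilatorPair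
  set x := f (x₁ hh) with hxdef
  set y := f (x₂ hh) with hydef
  set V := Submodule.span k (Set.range (tailVar hd f)) with hV
  have hVV : ∀ v ∈ V, ∀ w ∈ V, v * w ∈ Ideal.span {x} * maximalIdeal A := by
    intro v hv w hw
    induction hv using Submodule.span_induction with
    | mem v hv =>
      obtain ⟨i, rfl⟩ := hv
      induction hw using Submodule.span_induction with
      | mem w hw =>
        obtain ⟨j, rfl⟩ := hw
        by_cases hij : i = j
        · subst hij
          rw [← pow_two, hR.tail_sq, Ideal.mem_span_singleton_mul]
          refine ⟨x ^ (s - 1), Ideal.pow_mem_of_mem _ hx _ (by omega), ?_⟩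
          rw [← pow_succ']
          congr 1
          omega
        · rw [hR.tail_tail _ _ hij]
          exact Ideal.zero_mem _
      | zero => rw [mul_zero]; exact Ideal.zero_mem _
      | add v w _ _ hv hw => rw [mul_add]; exact Ideal.add_mem _ hv hw
      | smul c v _ hv => rw [mul_smul_comm]; exact smul_mem_ideal _ _ hv
    | zero => rw [zero_mul]; exact Ideal.zero_mem _
    | add v w _ _ hv hw => rw [add_mul]; exact Ideal.add_mem _ hv hw
    | smul c v _ hv => rw [smul_mul_assoc]; exact smul_mem_ideal _ _ hv
  have hsq : maximalIdeal A ^ 2 = Ideal.span {x} * maximalIdeal A := by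
    refine le_antisymm ?_ ?_
    · rw [pow_two, Ideal.mul_le]
      intro a ha b hb
      obtain ⟨F, G, v, hv, rfl⟩ := hdec a ha
      obtain ⟨F', G', v', hv', rfl⟩ := hdec b hb
      have e : (x * aeval x F + aeval x G * y + v) * (x * aeval x F' + aeval x G' * y + v') =
          x * (aeval x F * (x * aeval x F' + aeval x G' * y + v') + aeval x G * aeval x F' * y +
            aeval x G * aeval x G' * (x ^ p * y + aeval x Z * x ^ (s - t))) + v * v' := by
        have h1 := hR.y_sq
        have h2 := (hann hv').2
        have h3 := (hann hv).1
        have h4 := (hann hv).2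
        rw [← hxdef, ← hydef] at h1
        linear_combination aeval x G * aeval x G' * h1 + aeval x G * h2 + aeval x F' * h3 +
          aeval x G' * h4
      rw [e]
      refine Ideal.add_mem _ (Ideal.mul_mem_mul (Ideal.mem_span_singleton_self x) ?_)
        (hVV v hv v' hv')
      refine Ideal.add_mem _ (Ideal.add_mem _ (Ideal.mul_mem_left _ _ hb)
        (Ideal.mul_mem_left _ _ hy)) (Ideal.mul_mem_left _ _ ?_)
      exact Ideal.add_mem _ (Ideal.mul_mem_left _ _ hy)
        (Ideal.mul_mem_left _ _ (Ideal.pow_mem_of_mem _ hx _ (by omega)))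
    · rw [pow_two]
      exact Ideal.mul_mono_left ((Ideal.span_singleton_le_iff_mem _).mpr hx)
  refine ⟨hx, hy, ?_, hsq, hR.x_pow_y, ?_⟩
  · intro h0
    refine T.pow_ne_bot (by omega) ?_
    rw [eq_bot_iff]
    intro a ha
    rw [show s = (s - 1) + 1 by omega] at ha
    obtain ⟨b, hb, rfl⟩ := exists_eq_pow_mul hsq _ ha
    obtain ⟨F, G, v, hv, rfl⟩ := hdec b hb
    have h1 : x ^ (s - 1) * y = 0 := by
      rw [show s - 1 = (s - 1 - t) + t by omega, pow_add, mul_assoc, hR.x_pow_y, mul_zero]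
    have h2 : x ^ (s - 1) * v = 0 := by
      rw [show s - 1 = (s - 2) + 1 by omega, pow_succ, mul_assoc, (hann hv).1, mul_zero]
    rw [show s = (s - 1) + 1 by omega] at h0
    rw [Submodule.mem_bot]
    linear_combination aeval x F * h0 + aeval x G * h1 + h2
  · intro c hc
    obtain ⟨a, ha, ha'⟩ := T.exists_sub_smul_notMem le_rfl ht (x ^ 2)
    obtain ⟨b, hb, rfl⟩ := exists_eq_pow_mul hsq 1 ha
    obtain ⟨F, G, v, hv, rfl⟩ := hdec b hb
    refine ha' (F.coeff 0 + c * G.coeff 0) ?_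
    have e : x ^ 1 * (x * aeval x F + aeval x G * y + v) - (F.coeff 0 + c * G.coeff 0) • x ^ 2 =
        x ^ 3 * aeval x F.divX + algebraMap k A (G.coeff 0) * (x * y - c • x ^ 2) +
          x ^ 2 * y * aeval x G.divX := by
      rw [aeval_eq_add_divX x F, aeval_eq_add_divX x G]
      simp only [Algebra.smul_def, map_add, map_mul]
      linear_combination (hann hv).1
    rw [e]
    refine Ideal.add_mem _ (Ideal.add_mem _ (Ideal.mul_mem_right _ _ (Ideal.pow_mem_pow hx 3))
      (Ideal.mul_mem_left _ _ hc)) (Ideal.mul_mem_right _ _ ?_)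
    rw [pow_succ]
    exact Ideal.mul_mem_mul (Ideal.pow_mem_pow hx 2) hy

end ModelRel

/-- The second element of a frame is annihilated by `m ^ (t + 1)`. -/
theorem IsFrame.mul_y_eq_zero {x y a : A} (Fr : IsFrame k s t x y)
    (ha : a ∈ maximalIdeal A ^ (t + 1)) : a * y = 0 := by
  obtain ⟨b, _, rfl⟩ := exists_eq_pow_mul Fr.sq_eq t ha
  linear_combination b * Fr.x_pow_mul_y

/-- The elements annihilated by `x_1 ^ (t + 1)` in a model algebra. -/
theorem ModelRel.exists_eq_of_pow_mul_eq_zero {hd : d + 2 = h} {Z : k[X]} (hZ : Z.coeff 0 ≠ 0)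
    (hR : ModelRel hh hd s t p (aeval (f (x₁ hh)) Z) f) (T : TypeData k A h s t) (ht : 2 ≤ t)
    (hst : 2 * t ≤ s) (hf : Function.Surjective f) {a : A}
    (ha : f (x₁ hh) ^ (t + 1) * a = 0) :
    ∃ (F G : k[X]) (v : A), v ∈ Submodule.span k (Set.range (tailVar hd f)) ∧
      a = f (x₁ hh) ^ (s - t) * aeval (f (x₁ hh)) F +
        aeval (f (x₁ hh)) G * f (x₂ hh) + v := by
  have Fr := hR.isFrame hZ T ht hst hf
  obtain ⟨F, G, ⟨v, hv⟩, rfl⟩ := hR.exists_eq hZ (by omega) (by omega) hf a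
  have h1 : f (x₁ hh) ^ (t + 1) * aeval (f (x₁ hh)) F = 0 := by
    have h2 := (hR.span_le_annihilatorPair hv).1
    linear_combination ha - f (x₁ hh) * aeval (f (x₁ hh)) G * Fr.x_pow_mul_y -
      f (x₁ hh) ^ t * h2
  obtain ⟨F, rfl⟩ := Fr.dvd_of_x_pow_mul_aeval_eq_zero h1 (by omega)
  refine ⟨F, G, v, hv, ?_⟩
  rw [map_mul, map_pow, aeval_X, show s + 1 - (t + 1) = s - t by omega]

/-- The square of the annihilator of `m ^ (t + 1)` lies in `m ^ (p' + 2)`. If `p < p'`, this fails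
for the element `x_2` of the system of coordinates with exponent `p`, since `x_1 ^ (p + 1) x_2`
does not lie in `m ^ (p + 3)`. -/
theorem ModelRel.le_of_modelRel {hd : d + 2 = h} {Z : k[X]} (hZ : Z.coeff 0 ≠ 0)
    (hR : ModelRel hh hd s t p (aeval (f (x₁ hh)) Z) f) (T : TypeData k A h s t) (ht : 2 ≤ t)
    (hst : 2 * t ≤ s) (hf : Function.Surjective f)
    {f' : MvPowerSeries (Fin h) k →ₐ[k] A} {p' : ℕ} {Z' : k[X]} (hZ' : Z'.coeff 0 ≠ 0)
    (hR' : ModelRel hh hd s t p' (aeval (f' (x₁ hh)) Z') f') (hf' : Function.Surjective f')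
    (hp' : p' < t) : p' ≤ p := by
  by_contra! hlt
  have Fr := hR.isFrame hZ T ht hst hf
  have Fr' := hR'.isFrame hZ' T ht hst hf'
  obtain ⟨F, G, v, hv, hFG⟩ := hR'.exists_eq_of_pow_mul_eq_zero hZ' T ht hst hf'
    (Fr.mul_y_eq_zero (Ideal.pow_mem_pow Fr'.x_mem (t + 1)))
  have hann := hR'.span_le_annihilatorPair hv
  obtain ⟨α, hα⟩ := Fr'.mul_mem_line T ht hst hann hann
  set x' := f' (x₁ hh)
  set y' := f' (x₂ hh)
  have hpow : ∀ j, p' + 2 ≤ j → x' ^ j ∈ maximalIdeal A ^ (p' + 2) := fun j hj =>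
    Ideal.pow_le_pow_right hj (Ideal.pow_mem_pow Fr'.x_mem j)
  have hsq : f (x₂ hh) ^ 2 ∈ maximalIdeal A ^ (p' + 2) := by
    have h1 : x' ^ (s - t) * y' = 0 := Fr'.x_pow_mul_y_eq_zero (by omega)
    have h2 : x' ^ (s - t) * v = 0 := by
      rw [show s - t = (s - t - 1) + 1 by omega, pow_succ, mul_assoc, hann.1, mul_zero]
    have e : f (x₂ hh) ^ 2 = x' ^ (2 * (s - t)) * aeval x' F ^ 2 +
        aeval x' G ^ 2 * (x' ^ (p' + 1) * y' + aeval x' Z' * x' ^ (s - t + 1)) + α • x' ^ s := by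
      rw [← hR'.y_sq, ← hα, hFG]
      linear_combination 2 * aeval x' F * aeval x' G * h1 + 2 * aeval x' F * h2 +
        2 * aeval x' G * hann.2
    rw [e]
    refine Ideal.add_mem _ (Ideal.add_mem _ (Ideal.mul_mem_right _ _ (hpow _ (by omega)))
      (Ideal.mul_mem_left _ _ (Ideal.add_mem _ ?_ (Ideal.mul_mem_left _ _ (hpow _ (by omega))))))
      (smul_mem_ideal _ _ (hpow _ (by omega)))
    rw [pow_succ]
    exact Ideal.mul_mem_mul (Ideal.pow_mem_pow Fr'.x_mem _) Fr'.y_mem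
  have h1 : f (x₁ hh) ^ (p + 1) * f (x₂ hh) ∈ maximalIdeal A ^ (p + 3) := by
    have h2 : f (x₂ hh) ^ 2 ∈ maximalIdeal A ^ (p + 3) := Ideal.pow_le_pow_right (by omega) hsq
    rw [hR.y_sq] at h2
    have h3 : aeval (f (x₁ hh)) Z * f (x₁ hh) ^ (s - t + 1) ∈ maximalIdeal A ^ (p + 3) :=
      Ideal.mul_mem_left _ _
        (Ideal.pow_le_pow_right (by omega) (Ideal.pow_mem_pow Fr.x_mem (s - t + 1)))
    simpa using Ideal.sub_mem _ h2 h3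
  refine Fr.x_pow_mul_y_notMem T ht (by omega) ?_
  have h2 := Ideal.mul_mem_mul (Ideal.pow_mem_pow Fr.x_mem (t - 2 - p)) h1
  rw [← pow_add, ← mul_assoc, ← pow_add, show t - 2 - p + (p + 1) = t - 1 by omega,
    show t - 2 - p + (p + 3) = t + 1 by omega] at h2
  exact h2

end Frame

/-! ### Invariance of the parameter -/

section QuadraticModel

variable {k : Type*} [Field k]

/-- The ring `k[T] / (T ^ N)`. -/
abbrev TruncPoly (k : Type*) [Field k] (N : ℕ) : Type _ := k[X] ⧸ Ideal.span {(X ^ N : k[X])}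

/-- The quadratic extension of `k[T] / (T ^ N)` by a root `ω` of `ω ^ 2 = Z(T) + ω`. With
`x_1 = T` and `x_2 = T ^ ρ ω` the relation `x_2 ^ 2 = x_1 ^ ρ x_2 + Z x_1 ^ (2 ρ)` holds. -/
abbrev QuadExt (N : ℕ) (Z : k[X]) : Type _ :=
  QuadraticAlgebra (TruncPoly k N) (Ideal.Quotient.mk _ Z) 1

/-- The embedding of polynomials in `T`, truncated at `T ^ N`. -/
noncomputable def QuadExt.ofPoly (N : ℕ) (Z : k[X]) : k[X] →ₐ[k] QuadExt N Z :=
  (Algebra.ofId (TruncPoly k N) (QuadExt N Z)).restrictScalars k |>.comp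
    (Ideal.Quotient.mkₐ k (Ideal.span {(X ^ N : k[X])}))

/-- The root `ω`. -/
noncomputable def QuadExt.root (N : ℕ) (Z : k[X]) : QuadExt N Z := ⟨0, 1⟩

namespace QuadExt

variable {N : ℕ} {Z : k[X]}

theorem ofPoly_eq (F : k[X]) : ofPoly N Z F = ⟨Ideal.Quotient.mk _ F, 0⟩ := rfl

theorem root_sq : root N Z ^ 2 = ofPoly N Z Z + root N Z := by
  rw [pow_two, ofPoly_eq, root]
  ext <;> simp

theorem ofPoly_X_pow_eq_zero : ofPoly N Z X ^ N = 0 := by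
  rw [← map_pow, ofPoly_eq, Ideal.Quotient.eq_zero_iff_mem.mpr (Ideal.mem_span_singleton_self _)]
  rfl

theorem aeval_ofPoly_X (F : k[X]) : aeval (ofPoly N Z X) F = ofPoly N Z F := by
  rw [aeval_algHom_apply, aeval_X_left_apply]

theorem exists_eq (a : QuadExt N Z) :
    ∃ F G : k[X], a = ofPoly N Z F + ofPoly N Z G * root N Z := by
  obtain ⟨b, c⟩ := a
  obtain ⟨F, rfl⟩ := Ideal.Quotient.mk_surjective b
  obtain ⟨G, rfl⟩ := Ideal.Quotient.mk_surjective c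
  refine ⟨F, G, ?_⟩
  rw [ofPoly_eq, ofPoly_eq, root]
  ext <;> simp

theorem add_mul_root_eq_zero_iff {F G : k[X]} :
    ofPoly N Z F + ofPoly N Z G * root N Z = 0 ↔ X ^ N ∣ F ∧ X ^ N ∣ G := by
  have e : ofPoly N Z F + ofPoly N Z G * root N Z =
      ⟨Ideal.Quotient.mk _ F, Ideal.Quotient.mk _ G⟩ := by
    rw [ofPoly_eq, ofPoly_eq, root]
    ext <;> simp
  rw [e, ← Ideal.mem_span_singleton, ← Ideal.mem_span_singleton,
    ← Ideal.Quotient.eq_zero_iff_mem, ← Ideal.Quotient.eq_zero_iff_mem]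
  exact QuadraticAlgebra.ext_iff

/-- Multiplication by `T ^ i` is injective up to multiples of `T ^ q` if `N = i + q`. -/
theorem X_pow_dvd_of_mul_eq_zero {i q : ℕ} (hN : N = i + q) {a : QuadExt N Z}
    (ha : ofPoly N Z X ^ i * a = 0) : ofPoly N Z X ^ q ∣ a := by
  obtain ⟨F, G, rfl⟩ := exists_eq a
  have h1 : ofPoly N Z (X ^ i * F) + ofPoly N Z (X ^ i * G) * root N Z = 0 := by
    rw [map_mul, map_mul, map_pow]
    linear_combination ha
  rw [add_mul_root_eq_zero_iff, hN, pow_add, mul_dvd_mul_iff_left (pow_ne_zero _ X_ne_zero),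
    mul_dvd_mul_iff_left (pow_ne_zero _ X_ne_zero)] at h1
  obtain ⟨⟨F, rfl⟩, ⟨G, rfl⟩⟩ := h1
  rw [map_mul, map_mul, map_pow]
  exact ⟨ofPoly N Z F + ofPoly N Z G * root N Z, by ring⟩

theorem X_pow_dvd_and_of_dvd {q : ℕ} (hq : q ≤ N) {F G : k[X]}
    (h : ofPoly N Z X ^ q ∣ ofPoly N Z F + ofPoly N Z G * root N Z) : X ^ q ∣ F ∧ X ^ q ∣ G := by
  obtain ⟨a, ha⟩ := h
  obtain ⟨F', G', rfl⟩ := exists_eq a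
  have h1 : ofPoly N Z (F - X ^ q * F') + ofPoly N Z (G - X ^ q * G') * root N Z = 0 := by
    simp only [map_sub, map_mul, map_pow]
    linear_combination ha
  rw [add_mul_root_eq_zero_iff] at h1
  have h2 : (X ^ q : k[X]) ∣ X ^ N := pow_dvd_pow _ hq
  exact ⟨(dvd_sub_left (Dvd.intro _ rfl)).mp (h2.trans h1.1),
    (dvd_sub_left (Dvd.intro _ rfl)).mp (h2.trans h1.2)⟩

end QuadExt

theorem X_pow_dvd_of_dvd_mul {q : ℕ} {F G : k[X]} (hF : F.coeff 0 ≠ 0) (h : X ^ q ∣ F * G) :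
    X ^ q ∣ G := by
  refine IsCoprime.dvd_of_dvd_mul_left (IsCoprime.pow_left ?_) h
  refine (Irreducible.coprime_iff_not_dvd irreducible_X).mpr ?_
  rwa [X_dvd_iff]

theorem coeff_zero_eq_of_X_pow_dvd_sub {q : ℕ} (hq : 0 < q) {F G : k[X]} (h : X ^ q ∣ F - G) :
    F.coeff 0 = G.coeff 0 := by
  have h1 : X ∣ F - G := (dvd_pow_self X hq.ne').trans h
  rwa [X_dvd_iff, coeff_sub, sub_eq_zero] at h1

theorem coeff_zero_pow (F : k[X]) (n : ℕ) : (F ^ n).coeff 0 = F.coeff 0 ^ n := by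
  rw [coeff_zero_eq_eval_zero, eval_pow, ← coeff_zero_eq_eval_zero]

/-- Two parameters among `c` and `c + T ^ d` that agree up to a substitution `T ↦ T u(T)` modulo
`T ^ q` are equal. -/
theorem param_eq_of_dvd {q : ℕ} (hq : 0 < q) {u : k[X]} (hu : u.coeff 0 ≠ 0) {Z Z' : k[X]}
    (hZ : ∃ c : k, Z = C c ∨ ∃ d : ℕ, 1 ≤ d ∧ d < q ∧ Z = C c + X ^ d)
    (hZ' : ∃ c : k, Z' = C c ∨ ∃ d : ℕ, 1 ≤ d ∧ d < q ∧ Z' = C c + X ^ d)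
    (h : X ^ q ∣ Z - Z'.comp (X * u)) : Z = Z' := by
  have h0 := coeff_zero_eq_of_X_pow_dvd_sub hq h
  have hX0 : ∀ d : ℕ, 1 ≤ d → (X ^ d : k[X]).coeff 0 = 0 := fun d hd => by
    rw [coeff_X_pow, if_neg (by omega)]
  have hXu0 : ∀ d : ℕ, 1 ≤ d → ((X * u) ^ d : k[X]).coeff 0 = 0 := fun d hd => by
    rw [coeff_zero_pow, coeff_X_mul_zero, zero_pow (by omega)]
  have hndvd : ∀ {d e : ℕ} {v : k[X]}, d < e → v.coeff 0 ≠ 0 → ¬ X ^ e ∣ X ^ d * v := by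
    intro d e v hde hv hdvd
    rw [show e = d + (e - d) by omega, pow_add,
      mul_dvd_mul_iff_left (pow_ne_zero _ X_ne_zero)] at hdvd
    exact hv (X_dvd_iff.mp ((dvd_pow_self X (by omega)).trans hdvd))
  have hu' : ∀ d : ℕ, (u ^ d).coeff 0 ≠ 0 := fun d => by
    rw [coeff_zero_pow]; exact pow_ne_zero _ hu
  have h1 : ((1 : k[X])).coeff 0 ≠ 0 := by simp
  obtain ⟨c, rfl | ⟨d, hd, hdq, rfl⟩⟩ := hZ <;> obtain ⟨c', rfl | ⟨d', hd', hdq', rfl⟩⟩ := hZ' <;>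
    simp only [add_comp, C_comp, X_pow_comp, coeff_add, coeff_C_zero] at h h0
  · rw [h0]
  · rw [hXu0 _ hd', add_zero] at h0
    rw [h0, sub_add_cancel_left, dvd_neg, mul_pow] at h
    exact absurd h (hndvd hdq' (hu' d'))
  · rw [hX0 _ hd, add_zero] at h0
    rw [h0, add_sub_cancel_left, ← mul_one (X ^ d)] at h
    exact absurd h (hndvd hdq h1)
  · rw [hX0 _ hd, hXu0 _ hd', add_zero, add_zero] at h0
    rw [h0, add_sub_add_left_eq_sub, mul_pow] at h
    rcases lt_trichotomy d d' with hlt | rfl | hlt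
    · have h2 : X ^ d' ∣ X ^ d := (dvd_sub_left (Dvd.intro _ rfl)).mp
        ((pow_dvd_pow X hdq'.le).trans h)
      rw [← mul_one (X ^ d)] at h2
      exact absurd h2 (hndvd hlt h1)
    · rw [h0]
    · have h2 : X ^ d ∣ X ^ d' * u ^ d' := (dvd_sub_right dvd_rfl).mp
        ((pow_dvd_pow X hdq.le).trans h)
      exact absurd h2 (hndvd hlt (hu' d'))

end QuadraticModel

section Parameter

variable {k : Type*} [Field k] {h s t r d : ℕ} {hh : 2 ≤ h}

/-- In the relation `y ^ 2 = x ^ m y + P(x) x ^ n` terms that are multiples of `a` do not matter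
modulo `a`. -/
theorem dvd_relation_of_dvd {B : Type*} [CommRing B] [Algebra k B] {P : k[X]}
    {a τ U κ W l : B} {m n : ℕ}
    (h : a ∣ (W + a * l) ^ 2 - (U + a * κ) ^ m * (W + a * l) -
      aeval (τ * (U + a * κ)) P * (U + a * κ) ^ n) :
    a ∣ W ^ 2 - U ^ m * W - aeval (τ * U) P * U ^ n := by
  let π := Ideal.Quotient.mkₐ k (Ideal.span {a})
  have hπ : ∀ b, π b = 0 ↔ a ∣ b := fun b =>
    Ideal.Quotient.eq_zero_iff_mem.trans Ideal.mem_span_singleton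
  have h0 : π a = 0 := (hπ a).mpr dvd_rfl
  rw [← hπ] at h ⊢
  simpa only [map_sub, map_mul, map_pow, map_add, ← aeval_algHom_apply, h0, zero_mul,
    add_zero] using h

/-- In `QuadExt` the elements `T` and `T ^ (r + 1) ω` satisfy the relations of a model algebra, with
all further variables equal to zero. -/
theorem exists_algHom_quadExt (hd : d + 2 = h) {N : ℕ} (Z : k[X])
    (hNs : N ≤ s) (hNt : N = t + (r + 1)) (hr : 2 * (r + 1) = s - t + 1) :
    ∃ g : MvPowerSeries (Fin h) k →ₐ[k] QuadExt N Z,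
      modelIdeal hh s t r (aeval (x₁ hh) Z) ≤ RingHom.ker g ∧
        g (x₁ hh) = QuadExt.ofPoly N Z X ∧
        g (x₂ hh) = QuadExt.ofPoly N Z X ^ (r + 1) * QuadExt.root N Z ∧
        ∀ j, tailVar hd g j = 0 := by
  set τ := QuadExt.ofPoly N Z X with hτ
  set ω := QuadExt.root N Z with hω
  have hτN : τ ^ N = 0 := QuadExt.ofPoly_X_pow_eq_zero
  obtain ⟨g, hg⟩ := exists_algHom_of_isNilpotent (k := k) (h := h) (fun i =>
    if i.val = 0 then τ else if i.val = 1 then τ ^ (r + 1) * ω else 0) (by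
      intro i
      have hτn : IsNilpotent τ := ⟨N, hτN⟩
      split_ifs
      · exact hτn
      · exact (Commute.all _ _).isNilpotent_mul_right (hτn.pow_succ r)
      · exact IsNilpotent.zero)
  have hg0 : g (x₁ hh) = τ := by rw [x₁, hg]; simp
  have hg1 : g (x₂ hh) = τ ^ (r + 1) * ω := by rw [x₂, hg]; simp
  have hg2 : ∀ j, tailVar hd g j = 0 := by intro j; rw [tailVar, hg]; simp
  refine ⟨g, ?_, hg0, hg1, hg2⟩
  rw [modelIdeal_le_ker_iff hd, ← aeval_algHom_apply]
  refine ⟨fun j => ?_, fun j => ?_, fun i j hij => ?_, fun j => ?_, ?_, ?_⟩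
  · rw [hg2, mul_zero]
  · rw [hg2, mul_zero]
  · rw [hg2, zero_mul]
  · rw [hg2, hg0, pow_eq_zero_of_le hNs hτN]
    simp
  · rw [hg0, hg1, ← hr, QuadExt.aeval_ofPoly_X]
    linear_combination τ ^ (2 * (r + 1)) * QuadExt.root_sq (N := N) (Z := Z)
  · rw [hg0, hg1, ← mul_assoc, ← pow_add, ← hNt, hτN, zero_mul]

/-- If the algebra of the parameters `(r, Z)` is also that of `(r, Z')`, then `Z` and `Z'` agree
modulo `T ^ (t - r - 1)` up to a substitution `T ↦ T u(T)`. The two coordinate systems are compared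
in `QuadExt`, where multiples of `T ^ q` relative to the leading terms are negligible. -/
theorem exists_dvd_sub_comp {A : Type*} [CommRing A] [IsLocalRing A] [Algebra k A]
    (T : TypeData k A h s t) (ht : 2 ≤ t) (hst : 2 * t ≤ s) (hrt : r + 2 ≤ t)
    (hr : 2 * (r + 1) = s - t + 1) {Z Z' : k[X]} (hZ : Z.coeff 0 ≠ 0) (hZ' : Z'.coeff 0 ≠ 0)
    {f f' : MvPowerSeries (Fin h) k →ₐ[k] A} (hf : Function.Surjective f)
    (hf' : Function.Surjective f')
    (hker : RingHom.ker f = modelIdeal hh s t r (aeval (x₁ hh) Z))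
    (hker' : RingHom.ker f' = modelIdeal hh s t r (aeval (x₁ hh) Z')) :
    ∃ u : k[X], u.coeff 0 ≠ 0 ∧ X ^ (t - r - 1) ∣ Z - Z'.comp (X * u) := by
  obtain ⟨d, hd⟩ : ∃ d, d + 2 = h := ⟨h - 2, by omega⟩
  have hR : ModelRel hh hd s t r (aeval (f (x₁ hh)) Z) f := by
    rw [aeval_algHom_apply, ← modelIdeal_le_ker_iff, hker]
  have hR' : ModelRel hh hd s t r (aeval (f' (x₁ hh)) Z') f' := by
    rw [aeval_algHom_apply, ← modelIdeal_le_ker_iff, hker']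
  have Fr := hR.isFrame hZ T ht hst hf
  have Fr' := hR'.isFrame hZ' T ht hst hf'
  obtain ⟨q, hq⟩ : ∃ q, t = q + (r + 1) := ⟨t - (r + 1), by omega⟩
  have htq : t - r - 1 = q := by omega
  rw [htq]
  obtain ⟨g, hgle, hg0, hg1, hg2⟩ := exists_algHom_quadExt (hh := hh) (s := s) (t := t) (r := r)
    hd (N := t + (r + 1)) Z (by omega) rfl hr
  -- The homomorphism to `QuadExt` factors through `A`.
  obtain ⟨ψ, hψ⟩ : ∃ ψ : A →ₐ[k] QuadExt (t + (r + 1)) Z, ∀ a, ψ (f a) = g a := by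
    refine ⟨AlgHom.liftOfSurjective f hf g ?_, fun a => ?_⟩
    · exact fun a ha => hgle (by rw [← hker]; exact ha)
    · exact AlgHom.liftOfSurjective_apply f hf g _ a
  set τ := QuadExt.ofPoly (t + (r + 1)) Z X with hτ
  set ω := QuadExt.root (t + (r + 1)) Z with hω
  have hψx : ψ (f (x₁ hh)) = τ := by rw [hψ, hg0]
  have hψy : ψ (f (x₂ hh)) = τ ^ (r + 1) * ω := by rw [hψ, hg1]
  have hψv : ∀ v ∈ Submodule.span k (Set.range (tailVar hd f)), ψ v = 0 := by
    intro v hv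
    induction hv using Submodule.span_induction with
    | mem v hv => obtain ⟨j, rfl⟩ := hv; rw [tailVar, hψ]; exact hg2 j
    | zero => exact map_zero _
    | add v w _ _ hv hw => rw [map_add, hv, hw, add_zero]
    | smul c v _ hv => rw [map_smul, hv, smul_zero]
  have hψpoly : ∀ F : k[X], ψ (aeval (f (x₁ hh)) F) = QuadExt.ofPoly _ Z F := by
    intro F
    rw [← aeval_algHom_apply, hψx, QuadExt.aeval_ofPoly_X]
  -- The coordinates `x_1'`, `x_2'` in terms of `x_1`, `x_2`.
  obtain ⟨u, G, v, hv, hX⟩ := hR.exists_eq_of_mem hZ (by omega) (by omega) hf Fr'.x_mem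
  obtain ⟨F, w, v', hv', hY⟩ := hR.exists_eq_of_pow_mul_eq_zero hZ T ht hst hf
    (Fr'.mul_y_eq_zero (Ideal.pow_mem_pow Fr.x_mem (t + 1)))
  -- If `u(0) = 0`, then `x_1'` is the sum of an element of `m ^ 2` and one killed by `x_1 ^ (t +
  -- 1)`. As `x_1` is expressed through `x_1'`, `x_2'`, this puts `x_1 ^ (t + 2)` into `m ^ (t +
  -- 3)`.
  have hu0 : u.coeff 0 ≠ 0 := by
    intro hu0
    obtain ⟨a, b, v'', hv'', hx⟩ := hR'.exists_eq_of_mem hZ' (by omega) (by omega) hf' Fr.x_mem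
    refine T.pow_notMem Fr.x_mem Fr.x_pow_ne (j := t + 2) (by omega) ?_
    have h1 : f (x₁ hh) ^ (t + 1) * f' (x₂ hh) = 0 :=
      Fr'.mul_y_eq_zero (Ideal.pow_mem_pow Fr.x_mem (t + 1))
    have h2 : f (x₁ hh) ^ (t + 1) * v'' = 0 :=
      Fr'.mul_eq_zero_of_mem_sq (hR'.span_le_annihilatorPair hv'').1
        (Ideal.pow_le_pow_right (by omega) (Ideal.pow_mem_pow Fr.x_mem (t + 1)))
    have h3 : f (x₁ hh) ^ t * f (x₂ hh) = 0 := Fr.x_pow_mul_y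
    have h4 := (hR.span_le_annihilatorPair hv).1
    rw [aeval_eq_add_divX _ u, hu0, map_zero, zero_add] at hX
    have e : f (x₁ hh) ^ (t + 2) = f (x₁ hh) ^ (t + 3) *
        (aeval (f (x₁ hh)) u.divX * aeval (f' (x₁ hh)) a) := by
      linear_combination f (x₁ hh) ^ (t + 1) * hx +
        f (x₁ hh) ^ (t + 1) * aeval (f' (x₁ hh)) a * hX +
        aeval (f' (x₁ hh)) b * h1 + h2 +
        f (x₁ hh) * aeval (f (x₁ hh)) G * aeval (f' (x₁ hh)) a * h3 +
        f (x₁ hh) ^ t * aeval (f' (x₁ hh)) a * h4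
    rw [e]
    exact Ideal.mul_mem_right _ _ (Ideal.pow_mem_pow Fr.x_mem _)
  refine ⟨u, hu0, ?_⟩
  set U := QuadExt.ofPoly (t + (r + 1)) Z u with hU
  set W := QuadExt.ofPoly (t + (r + 1)) Z w with hW
  -- The corrections to the leading terms are negligible because of `q ≤ r`, a consequence of
  -- `2 t ≤ s`.
  obtain ⟨κ, hκ⟩ : ∃ κ, ψ (f' (x₁ hh)) = τ * (U + τ ^ q * κ) := by
    refine ⟨QuadExt.ofPoly _ Z G * τ ^ (r - q) * ω, ?_⟩
    rw [hX, map_add, map_add, map_mul, map_mul, hψx, hψy, hψpoly, hψpoly, hψv v hv]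
    have e : τ ^ (r + 1) = τ * (τ ^ q * τ ^ (r - q)) := by
      rw [← pow_add, ← pow_succ']; congr 1; omega
    rw [e]
    ring
  obtain ⟨l, hl⟩ : ∃ l, ψ (f' (x₂ hh)) = τ ^ (r + 1) * (W * ω + τ ^ q * l) := by
    refine ⟨QuadExt.ofPoly _ Z F * τ ^ (r - q), ?_⟩
    rw [hY, map_add, map_add, map_mul, map_mul, map_pow, hψx, hψy, hψpoly, hψpoly, hψv v' hv']
    have e : τ ^ (s - t) = τ ^ (r + 1) * (τ ^ q * τ ^ (r - q)) := by
      rw [← pow_add, ← pow_add]; congr 1; omega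
    rw [e]
    ring
  have hrel := congrArg ψ hR'.y_sq
  rw [map_add, map_mul, map_mul, map_pow, map_pow, map_pow, ← aeval_algHom_apply, hl, hκ,
    ← hr, mul_pow τ (U + τ ^ q * κ) (r + 1), mul_pow τ (U + τ ^ q * κ) (2 * (r + 1))] at hrel
  have hdvd : τ ^ q ∣ (W * ω + τ ^ q * l) ^ 2 - (U + τ ^ q * κ) ^ (r + 1) * (W * ω + τ ^ q * l) -
      aeval (τ * (U + τ ^ q * κ)) Z' * (U + τ ^ q * κ) ^ (2 * (r + 1)) := by
    refine QuadExt.X_pow_dvd_of_mul_eq_zero (i := 2 * (r + 1)) (by omega) ?_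
    rw [← hτ]
    linear_combination hrel
  -- Modulo `T ^ q` the relation only involves the leading terms.
  have hdvd' : τ ^ q ∣ (W * ω) ^ 2 - U ^ (r + 1) * (W * ω) -
      aeval (τ * U) Z' * U ^ (2 * (r + 1)) := dvd_relation_of_dvd hdvd
  have hpoly : (W * ω) ^ 2 - U ^ (r + 1) * (W * ω) - aeval (τ * U) Z' * U ^ (2 * (r + 1)) =
      QuadExt.ofPoly _ Z (w ^ 2 * Z - Z'.comp (X * u) * u ^ (2 * (r + 1))) +
        QuadExt.ofPoly _ Z (w ^ 2 - u ^ (r + 1) * w) * ω := by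
    have h1 : aeval (τ * U) Z' = QuadExt.ofPoly (t + (r + 1)) Z (Z'.comp (X * u)) := by
      rw [hτ, hU, ← map_mul, aeval_algHom_apply]
      rfl
    rw [h1]
    simp only [map_sub, map_mul, map_pow]
    linear_combination W ^ 2 * QuadExt.root_sq (N := t + (r + 1)) (Z := Z)
  rw [hpoly] at hdvd'
  obtain ⟨hd1, hd2⟩ := QuadExt.X_pow_dvd_and_of_dvd (by omega) hdvd'
  have hq0 : 0 < q := by omega
  have hw0 : w.coeff 0 ≠ 0 := by
    intro hw0
    have h1 := coeff_zero_eq_of_X_pow_dvd_sub hq0 hd1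
    rw [mul_coeff_zero, mul_coeff_zero, coeff_zero_pow, coeff_zero_pow, hw0, zero_pow two_ne_zero,
      zero_mul] at h1
    have h2 : (Z'.comp (X * u)).coeff 0 = Z'.coeff 0 := by
      rw [coeff_zero_eq_eval_zero, eval_comp, eval_mul, eval_X, zero_mul,
        ← coeff_zero_eq_eval_zero]
    rw [h2] at h1
    exact mul_ne_zero hZ' (pow_ne_zero _ hu0) h1.symm
  have hd3 : X ^ q ∣ w - u ^ (r + 1) := by
    refine X_pow_dvd_of_dvd_mul hw0 ?_
    convert hd2 using 1
    ring
  have hd4 : X ^ q ∣ u ^ (2 * (r + 1)) * (Z - Z'.comp (X * u)) := by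
    have e : u ^ (2 * (r + 1)) * (Z - Z'.comp (X * u)) =
        (w ^ 2 * Z - Z'.comp (X * u) * u ^ (2 * (r + 1))) -
          (w - u ^ (r + 1)) * ((w + u ^ (r + 1)) * Z) := by ring
    rw [e]
    exact dvd_sub hd1 (Dvd.dvd.mul_right hd3 _)
  refine X_pow_dvd_of_dvd_mul ?_ hd4
  rw [coeff_zero_pow]
  exact pow_ne_zero _ hu0

end Parameter

/-! ### The classification -/

section Classification

variable {k : Type*} [Field k] {h s t r p p' : ℕ} {hh : 2 ≤ h}
  {I : Ideal (MvPowerSeries (Fin h) k)}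

theorem exists_typeData (ht : 2 ≤ t) (hst : 2 * t ≤ s)
    (hI : IsAlmostStretchedGorenstein (MvPowerSeries (Fin h) k ⧸ I) h s t) :
    ∃ _ : IsLocalRing (MvPowerSeries (Fin h) k ⧸ I),
      TypeData k (MvPowerSeries (Fin h) k ⧸ I) h s t := by
  obtain ⟨hloc, -, hG, hT⟩ := hI
  exact ⟨hloc, TypeData.of_hasType ht hst (exists_algebraMap_sub_mem_maximalIdeal
    (Ideal.Quotient.mkₐ k I) (Ideal.Quotient.mkₐ_surjective k I)) hG hT⟩

theorem IdealIso.exists_algHom {J : Ideal (MvPowerSeries (Fin h) k)} (e : IdealIso I J) :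
    ∃ f : MvPowerSeries (Fin h) k →ₐ[k] MvPowerSeries (Fin h) k ⧸ I,
      Function.Surjective f ∧ RingHom.ker f = J := by
  obtain ⟨e⟩ := e
  refine ⟨e.symm.toAlgHom.comp (Ideal.Quotient.mkₐ k J),
    e.symm.surjective.comp (Ideal.Quotient.mkₐ_surjective k J), ?_⟩
  ext a
  rw [RingHom.mem_ker]
  change e.symm (Ideal.Quotient.mk J a) = 0 ↔ _
  rw [map_eq_zero_iff _ e.symm.injective, Ideal.Quotient.eq_zero_iff_mem]

theorem modelRel_of_ker_eq {A : Type*} [CommRing A] [Algebra k A] {d : ℕ} (hd : d + 2 = h)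
    {f : MvPowerSeries (Fin h) k →ₐ[k] A} {Z : k[X]}
    (hker : RingHom.ker f = modelIdeal hh s t p (aeval (x₁ hh) Z)) :
    ModelRel hh hd s t p (aeval (f (x₁ hh)) Z) f := by
  rw [aeval_algHom_apply, ← modelIdeal_le_ker_iff, hker]

theorem exponent_eq_of_idealIso [IsLocalRing (MvPowerSeries (Fin h) k ⧸ I)]
    (T : TypeData k (MvPowerSeries (Fin h) k ⧸ I) h s t) (ht : 2 ≤ t) (hst : 2 * t ≤ s)
    {Z Z' : k[X]} (hZ : Z.coeff 0 ≠ 0) (hZ' : Z'.coeff 0 ≠ 0) (hp : p < t) (hp' : p' < t)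
    (hI : IdealIso I (modelIdeal hh s t p (aeval (x₁ hh) Z)))
    (hI' : IdealIso I (modelIdeal hh s t p' (aeval (x₁ hh) Z'))) : p = p' := by
  obtain ⟨d, hd⟩ : ∃ d, d + 2 = h := ⟨h - 2, by omega⟩
  obtain ⟨f, hf, hker⟩ := hI.exists_algHom
  obtain ⟨f', hf', hker'⟩ := hI'.exists_algHom
  have hR := modelRel_of_ker_eq hd hker
  have hR' := modelRel_of_ker_eq hd hker'
  exact le_antisymm (hR'.le_of_modelRel hZ' T ht hst hf' hZ hR hf hp)
    (hR.le_of_modelRel hZ T ht hst hf hZ' hR' hf' hp')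

theorem param_eq_of_idealIso [IsLocalRing (MvPowerSeries (Fin h) k ⧸ I)]
    (T : TypeData k (MvPowerSeries (Fin h) k ⧸ I) h s t) (ht : 2 ≤ t) (hst : 2 * t ≤ s)
    (hrt : r + 2 ≤ t) (hr : 2 * (r + 1) = s - t + 1) {Z Z' : k[X]}
    (hZ : ∃ c : k, c ≠ 0 ∧ (Z = C c ∨ ∃ d : ℕ, 1 ≤ d ∧ d + r + 2 ≤ t ∧ Z = C c + X ^ d))
    (hZ' : ∃ c : k, c ≠ 0 ∧ (Z' = C c ∨ ∃ d : ℕ, 1 ≤ d ∧ d + r + 2 ≤ t ∧ Z' = C c + X ^ d))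
    (hI : IdealIso I (modelIdeal hh s t r (aeval (x₁ hh) Z)))
    (hI' : IdealIso I (modelIdeal hh s t r (aeval (x₁ hh) Z'))) : Z = Z' := by
  have key : ∀ {Z : k[X]},
      (∃ c : k, c ≠ 0 ∧ (Z = C c ∨ ∃ d : ℕ, 1 ≤ d ∧ d + r + 2 ≤ t ∧ Z = C c + X ^ d)) →
      Z.coeff 0 ≠ 0 ∧ ∃ c : k, Z = C c ∨ ∃ d : ℕ, 1 ≤ d ∧ d < t - r - 1 ∧ Z = C c + X ^ d := by
    rintro Z ⟨c, hc, rfl | ⟨d, hd, hd', rfl⟩⟩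
    · exact ⟨by simpa using hc, c, Or.inl rfl⟩
    · refine ⟨?_, c, Or.inr ⟨d, hd, by omega, rfl⟩⟩
      rwa [coeff_add, coeff_C_zero, coeff_X_pow, if_neg (by omega), add_zero]
  obtain ⟨f, hf, hker⟩ := hI.exists_algHom
  obtain ⟨f', hf', hker'⟩ := hI'.exists_algHom
  obtain ⟨u, hu, hdvd⟩ := exists_dvd_sub_comp T ht hst hrt hr (key hZ).1 (key hZ').1 hf hf'
    hker hker'
  exact param_eq_of_dvd (by omega) hu (key hZ).2 (key hZ').2 hdvd

theorem classification_regular [IsAlgClosed k] [CharZero k] (hh : 2 ≤ h) (ht : 2 ≤ t)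
    (hst : 2 * t ≤ s) (hI : IsAlmostStretchedGorenstein (MvPowerSeries (Fin h) k ⧸ I) h s t)
    (hreg : RegularPair s t) :
    ∃! q : ℕ × MvPowerSeries (Fin h) k,
      q ∈ regularParams k h t ∧ IdealIso I (modelIdeal hh s t q.1 q.2) := by
  obtain ⟨hloc, T⟩ := exists_typeData ht hst hI
  obtain ⟨p, Z, hp, hZ, e⟩ := exists_algEquiv_model hh ht hst T
  obtain ⟨rfl, -⟩ | ⟨h1, h2, -⟩ := hZ
  swap
  · exact absurd ⟨p, h1, by omega⟩ hreg
  have h1 : aeval (x₁ hh : MvPowerSeries (Fin h) k) (1 : k[X]) = 1 := map_one _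
  rw [h1] at e
  refine ⟨(p, 1), ⟨⟨hp, rfl⟩, e⟩, ?_⟩
  rintro ⟨p', z'⟩ ⟨⟨hp', hz' : z' = 1⟩, e'⟩
  subst hz'
  obtain rfl : p' = p := exponent_eq_of_idealIso T ht hst (Z := 1) (Z' := 1) (by simp) (by simp)
    hp' hp (by rw [h1]; exact e') (by rw [h1]; exact e)
  rfl

/-- The parameters of the list are values of polynomials at `x_1`. -/
theorem exists_poly_of_mem_nonregularParams {q : ℕ × MvPowerSeries (Fin h) k}
    (hrt : r + 2 ≤ t) (hq : q ∈ nonregularParams k hh t r) :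
    ∃ Z : k[X], q.2 = aeval (x₁ hh) Z ∧ Z.coeff 0 ≠ 0 ∧ q.1 < t ∧ (q.1 ≠ r → Z = 1) ∧
      (q.1 = r → ∃ c : k, c ≠ 0 ∧
        (Z = C c ∨ ∃ d : ℕ, 1 ≤ d ∧ d + r + 2 ≤ t ∧ Z = C c + X ^ d)) := by
  obtain ⟨p, z⟩ := q
  obtain ⟨h1, h2, h3⟩ | ⟨h1, c, hc, h2⟩ | ⟨h1, c, hc, d, hd, hd', h2⟩ := hq <;>
    simp only at *
  · exact ⟨1, by simpa using h3, by simp, h1, fun _ => rfl, fun h => absurd h h2⟩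
  · refine ⟨C c, ?_, by simpa using hc, by omega, fun h => absurd h1 h,
      fun _ => ⟨c, hc, Or.inl rfl⟩⟩
    rw [h2, aeval_C]; rfl
  · refine ⟨C c + X ^ d, ?_, ?_, by omega, fun h => absurd h1 h,
      fun _ => ⟨c, hc, Or.inr ⟨d, hd, hd', rfl⟩⟩⟩
    · rw [h2, map_add, aeval_C, map_pow, aeval_X]; rfl
    · rwa [coeff_add, coeff_C_zero, coeff_X_pow, if_neg (by omega), add_zero]

theorem classification_nonregular [IsAlgClosed k] [CharZero k] (hh : 2 ≤ h) (ht : 2 ≤ t)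
    (hst : 2 * t ≤ s) (hI : IsAlmostStretchedGorenstein (MvPowerSeries (Fin h) k ⧸ I) h s t)
    (hrt : r + 2 ≤ t) (hr : 2 * (r + 1) + t = s + 1) :
    ∃! q : ℕ × MvPowerSeries (Fin h) k,
      q ∈ nonregularParams k hh t r ∧ IdealIso I (modelIdeal hh s t q.1 q.2) := by
  obtain ⟨hloc, T⟩ := exists_typeData ht hst hI
  refine existsUnique_of_exists_of_unique ?_ ?_
  · obtain ⟨p, Z, hp, hZ, e⟩ := exists_algEquiv_model hh ht hst T
    refine ⟨(p, aeval (x₁ hh) Z), ?_, e⟩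
    obtain ⟨rfl, hpr⟩ | ⟨h1, h2, c, hc, rfl | ⟨d, hd, hd', rfl⟩⟩ := hZ
    · exact Or.inl ⟨hp, fun h => hpr ⟨by simp only at h; omega, by simp only at h; omega⟩,
        by simp⟩
    · exact Or.inr (Or.inl ⟨by simp only; omega, c, hc, aeval_C _ c⟩)
    · refine Or.inr (Or.inr ⟨by simp only; omega, c, hc, d, hd, by omega, ?_⟩)
      simp only
      rw [map_add, aeval_C, map_pow, aeval_X]
      rfl
  · rintro ⟨p, z⟩ ⟨p', z'⟩ ⟨hq, e⟩ ⟨hq', e'⟩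
    obtain ⟨Z, hz, hZ, hp, hne, heq⟩ := exists_poly_of_mem_nonregularParams hrt hq
    obtain ⟨Z', hz', hZ', hp', hne', heq'⟩ := exists_poly_of_mem_nonregularParams hrt hq'
    simp only at *
    subst hz hz'
    obtain rfl := exponent_eq_of_idealIso T ht hst hZ hZ' hp hp' e e'
    by_cases hpr : p = r
    · subst hpr
      rw [param_eq_of_idealIso T ht hst hrt (by omega) (heq rfl) (heq' rfl) e e']
    · rw [hne hpr, hne' hpr]

end Classification

/-! ### Model algebras in two variables -/

section PlaneModel

variable {k : Type*} [Field k] {s t p : ℕ}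

/-- A relation between `x_1` and `x_2` modulo a model ideal holds for all elements `τ`, `ω` of an
algebra that satisfy the defining relations. -/
theorem aeval_add_eq_zero_of_mem_modelIdeal {E : Type*} [CommRing E] [Algebra k E] {τ ω : E}
    {Z F G : k[X]} (hτ : τ ^ (s + 1) = 0) (hτω : τ ^ t * ω = 0)
    (hω : ω ^ 2 = τ ^ (p + 1) * ω + aeval τ Z * τ ^ (s - t + 1))
    (hmem : aeval (x₁ le_rfl : MvPowerSeries (Fin 2) k) F +
      aeval (x₁ le_rfl : MvPowerSeries (Fin 2) k) G * x₂ le_rfl ∈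
        modelIdeal le_rfl s t p (aeval (x₁ le_rfl : MvPowerSeries (Fin 2) k) Z)) :
    aeval τ F + aeval τ G * ω = 0 := by
  have hn : IsNilpotent τ := ⟨_, hτ⟩
  have hn' : IsNilpotent ω := by
    have h1 : IsNilpotent (ω ^ 2) := by
      have e : ω ^ 2 = τ * (τ ^ p * ω + aeval τ Z * τ ^ (s - t)) := by
        rw [hω]; ring
      rw [e]
      exact (Commute.all _ _).isNilpotent_mul_right hn
    obtain ⟨m, hm⟩ := h1
    exact ⟨2 * m, by rw [pow_mul]; exact hm⟩
  obtain ⟨g, hg⟩ := exists_algHom_of_isNilpotent (k := k) (h := 2) ![τ, ω] (by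
    intro i
    fin_cases i
    · exact hn
    · exact hn')
  have hg0 : g (x₁ le_rfl) = τ := hg 0
  have hg1 : g (x₂ le_rfl) = ω := hg 1
  have hle : modelIdeal le_rfl s t p (aeval (x₁ le_rfl : MvPowerSeries (Fin 2) k) Z) ≤
      RingHom.ker g := by
    rw [modelIdeal_le_ker_iff (d := 0) rfl, ← aeval_algHom_apply, hg0]
    refine ⟨fun j => j.elim0, fun j => j.elim0, fun j => j.elim0, fun j => j.elim0, ?_, ?_⟩
    · rw [hg0, hg1]; exact hω
    · rw [hg0, hg1]; exact hτω
  have h0 := hle hmem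
  rwa [RingHom.mem_ker, map_add, map_mul, ← aeval_algHom_apply, ← aeval_algHom_apply, hg0,
    hg1] at h0

/-- In the ring `B[ω]` with `ω ^ 2 = a + b ω` and `c a = 0`, the multiples of `c ω` have coordinates
in `0` and `c B`. -/
theorem quadraticAlgebra_mem_span_singleton {B : Type*} [CommRing B] {a b c : B} (hc : c * a = 0)
    {v : QuadraticAlgebra B a b} (hv : v ∈ Ideal.span {(⟨0, c⟩ : QuadraticAlgebra B a b)}) :
    v.re = 0 ∧ ∃ d, v.im = c * d := by
  obtain ⟨d, rfl⟩ := Ideal.mem_span_singleton.mp hv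
  refine ⟨?_, d.re + b * d.im, ?_⟩
  · simp only [QuadraticAlgebra.re_mul]
    linear_combination d.im * hc
  · simp only [QuadraticAlgebra.im_mul]
    ring

/-- The relations are tested in the quotient of `B[ω]`, where
`ω ^ 2 = τ ^ (p + 1) ω + Z(τ) τ ^ (s - t + 1)`, by the ideal of `τ ^ t ω`. -/
theorem aeval_eq_zero_of_mem_modelIdeal (hts : t ≤ s) {B : Type*} [CommRing B] [Algebra k B]
    {τ : B} (hτ : τ ^ (s + 1) = 0) {Z F G : k[X]}
    (hmem : aeval (x₁ le_rfl : MvPowerSeries (Fin 2) k) F +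
      aeval (x₁ le_rfl : MvPowerSeries (Fin 2) k) G * x₂ le_rfl ∈
        modelIdeal le_rfl s t p (aeval (x₁ le_rfl : MvPowerSeries (Fin 2) k) Z)) :
    aeval τ F = 0 ∧ ∃ b, aeval τ G = τ ^ t * b := by
  obtain ⟨a, ha⟩ : ∃ a, a = aeval τ Z * τ ^ (s - t + 1) := ⟨_, rfl⟩
  obtain ⟨b, hb⟩ : ∃ b, b = τ ^ (p + 1) := ⟨_, rfl⟩
  have hta : τ ^ t * a = 0 := by
    have e : τ ^ t * τ ^ (s - t + 1) = 0 := by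
      rw [← pow_add, show t + (s - t + 1) = s + 1 by omega, hτ]
    rw [ha]
    linear_combination aeval τ Z * e
  let J : Ideal (QuadraticAlgebra B a b) := Ideal.span {⟨0, τ ^ t⟩}
  let ι : B →ₐ[k] QuadraticAlgebra B a b := (Algebra.ofId B _).restrictScalars k
  have hι : ∀ c, ι c = ⟨c, 0⟩ := fun c => rfl
  have hιω : ∀ c d, ι c + ι d * ⟨0, 1⟩ = ⟨c, d⟩ := by
    intro c d
    rw [hι, hι]
    ext <;> simp
  let ρ : QuadraticAlgebra B a b →ₐ[k] QuadraticAlgebra B a b ⧸ J := Ideal.Quotient.mkₐ k J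
  have hρ : ∀ v, ρ v = 0 ↔ v ∈ J := fun v => Ideal.Quotient.eq_zero_iff_mem
  have hpoly : ∀ P : k[X], aeval (ρ (ι τ)) P = ρ (ι (aeval τ P)) := fun P => by
    rw [aeval_algHom_apply, aeval_algHom_apply]
  have key := aeval_add_eq_zero_of_mem_modelIdeal (τ := ρ (ι τ)) (ω := ρ ⟨0, 1⟩) (s := s) (t := t)
    (by rw [← map_pow, ← map_pow, hτ, map_zero, map_zero]) (by
      rw [← map_pow, ← map_pow, ← map_mul, hρ]
      have := hιω 0 (τ ^ t)
      rw [map_zero, zero_add] at this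
      rw [this]
      exact Ideal.mem_span_singleton_self _) (by
      rw [hpoly, ← map_pow, ← map_pow, ← map_pow, ← map_pow, ← map_pow, ← map_mul, ← map_mul,
        ← map_mul, ← ha, ← hb, ← map_add, add_comm, hιω, pow_two]
      congr 1
      ext <;> simp) hmem
  rw [hpoly, hpoly, ← map_mul, ← map_add, hιω, hρ] at key
  exact quadraticAlgebra_mem_span_singleton hta key

/-- In the quotient by a model ideal in two variables, the elements `x_1 ^ i` with `i ≤ s` and
`x_1 ^ i x_2` with `i < t` are linearly independent: they remain so in the ring
`B[ω] / (T ^ t ω)`, `B = k[T] / (T ^ (s + 1))`, `ω ^ 2 = T ^ (p + 1) ω + Z T ^ (s - t + 1)`. -/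
theorem X_pow_dvd_of_mem_modelIdeal (hts : t ≤ s) {Z F G : k[X]}
    (hmem : aeval (x₁ le_rfl : MvPowerSeries (Fin 2) k) F +
      aeval (x₁ le_rfl : MvPowerSeries (Fin 2) k) G * x₂ le_rfl ∈
        modelIdeal le_rfl s t p (aeval (x₁ le_rfl : MvPowerSeries (Fin 2) k) Z)) :
    X ^ (s + 1) ∣ F ∧ X ^ t ∣ G := by
  let π : k[X] →ₐ[k] TruncPoly k (s + 1) := Ideal.Quotient.mkₐ k _
  have hπ : ∀ P, π P = 0 ↔ X ^ (s + 1) ∣ P := fun P =>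
    Ideal.Quotient.eq_zero_iff_mem.trans Ideal.mem_span_singleton
  have hpoly : ∀ P : k[X], aeval (π X) P = π P := fun P => by
    rw [aeval_algHom_apply, aeval_X_left_apply]
  obtain ⟨h1, b, h2⟩ := aeval_eq_zero_of_mem_modelIdeal hts (τ := π X)
    (by rw [← map_pow, hπ]) hmem
  rw [hpoly, hπ] at h1
  obtain ⟨b, rfl⟩ := Ideal.Quotient.mkₐ_surjective k _ b
  refine ⟨h1, ?_⟩
  have h3 : π (G - X ^ t * b) = 0 := by
    rw [map_sub, map_mul, sub_eq_zero, map_pow, ← hpoly G]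
    exact h2
  rw [hπ] at h3
  exact (dvd_sub_left (Dvd.intro _ rfl)).mp ((pow_dvd_pow X (by omega)).trans h3)

/-- `A` is the quotient by a model ideal in two variables, with `x` and `y` the images of the
variables: the elements `x ^ i` with `i ≤ s` and `x ^ i y` with `i < t` form a basis of `A`. -/
structure IsPlaneModel (k : Type*) [Field k] {A : Type*} [CommRing A] [IsLocalRing A] [Algebra k A]
    (s t p : ℕ) (Z : k[X]) (x y : A) : Prop where
  x_mem : x ∈ maximalIdeal A
  y_mem : y ∈ maximalIdeal A
  exists_eq : ∀ a : A, ∃ F G : k[X], a = aeval x F + aeval x G * y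
  dvd : ∀ F G : k[X], aeval x F + aeval x G * y = 0 → X ^ (s + 1) ∣ F ∧ X ^ t ∣ G
  y_sq : y ^ 2 = x ^ (p + 1) * y + aeval x Z * x ^ (s - t + 1)
  x_pow_y : x ^ t * y = 0
  x_pow : x ^ (s + 1) = 0

namespace IsPlaneModel

variable {A : Type*} [CommRing A] [IsLocalRing A] [Algebra k A] {Z : k[X]} {x y : A}

theorem residue (M : IsPlaneModel k s t p Z x y) (a : A) :
    ∃ c : k, a - algebraMap k A c ∈ maximalIdeal A := by
  obtain ⟨F, G, rfl⟩ := M.exists_eq a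
  refine ⟨F.coeff 0, ?_⟩
  have e : aeval x F + aeval x G * y - algebraMap k A (F.coeff 0) =
      aeval x F.divX * x + aeval x G * y := by
    rw [aeval_eq_add_divX x F]; ring
  rw [e]
  exact Ideal.add_mem _ (Ideal.mul_mem_left _ _ M.x_mem) (Ideal.mul_mem_left _ _ M.y_mem)

/-- The `j`-th power of the maximal ideal is spanned by `x ^ i` with `i ≥ j` and `x ^ i y` with
`i ≥ j - 1`. For `j = 0` the truncated difference `j - 1 = 0` gives the right answer. -/
theorem mem_pow_iff (M : IsPlaneModel k s t p Z x y) (hts : t < s) (j : ℕ) {a : A} :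
    a ∈ maximalIdeal A ^ j ↔
      ∃ F G : k[X], a = aeval x F * x ^ j + aeval x G * (x ^ (j - 1) * y) := by
  constructor
  · induction j generalizing a with
    | zero =>
      intro _
      obtain ⟨F, G, rfl⟩ := M.exists_eq a
      exact ⟨F, G, by simp⟩
    | succ j ih =>
      intro ha
      rw [pow_succ'] at ha
      induction ha using Submodule.mul_induction_on' with
      | mem_mul_mem b hb c hc =>
        obtain ⟨F, G, rfl⟩ := M.exists_eq b
        have hF : F.coeff 0 = 0 :=
          coeff_zero_eq_zero_of_add_mem M.x_mem (Ideal.mul_mem_left _ _ M.y_mem) hb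
        obtain ⟨F', G', rfl⟩ := ih hc
        rw [aeval_eq_add_divX x F, hF, map_zero, zero_add]
        rcases j with _ | j
        · refine ⟨F.divX * F' + G * G' * Z * X ^ (s - t),
            F.divX * G' * X + G * F' + G * G' * X ^ (p + 1), ?_⟩
          simp only [map_add, map_mul, map_pow, aeval_X, pow_zero, zero_add, Nat.sub_self,
            Nat.zero_sub]
          linear_combination aeval x G * aeval x G' * M.y_sq
        · obtain ⟨n, hn⟩ : ∃ n, s - t = n + 1 := ⟨s - t - 1, by omega⟩
          have hy := M.y_sq
          rw [hn] at hy
          refine ⟨F.divX * F' + G * G' * Z * X ^ n,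
            F.divX * G' + G * F' + G * G' * X ^ p, ?_⟩
          simp only [map_add, map_mul, map_pow, aeval_X, Nat.add_sub_cancel]
          linear_combination aeval x G * aeval x G' * x ^ j * hy
      | add b _ c _ hb hc =>
        obtain ⟨F, G, rfl⟩ := hb
        obtain ⟨F', G', rfl⟩ := hc
        exact ⟨F + F', G + G', by simp only [map_add]; ring⟩
  · rintro ⟨F, G, rfl⟩
    refine Ideal.add_mem _ (Ideal.mul_mem_left _ _ (Ideal.pow_mem_pow M.x_mem j))
      (Ideal.mul_mem_left _ _ ?_)
    rcases j with _ | j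
    · simp
    · rw [Nat.add_sub_cancel, pow_succ]
      exact Ideal.mul_mem_mul (Ideal.pow_mem_pow M.x_mem j) M.y_mem

theorem finrank_pow (M : IsPlaneModel k s t p Z x y) (hts : t < s) (j : ℕ) :
    Module.finrank k ↥(maximalIdeal A ^ j) = (s + 1 - j) + (t - (j - 1)) := by
  let φ : degreeLT k (s + 1 - j) × degreeLT k (t - (j - 1)) →ₗ[k] A :=
    LinearMap.coprod
      (LinearMap.mulRight k (x ^ j) ∘ₗ (aeval x).toLinearMap ∘ₗ (degreeLT k _).subtype)
      (LinearMap.mulRight k (x ^ (j - 1) * y) ∘ₗ (aeval x).toLinearMap ∘ₗ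
        (degreeLT k _).subtype)
  have hφ : ∀ q, φ q =
      aeval x (q.1 : k[X]) * x ^ j + aeval x (q.2 : k[X]) * (x ^ (j - 1) * y) := fun q => rfl
  have hinj : Function.Injective φ := by
    rw [← LinearMap.ker_eq_bot, LinearMap.ker_eq_bot']
    rintro ⟨⟨F, hF⟩, ⟨G, hG⟩⟩ h0
    rw [hφ] at h0
    obtain ⟨h1, h2⟩ := M.dvd (F * X ^ j) (G * X ^ (j - 1)) (by
      simp only [map_mul, map_pow, aeval_X]
      linear_combination h0)
    have key : ∀ {m n l : ℕ} {P : k[X]}, P ∈ degreeLT k m → m = n - l → X ^ n ∣ P * X ^ l →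
        P = 0 := by
      intro m n l P hP hm hdvd
      refine eq_zero_of_mem_degreeLT_of_dvd hP ?_
      have hdvd' : X ^ (m + l) ∣ P * X ^ l := by
        rcases le_total l n with hle | hle
        · rwa [show m + l = n by omega]
        · rw [hm, Nat.sub_eq_zero_of_le hle, zero_add]
          exact Dvd.intro_left _ rfl
      rwa [pow_add, mul_dvd_mul_iff_right (pow_ne_zero _ X_ne_zero)] at hdvd'
    obtain rfl := key hF rfl h1
    obtain rfl := key hG rfl h2
    rfl
  have hrange : LinearMap.range φ = (maximalIdeal A ^ j).restrictScalars k := by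
    ext a
    rw [Submodule.restrictScalars_mem, M.mem_pow_iff hts, LinearMap.mem_range]
    constructor
    · rintro ⟨⟨F, G⟩, rfl⟩
      exact ⟨F, G, hφ _⟩
    · rintro ⟨F, G, rfl⟩
      refine ⟨(⟨F %ₘ X ^ (s + 1 - j), modByMonic_X_pow_mem_degreeLT _ _⟩,
        ⟨G %ₘ X ^ (t - (j - 1)), modByMonic_X_pow_mem_degreeLT _ _⟩), ?_⟩
      rw [hφ]
      simp only
      rw [aeval_modByMonic_X_pow, aeval_modByMonic_X_pow]
      · rw [← mul_assoc, ← pow_add, show t - (j - 1) + (j - 1) = t + ((j - 1) - t) by omega,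
          pow_add]
        linear_combination x ^ (j - 1 - t) * M.x_pow_y
      · rw [← pow_add]
        exact pow_eq_zero_of_le (by omega) M.x_pow
  have h1 := LinearMap.finrank_range_of_inj hinj
  rw [hrange, Module.finrank_prod, finrank_degreeLT, finrank_degreeLT] at h1
  exact h1

theorem moduleFinite (M : IsPlaneModel k s t p Z x y) (hts : t < s) : Module.Finite k A := by
  refine Module.finite_of_finrank_pos ?_
  have h1 := M.finrank_pow hts 0
  rw [pow_zero, Ideal.one_eq_top] at h1
  have h2 : Module.finrank k A = Module.finrank k ↥(⊤ : Ideal A) := (finrank_top k A).symm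
  omega

theorem isArtinianRing (M : IsPlaneModel k s t p Z x y) (hts : t < s) : IsArtinianRing A :=
  have _ := M.moduleFinite hts
  IsArtinianRing.of_finite k A

theorem hasType (M : IsPlaneModel k s t p Z x y) (ht : 2 ≤ t) (hts : t < s) :
    HasType A 2 s t := by
  have hfin := M.moduleFinite hts
  have key : ∀ j, hilbertFn A j + ((s + 1 - (j + 1)) + (t - (j + 1 - 1))) =
      (s + 1 - j) + (t - (j - 1)) := by
    intro j
    rw [← M.finrank_pow hts, ← M.finrank_pow hts]
    exact hilbertFn_add_finrank M.residue j
  refine ⟨?_, ?_, fun j hj hj' => ?_, fun j hj hj' => ?_, fun j hj => ?_⟩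
  · have := key 0; omega
  · have := key 1; omega
  · have := key j; omega
  · have := key j; omega
  · have := key j; omega

theorem isAlmostStretched (M : IsPlaneModel k s t p Z x y) (ht : 2 ≤ t) (hts : t < s) :
    IsAlmostStretched A := by
  have hart := M.isArtinianRing hts
  refine ⟨hart, ?_⟩
  rw [IsLocalRing.spanFinrank_eq_finrank_quotient _ (IsNoetherian.noetherian _)]
  exact (M.hasType ht hts).2.2.1 2 le_rfl ht

/-- The socle is spanned by `x ^ s`. -/
theorem isArtinGorenstein (M : IsPlaneModel k s t p Z x y) (hZ : Z.coeff 0 ≠ 0) (ht : 1 ≤ t)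
    (hts : t < s) : IsArtinGorenstein A := by
  refine ⟨M.isArtinianRing hts, ?_⟩
  have hxs : x ^ s ≠ 0 := by
    intro h0
    have h1 := (M.dvd (X ^ s) 0 (by simpa using h0)).1
    rw [pow_dvd_pow_iff X_ne_zero not_isUnit_X] at h1
    omega
  have hsy : x ^ s * y = 0 := by
    rw [show s = (s - t) + t by omega, pow_add, mul_assoc, M.x_pow_y, mul_zero]
  have hmem : x ^ s ∈ Module.annihilator A ↥(maximalIdeal A) := by
    rw [Module.mem_annihilator]
    rintro ⟨b, hb⟩
    ext
    rw [← pow_one (maximalIdeal A), M.mem_pow_iff hts] at hb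
    obtain ⟨F, G, rfl⟩ := hb
    have h1 := M.x_pow
    simp only [SetLike.mk_smul_mk, smul_eq_mul, ZeroMemClass.coe_zero, pow_one, Nat.sub_self,
      pow_zero, one_mul]
    linear_combination aeval x F * h1 + aeval x G * hsy
  have hsocle : ∀ a ∈ Module.annihilator A ↥(maximalIdeal A), ∃ c : k, a = c • x ^ s := by
    intro a ha
    rw [Module.mem_annihilator] at ha
    have hax : a * x = 0 := congrArg Subtype.val (ha ⟨x, M.x_mem⟩)
    have hay : a * y = 0 := congrArg Subtype.val (ha ⟨y, M.y_mem⟩)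
    obtain ⟨F, G, rfl⟩ := M.exists_eq a
    obtain ⟨h1, h2⟩ := M.dvd (F * X) (G * X) (by
      simp only [map_mul, aeval_X]
      linear_combination hax)
    rw [pow_succ, mul_dvd_mul_iff_right X_ne_zero] at h1
    obtain ⟨m, rfl⟩ : ∃ m, t = m + 1 := ⟨t - 1, by omega⟩
    rw [pow_succ, mul_dvd_mul_iff_right X_ne_zero] at h2
    obtain ⟨F, rfl⟩ := h1
    obtain ⟨G, rfl⟩ := h2
    have e : (m + (s - (m + 1) + 1)) = s := by omega
    have h3 : x ^ s * (aeval x G * aeval x Z) = 0 := by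
      simp only [map_mul, map_pow, aeval_X] at hay
      rw [← e, pow_add]
      linear_combination hay - aeval x F * hsy - x ^ m * aeval x G * M.y_sq -
        aeval x G * x ^ p * M.x_pow_y
    have h4 := (M.dvd (X ^ s * (G * Z)) 0 (by simpa using h3)).1
    rw [pow_succ, mul_dvd_mul_iff_left (pow_ne_zero _ X_ne_zero), X_dvd_iff, mul_coeff_zero] at h4
    have hG : G.coeff 0 = 0 := (mul_eq_zero.mp h4).resolve_right hZ
    refine ⟨F.coeff 0, ?_⟩
    simp only [map_mul, map_pow, aeval_X]
    rw [aeval_eq_add_divX x F, aeval_eq_add_divX x G, hG, map_zero, Algebra.smul_def]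
    linear_combination aeval x F.divX * M.x_pow + aeval x G.divX * M.x_pow_y
  rw [isSimpleModule_iff_toSpanSingleton_surjective]
  refine ⟨⟨⟨⟨x ^ s, hmem⟩, 0, fun h => hxs (congrArg Subtype.val h)⟩⟩, ?_⟩
  rintro ⟨a, ha⟩ hne ⟨b, hb⟩
  obtain ⟨c, rfl⟩ := hsocle a ha
  obtain ⟨c', rfl⟩ := hsocle b hb
  have hc : c ≠ 0 := by
    rintro rfl
    exact hne (Subtype.ext (zero_smul k _))
  refine ⟨algebraMap k A (c' * c⁻¹), Subtype.ext ?_⟩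
  change algebraMap k A (c' * c⁻¹) * (c • x ^ s) = c' • x ^ s
  rw [← Algebra.smul_def, smul_smul, inv_mul_cancel_right₀ hc]

end IsPlaneModel

end PlaneModel

section Length

/-- The Hilbert function is the sequence of differences of the lengths of the powers of the maximal
ideal. -/
theorem length_pow_eq_add {A : Type*} [CommRing A] [IsLocalRing A] [IsArtinianRing A] (j : ℕ) :
    Module.length A ↥(maximalIdeal A ^ j) =
      Module.length A ↥(maximalIdeal A ^ (j + 1)) + hilbertFn A j := by
  set N : Submodule A ↥(maximalIdeal A ^ j) := maximalIdeal A • ⊤ with hN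
  have hmap : N.map (maximalIdeal A ^ j).subtype = maximalIdeal A ^ (j + 1) := by
    rw [hN, Submodule.map_smul'', Submodule.map_top, Submodule.range_subtype, pow_succ',
      smul_eq_mul]
  have h1 : Module.length A ↥(maximalIdeal A ^ (j + 1)) = Module.length A ↥N := by
    rw [← hmap]
    exact (Submodule.equivMapOfInjective _ (Submodule.subtype_injective _) N).length_eq.symm
  have h2 : Module.length A (↥(maximalIdeal A ^ j) ⧸ N) = hilbertFn A j := by
    let _ : Field (A ⧸ maximalIdeal A) := Ideal.Quotient.field _
    rw [Module.length_eq_of_surjective (R := A ⧸ maximalIdeal A) Ideal.Quotient.mk_surjective]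
    exact Module.length_eq_finrank _ _
  rw [h1, ← h2]
  exact Module.length_eq_add_of_exact N.subtype N.mkQ (Submodule.subtype_injective _)
    (Submodule.mkQ_surjective _) (LinearMap.exact_subtype_mkQ N)

end Length

/-! ### Complete intersections in two variables -/

section PlaneCurves

variable {k : Type*} [Field k] {s t p : ℕ}

theorem mvPowerSeries_X_ne_zero {σ : Type*} (i : σ) :
    (MvPowerSeries.X i : MvPowerSeries σ k) ≠ 0 := by
  classical
  intro h
  have h1 := congrArg (MvPowerSeries.coeff (Finsupp.single i 1)) h
  rw [MvPowerSeries.coeff_index_single_self_X, map_zero] at h1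
  exact one_ne_zero h1

theorem X_dvd_of_dvd_X_pow_mul {σ : Type*} {i j : σ} (hij : i ≠ j) {n : ℕ}
    {b : MvPowerSeries σ k} (h : MvPowerSeries.X i ∣ MvPowerSeries.X j ^ n * b) :
    MvPowerSeries.X i ∣ b := by
  classical
  rw [MvPowerSeries.X_dvd_iff] at h ⊢
  intro m hm
  have h1 := h (Finsupp.single j n + m) (by simp [hm, hij.symm])
  rwa [MvPowerSeries.X_pow_eq, MvPowerSeries.coeff_add_monomial_mul, one_mul] at h1

/-- In two variables only the last two generators remain. -/
theorem modelIdeal_two (z : MvPowerSeries (Fin 2) k) :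
    modelIdeal le_rfl s t p z = Ideal.span
      {x₂ le_rfl ^ 2 - x₁ le_rfl ^ (p + 1) * x₂ le_rfl - z * x₁ le_rfl ^ (s - t + 1),
        x₁ le_rfl ^ t * x₂ le_rfl} := by
  have h1 : ∀ i j : Fin 2, i < j → i.val = 0 ∧ j.val = 1 := by decide
  have e1 : {f : MvPowerSeries (Fin 2) k | ∃ i j : Fin 2, i < j ∧ ¬ (i.val = 0 ∧ j.val = 1) ∧
      f = MvPowerSeries.X i * MvPowerSeries.X j} = ∅ := by
    ext f
    simp only [Set.mem_ofPred_eq, Set.mem_empty_iff_false, iff_false]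
    rintro ⟨i, j, hij, hn, -⟩
    exact hn (h1 i j hij)
  have e2 : {f : MvPowerSeries (Fin 2) k | ∃ j : Fin 2, 2 ≤ j.val ∧
      f = MvPowerSeries.X j ^ 2 - x₁ le_rfl ^ s} = ∅ := by
    ext f
    simp only [Set.mem_ofPred_eq, Set.mem_empty_iff_false, iff_false]
    rintro ⟨j, hj, -⟩
    omega
  rw [modelIdeal, e1, e2, Set.empty_union, Set.empty_union]

/-- The two generators have no common factor: the first is divisible neither by `x_1` nor by
`x_2`. -/
theorem isCodimTwoCompleteIntersection_modelIdeal {z : MvPowerSeries (Fin 2) k} (hz : IsUnit z) :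
    IsCodimTwoCompleteIntersection (modelIdeal le_rfl s t p z) := by
  set x : MvPowerSeries (Fin 2) k := x₁ le_rfl with hx
  set y : MvPowerSeries (Fin 2) k := x₂ le_rfl with hy
  set f := y ^ 2 - x ^ (p + 1) * y - z * x ^ (s - t + 1) with hf
  have hx0 : x ≠ 0 := mvPowerSeries_X_ne_zero _
  have hy0 : y ≠ 0 := mvPowerSeries_X_ne_zero _
  have hxm : x ∈ maximalIdeal (MvPowerSeries (Fin 2) k) := by
    rw [mem_maximalIdeal, mem_nonunits_iff, MvPowerSeries.isUnit_iff_constantCoeff]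
    simp [hx, x₁]
  have hym : y ∈ maximalIdeal (MvPowerSeries (Fin 2) k) := by
    rw [mem_maximalIdeal, mem_nonunits_iff, MvPowerSeries.isUnit_iff_constantCoeff]
    simp [hy, x₂]
  have hxb : ∀ b, x ∣ f * b → x ∣ b := by
    intro b hb
    refine X_dvd_of_dvd_X_pow_mul (j := (⟨1, by omega⟩ : Fin 2)) (n := 2) (by simp) ?_
    change x ∣ y ^ 2 * b
    have e : y ^ 2 * b = f * b + x * (x ^ p * y + z * x ^ (s - t)) * b := by
      rw [hf]; ring
    rw [e]
    exact dvd_add hb (Dvd.dvd.mul_right (Dvd.intro _ rfl) _)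
  have hyb : ∀ b, y ∣ f * b → y ∣ b := by
    intro b hb
    refine X_dvd_of_dvd_X_pow_mul (j := (⟨0, by omega⟩ : Fin 2)) (n := s - t + 1) (by simp) ?_
    change y ∣ x ^ (s - t + 1) * b
    rw [← hz.dvd_mul_left]
    have e : z * (x ^ (s - t + 1) * b) = y * ((y - x ^ (p + 1)) * b) - f * b := by
      rw [hf]; ring
    rw [e]
    exact dvd_sub (Dvd.intro _ rfl) hb
  have hxpow : ∀ (n : ℕ) (a : MvPowerSeries (Fin 2) k), f ∣ x ^ n * a → f ∣ a := by
    intro n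
    induction n with
    | zero => intro a ha; simpa using ha
    | succ n ih =>
      rintro a ⟨b, hb⟩
      obtain ⟨b, rfl⟩ := hxb b ⟨x ^ n * a, by rw [← hb]; ring⟩
      exact ih a ⟨b, mul_left_cancel₀ hx0 (by linear_combination hb)⟩
  have hf0 : f ≠ 0 := by
    intro h0
    obtain ⟨b, hb⟩ := hxb 1 (by rw [h0, zero_mul]; exact dvd_zero _)
    exact hxm (IsUnit.of_mul_eq_one b hb.symm)
  refine ⟨f, x ^ t * y, ?_, modelIdeal_two z⟩
  have hfm : f ∈ maximalIdeal (MvPowerSeries (Fin 2) k) := by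
    rw [hf, pow_two, pow_succ x (s - t)]
    exact Ideal.sub_mem _ (Ideal.sub_mem _ (Ideal.mul_mem_left _ _ hym)
      (Ideal.mul_mem_left _ _ hym)) (Ideal.mul_mem_left _ _ (Ideal.mul_mem_left _ _ hxm))
  rw [IsLocalRing.isRegular_iff_isWeaklyRegular_of_subset_maximalIdeal (by
    intro r hr
    simp only [List.mem_cons, List.not_mem_nil, or_false] at hr
    rcases hr with rfl | rfl
    · exact hfm
    · exact Ideal.mul_mem_left _ _ hym)]
  rw [RingTheory.Sequence.isWeaklyRegular_cons_iff,
    RingTheory.Sequence.isWeaklyRegular_singleton_iff]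
  refine ⟨fun a b hab => mul_left_cancel₀ hf0 hab, ?_⟩
  have hmem : ∀ a : MvPowerSeries (Fin 2) k,
      a ∈ f • (⊤ : Submodule (MvPowerSeries (Fin 2) k) (MvPowerSeries (Fin 2) k)) ↔ f ∣ a := by
    intro a
    rw [Submodule.mem_smul_pointwise_iff_exists]
    exact ⟨fun ⟨b, _, hb⟩ => ⟨b, hb.symm⟩, fun ⟨b, hb⟩ => ⟨b, trivial, hb.symm⟩⟩
  rw [isSMulRegular_iff_right_eq_zero_of_smul]
  intro a ha
  obtain ⟨a, rfl⟩ := Submodule.Quotient.mk_surjective _ a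
  rw [← Submodule.Quotient.mk_smul, Submodule.Quotient.mk_eq_zero, hmem, smul_eq_mul,
    mul_assoc] at ha
  rw [Submodule.Quotient.mk_eq_zero, hmem]
  obtain ⟨b, hb⟩ := hxpow _ _ ha
  obtain ⟨b, rfl⟩ := hyb b ⟨a, hb.symm⟩
  exact ⟨b, mul_left_cancel₀ hy0 (by linear_combination hb)⟩

theorem exists_isPlaneModel {Z : k[X]} (hZ : Z.coeff 0 ≠ 0) (ht : 0 < t) (hts : t < s) :
    ∃ (_ : IsLocalRing (MvPowerSeries (Fin 2) k ⧸
        modelIdeal le_rfl s t p (aeval (x₁ le_rfl : MvPowerSeries (Fin 2) k) Z)))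
      (x y : MvPowerSeries (Fin 2) k ⧸
        modelIdeal le_rfl s t p (aeval (x₁ le_rfl : MvPowerSeries (Fin 2) k) Z)),
      IsPlaneModel k s t p Z x y := by
  set J := modelIdeal le_rfl s t p (aeval (x₁ le_rfl : MvPowerSeries (Fin 2) k) Z) with hJ
  have hdvd : ∀ F G : k[X], aeval (x₁ le_rfl : MvPowerSeries (Fin 2) k) F +
      aeval (x₁ le_rfl : MvPowerSeries (Fin 2) k) G * x₂ le_rfl ∈ J →
        X ^ (s + 1) ∣ F ∧ X ^ t ∣ G := fun F G hmem => X_pow_dvd_of_mem_modelIdeal hts.le hmem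
  have hnt : Nontrivial (MvPowerSeries (Fin 2) k ⧸ J) := by
    rw [Ideal.Quotient.nontrivial_iff, Ideal.ne_top_iff_one]
    intro h1
    have h2 := (hdvd 1 0 (by simpa using h1)).1
    exact not_isUnit_X (isUnit_of_dvd_one ((dvd_pow_self X (by omega)).trans h2))
  have hloc : IsLocalRing (MvPowerSeries (Fin 2) k ⧸ J) :=
    IsLocalRing.of_surjective' (Ideal.Quotient.mk J) Ideal.Quotient.mk_surjective
  let f := Ideal.Quotient.mkₐ k J
  have hfs : Function.Surjective f := Ideal.Quotient.mkₐ_surjective k J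
  have hR : ModelRel (d := 0) le_rfl rfl s t p (aeval (f (x₁ le_rfl)) Z) f := by
    refine modelRel_of_ker_eq rfl ?_
    exact Ideal.Quotient.mkₐ_ker k J
  have hζ : IsUnit (aeval (f (x₁ le_rfl)) Z) := by
    rw [aeval_algHom_apply]
    exact (isUnit_aeval_x₁ hZ).map f
  refine ⟨hloc, f (x₁ le_rfl), f (x₂ le_rfl), hR.apply_X_mem hZ (by omega) hts.le _,
    hR.apply_X_mem hZ (by omega) hts.le _, fun a => ?_, fun F G h0 => ?_, hR.y_sq, hR.x_pow_y,
    hR.x_pow_eq_zero hζ hts.le⟩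
  · obtain ⟨F, G, ⟨v, hv⟩, rfl⟩ := hR.exists_eq hZ (by omega) hts.le hfs a
    rw [Set.range_eq_empty, Submodule.span_empty, Submodule.mem_bot] at hv
    exact ⟨F, G, by simp [hv]⟩
  · rw [aeval_algHom_apply, aeval_algHom_apply, ← map_mul, ← map_add] at h0
    exact hdvd F G (Ideal.Quotient.eq_zero_iff_mem.mp h0)

theorem isAlmostStretchedGorenstein_modelIdeal {Z : k[X]} (hZ : Z.coeff 0 ≠ 0) (ht : 2 ≤ t)
    (hts : t < s) :
    IsAlmostStretchedGorenstein (MvPowerSeries (Fin 2) k ⧸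
      modelIdeal le_rfl s t p (aeval (x₁ le_rfl : MvPowerSeries (Fin 2) k) Z)) 2 s t := by
  obtain ⟨hloc, x, y, M⟩ := exists_isPlaneModel (p := p) hZ (by omega) hts
  exact ⟨hloc, M.isAlmostStretched ht hts, M.isArtinGorenstein hZ (by omega) hts,
    M.hasType ht hts⟩

/-- The length of an algebra of type `(6, 3)` with embedding dimension two is
`1 + 2 + 2 + 2 + 1 + 1 + 1`. -/
theorem length_eq_ten {A : Type*} [CommRing A]
    (hA : IsAlmostStretchedGorenstein A 2 6 3) : Module.length A A = 10 := by
  obtain ⟨hloc, ⟨hart, -⟩, -, h0, h1, h2, h3, h4⟩ := hA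
  have hbot : maximalIdeal A ^ 7 = ⊥ := by
    refine Submodule.eq_bot_of_le_smul_of_le_jacobson_bot (maximalIdeal A) _
      (IsNoetherian.noetherian _) ?_ ?_
    · have h5 := length_pow_eq_add (A := A) 7
      rw [h4 7 (by omega), Nat.cast_zero, add_zero] at h5
      by_contra hle
      have hlt : maximalIdeal A ^ (7 + 1) < maximalIdeal A ^ 7 := by
        refine lt_of_le_of_ne (Ideal.pow_le_pow_right (by omega)) fun he => hle ?_
        rw [smul_eq_mul, ← pow_succ', he]
      have h6 := Submodule.height_strictMono hlt
      rw [← Module.length_submodule, ← Module.length_submodule, h5] at h6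
      exact lt_irrefl _ h6
    · exact (IsLocalRing.jacobson_eq_maximalIdeal ⊥ bot_ne_top).ge
  have hl := fun j => length_pow_eq_add (A := A) j
  have e7 : Module.length A ↥(maximalIdeal A ^ 7) = 0 := by
    rw [hbot]; exact Module.length_bot
  have e0 : Module.length A ↥(maximalIdeal A ^ 0) = Module.length A A := by
    rw [pow_zero, Ideal.one_eq_top]; exact Module.length_top
  rw [← e0, hl 0, hl 1, hl 2, hl 3, hl 4, hl 5, hl 6, e7, h0, h1, h2 2 (by omega) (by omega),
    h2 3 (by omega) (by omega), h3 4 (by omega) (by omega), h3 5 (by omega) (by omega),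
    h3 6 (by omega) (by omega)]
  norm_num

theorem aeval_x₁_C {h : ℕ} (hh : 2 ≤ h) (c : k) :
    aeval (x₁ hh : MvPowerSeries (Fin h) k) (C c) = MvPowerSeries.C c :=
  aeval_C _ c

end PlaneCurves

end AlmostStretched

theorem theorem4p3 (k : Type*) [Field k] [IsAlgClosed k] [CharZero k] :
    -- the classification
    (∀ (h s t : ℕ) (hh : 2 ≤ h), 2 ≤ t → 2 * t ≤ s →
      ∀ I : Ideal (MvPowerSeries (Fin h) k),
        AlmostStretched.IsAlmostStretchedGorenstein (MvPowerSeries (Fin h) k ⧸ I) h s t →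
        (AlmostStretched.RegularPair s t →
          ∃! q : ℕ × MvPowerSeries (Fin h) k,
            q ∈ AlmostStretched.regularParams k h t ∧
              AlmostStretched.IdealIso I (AlmostStretched.modelIdeal hh s t q.1 q.2)) ∧
        (∀ r : ℕ, r + 2 ≤ t → 2 * (r + 1) + t = s + 1 →
          ∃! q : ℕ × MvPowerSeries (Fin h) k,
            q ∈ AlmostStretched.nonregularParams k hh t r ∧
              AlmostStretched.IdealIso I (AlmostStretched.modelIdeal hh s t q.1 q.2))) ∧
    -- the complete intersections of codimension two and length ten
    ({c : k | c ≠ 0}.Infinite ∧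
      (∀ c : k, c ≠ 0 →
        AlmostStretched.IsCodimTwoCompleteIntersection
            (AlmostStretched.modelIdeal le_rfl 6 3 1
              (MvPowerSeries.C c : MvPowerSeries (Fin 2) k)) ∧
          Module.length (MvPowerSeries (Fin 2) k)
            (MvPowerSeries (Fin 2) k ⧸ AlmostStretched.modelIdeal le_rfl 6 3 1
              (MvPowerSeries.C c : MvPowerSeries (Fin 2) k)) = 10 ∧
          AlmostStretched.IsAlmostStretchedGorenstein
            (MvPowerSeries (Fin 2) k ⧸ AlmostStretched.modelIdeal le_rfl 6 3 1
              (MvPowerSeries.C c : MvPowerSeries (Fin 2) k)) 2 6 3) ∧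
      (∀ c c' : k, c ≠ 0 → c' ≠ 0 →
        AlmostStretched.IdealIso
          (AlmostStretched.modelIdeal le_rfl 6 3 1
            (MvPowerSeries.C c : MvPowerSeries (Fin 2) k))
          (AlmostStretched.modelIdeal le_rfl 6 3 1
            (MvPowerSeries.C c' : MvPowerSeries (Fin 2) k)) → c = c')) := by
  have hex : ∀ c : k, c ≠ 0 → AlmostStretched.IsAlmostStretchedGorenstein
      (MvPowerSeries (Fin 2) k ⧸ AlmostStretched.modelIdeal le_rfl 6 3 1
        (MvPowerSeries.C c : MvPowerSeries (Fin 2) k)) 2 6 3 := by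
    intro c hc
    rw [← AlmostStretched.aeval_x₁_C le_rfl c]
    exact AlmostStretched.isAlmostStretchedGorenstein_modelIdeal (by simpa using hc) (by omega)
      (by omega)
  refine ⟨fun h s t hh ht hst I hI => ⟨fun hreg => ?_, fun r hrt hr => ?_⟩, ?_,
    fun c hc => ⟨?_, ?_, hex c hc⟩, fun c c' hc hc' e => ?_⟩
  · exact AlmostStretched.classification_regular hh ht hst hI hreg
  · exact AlmostStretched.classification_nonregular hh ht hst hI hrt hr
  · exact (Set.finite_singleton (0 : k)).infinite_compl
  · refine AlmostStretched.isCodimTwoCompleteIntersection_modelIdeal ?_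
    rw [MvPowerSeries.isUnit_iff_constantCoeff]
    simpa using hc
  · rw [Module.length_eq_of_surjective (R := MvPowerSeries (Fin 2) k ⧸
      AlmostStretched.modelIdeal le_rfl 6 3 1 (MvPowerSeries.C c : MvPowerSeries (Fin 2) k))
      Ideal.Quotient.mk_surjective]
    exact AlmostStretched.length_eq_ten (hex c hc)
  · -- Both `I_{1,c}` and `I_{1,c'}` are members of the list for `(6, 3)`, where `r = 1`.
    have hu := (AlmostStretched.classification_nonregular (r := 1) le_rfl (by omega) (by omega)
      (hex c hc) (by omega) (by omega)).unique
      (y₁ := (1, MvPowerSeries.C c)) (y₂ := (1, MvPowerSeries.C c'))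
      ⟨Or.inr (Or.inl ⟨rfl, c, hc, rfl⟩), ⟨AlgEquiv.refl⟩⟩
      ⟨Or.inr (Or.inl ⟨rfl, c', hc', rfl⟩), e⟩
    have h1 := congrArg (fun q => MvPowerSeries.constantCoeff q.2) hu
    simpa using h1
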